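/- **Theorem 1 (Efficient algorithm).** Let $p,T\ge 0$ be integers, let $F_0,\dots,F_T\in\mathbb{R}^p$ be given vectors (the values $\widetilde F^*(\widehat\mu_t)$ of an approximate backward mapping) and let $\lambda_0,\dots,\lambda_T\ge 0$. For $q\in\{0\}\cup[1,\infty)$ and $\gamma\in[0,1]$ let ProxGL be the problem $$\min_{\theta_0,\dots,\theta_T\in\mathbb{R}^p}\ \gamma\sum_{t=0}^T\|\theta_t\|_0+(1-\gamma)\sum_{t=1}^T\|\theta_t-\theta_{t-1}\|_q^q\quad\text{subject to}\quad \|\theta_t-F_t\|_\infty\le\lambda_t,\ t=0,\dots,T,$$ where $\|v\|_0$ is the number of nonzero entries of $v$, $\|v\|_q^q=\sum_{i}|v_i|^q$ for $q\ge 1$, and $\|v\|_q^q$ is read as $\|v\|_0$ for $q=0$. There are one algorithm and one constant $C$, independent of $p,T,q,F,\lambda$, such that for all $p$, $T$, $q$, $F$, $\lambda$ as above the algorithm computes an entire solution path of ProxGL over all $\gamma\in[0,1]$ in at most $C\,pT^3$ elementary operations, where $p$ and $T$ are replaced by $1$ if they are $0$. Here an algorithm is a program for a sequential (single-thread) random access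 machine with exact real arithmetic: addition, subtraction, multiplication, division and comparison of reals, evaluation of the scalar penalty $x\mapsto|x|^q$ (for $q=0$: $x\mapsto 1$ if $x\ne 0$ and $0$ if $x=0$), addition, truncated subtraction and comparison of natural-number indices, conversion of an index to a real, and access to a memory cell each cost one operation. The inputs are $p,T,F,\lambda$. The path is output coordinate by coordinate: for each coordinate $i$ a number $m_i$ of pieces, breakpoints $0=g_{i,0}\le g_{i,1}\le\dots\le g_{i,m_i}=1$ and trajectories $x_{i,j}\in\mathbb{R}^{T+1}$, $0\le j<m_i$, such that for every $\gamma\in[0,1]$ and every choice of indices $j_i<m_i$ with $g_{i,j_i}\le\gamma\le g_{i,j_i+1}$, the sequence with entries $\theta_{t;i}=(x_{i,j_i})_t$ is an optimal solution of ProxGL at $\gamma$. -/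

import Mathlib

/-! ### The optimization problem -/

namespace ProxGL

/-- The number of nonzero entries of a vector. -/
noncomputable def l0norm {p : ℕ} (v : Fin p → ℝ) : ℕ :=
  (Finset.univ.filter (fun i => v i ≠ 0)).card

/-- The temporal regularizer of a vector: the `q`-th power of the `q`-norm for `q ≠ 0`,
and the number of nonzero entries for `q = 0`. -/
noncomputable def lqPow {p : ℕ} (q : ℝ) (v : Fin p → ℝ) : ℝ :=
  if q = 0 then (l0norm v : ℝ) else ∑ i, |v i| ^ q

/-- The objective; `θ t i` is coordinate `i` of the parameter at time `t = 0, …, T`. -/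
noncomputable def objective {p T : ℕ} (q γ : ℝ) (θ : Fin (T + 1) → Fin p → ℝ) : ℝ :=
  γ * ∑ t, (l0norm (θ t) : ℝ) + (1 - γ) * ∑ t : Fin T, lqPow q (θ t.succ - θ t.castSucc)

/-- The feasible set: the sup-norm ball of radius `lam t` around `F t` at each time `t`, where
`F t` is the approximate backward mapping at time `t`. -/
def feasible {p T : ℕ} (F : Fin (T + 1) → Fin p → ℝ) (lam : Fin (T + 1) → ℝ) :
    Set (Fin (T + 1) → Fin p → ℝ) :=
  {θ | ∀ t, ‖θ t - F t‖ ≤ lam t}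

/-- `θ` is an optimal solution at the parameter `γ`. -/
def IsSolution {p T : ℕ} (q γ : ℝ) (F : Fin (T + 1) → Fin p → ℝ) (lam : Fin (T + 1) → ℝ)
    (θ : Fin (T + 1) → Fin p → ℝ) : Prop :=
  θ ∈ feasible F lam ∧ IsMinOn (objective q γ) (feasible F lam) θ

/-- A complete description of a solution path over `γ ∈ [0,1]`, coordinate by coordinate.
Coordinate `i` has `m i` pieces; piece `j < m i` is the interval `[g i j, g i (j + 1)]` of values
of `γ`, and on it the coordinate follows the trajectory `t ↦ x i j t`. The pieces of each
coordinate cover `[0,1]`, and for every `γ ∈ [0,1]` putting together, for each coordinate, the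
trajectory of a piece that contains `γ` gives an optimal solution. -/
structure IsSolutionPath {p T : ℕ} (q : ℝ) (F : Fin (T + 1) → Fin p → ℝ)
    (lam : Fin (T + 1) → ℝ) (m : Fin p → ℕ) (g : Fin p → ℕ → ℝ)
    (x : Fin p → ℕ → Fin (T + 1) → ℝ) : Prop where
  first : ∀ i, g i 0 = 0
  last : ∀ i, g i (m i) = 1
  mono : ∀ i, ∀ j < m i, g i j ≤ g i (j + 1)
  optimal : ∀ γ ∈ Set.Icc (0 : ℝ) 1, ∀ J : Fin p → ℕ,
    (∀ i, J i < m i ∧ g i (J i) ≤ γ ∧ γ ≤ g i (J i + 1)) →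
      IsSolution q γ F lam (fun t i => x i (J i) t)

end ProxGL

/-! ### The machine: a sequential real RAM with unit costs

The memory consists of index variables and index arrays (natural numbers), and of real variables
and real arrays. Arrays have up to three indices: the cell `(a, i, j, k)` is the entry `(i, j, k)`
of the array `a`. Indices can be added, subtracted (truncated at zero) and compared; reals can be
added, subtracted, multiplied, divided and compared exactly, and the scalar temporal penalty can
be evaluated. Indices can be converted to reals, but not conversely. -/

namespace RealRAM

/-- The scalar temporal penalty `|x| ^ q`, which for `q = 0` is the indicator of `x ≠ 0`. -/
noncomputable def penalty (q x : ℝ) : ℝ :=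
  if q = 0 then (if x = 0 then 0 else 1) else |x| ^ q

/-- The contents of the memory. -/
structure Store where
  nvar : ℕ → ℕ
  rvar : ℕ → ℝ
  ncell : ℕ × ℕ × ℕ × ℕ → ℕ
  rcell : ℕ × ℕ × ℕ × ℕ → ℝ

/-- Index expressions. -/
inductive NExp where
  | lit (n : ℕ)
  | var (v : ℕ)
  | get (a : ℕ) (i j k : NExp)
  | add (e₁ e₂ : NExp)
  | sub (e₁ e₂ : NExp)

/-- Real expressions; the only constants are those obtained from index expressions. -/
inductive RExp where
  | ofN (e : NExp)
  | var (v : ℕ)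
  | get (a : ℕ) (i j k : NExp)
  | add (e₁ e₂ : RExp)
  | sub (e₁ e₂ : RExp)
  | mul (e₁ e₂ : RExp)
  | div (e₁ e₂ : RExp)
  | pen (e : RExp)

/-- Tests. -/
inductive Test where
  | nle (e₁ e₂ : NExp)
  | rle (e₁ e₂ : RExp)
  | not (b : Test)
  | and (b₁ b₂ : Test)

/-- Programs. -/
inductive Prog where
  | skip
  | nset (v : ℕ) (e : NExp)
  | rset (v : ℕ) (e : RExp)
  | nput (a : ℕ) (i j k e : NExp)
  | rput (a : ℕ) (i j k : NExp) (e : RExp)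
  | seq (P₁ P₂ : Prog)
  | ite (b : Test) (P₁ P₂ : Prog)
  | loop (b : Test) (P : Prog)

def NExp.eval (s : Store) : NExp → ℕ
  | .lit n => n
  | .var v => s.nvar v
  | .get a i j k => s.ncell (a, i.eval s, j.eval s, k.eval s)
  | .add e₁ e₂ => e₁.eval s + e₂.eval s
  | .sub e₁ e₂ => e₁.eval s - e₂.eval s

noncomputable def RExp.eval (q : ℝ) (s : Store) : RExp → ℝ
  | .ofN e => (e.eval s : ℝ)
  | .var v => s.rvar v
  | .get a i j k => s.rcell (a, i.eval s, j.eval s, k.eval s)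
  | .add e₁ e₂ => e₁.eval q s + e₂.eval q s
  | .sub e₁ e₂ => e₁.eval q s - e₂.eval q s
  | .mul e₁ e₂ => e₁.eval q s * e₂.eval q s
  | .div e₁ e₂ => e₁.eval q s / e₂.eval q s
  | .pen e => penalty q (e.eval q s)

def Test.Holds (q : ℝ) (s : Store) : Test → Prop
  | .nle e₁ e₂ => e₁.eval s ≤ e₂.eval s
  | .rle e₁ e₂ => e₁.eval q s ≤ e₂.eval q s
  | .not b => ¬ b.Holds q s
  | .and b₁ b₂ => b₁.Holds q s ∧ b₂.Holds q s

/-! The cost of an expression or a test is the number of elementary operations in it, every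
constant, memory access, arithmetic operation, comparison and connective counting one. -/

def NExp.cost : NExp → ℕ
  | .lit _ => 1
  | .var _ => 1
  | .get _ i j k => i.cost + j.cost + k.cost + 1
  | .add e₁ e₂ => e₁.cost + e₂.cost + 1
  | .sub e₁ e₂ => e₁.cost + e₂.cost + 1

def RExp.cost : RExp → ℕ
  | .ofN e => e.cost + 1
  | .var _ => 1
  | .get _ i j k => i.cost + j.cost + k.cost + 1
  | .add e₁ e₂ => e₁.cost + e₂.cost + 1
  | .sub e₁ e₂ => e₁.cost + e₂.cost + 1
  | .mul e₁ e₂ => e₁.cost + e₂.cost + 1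
  | .div e₁ e₂ => e₁.cost + e₂.cost + 1
  | .pen e => e.cost + 1

def Test.cost : Test → ℕ
  | .nle e₁ e₂ => e₁.cost + e₂.cost + 1
  | .rle e₁ e₂ => e₁.cost + e₂.cost + 1
  | .not b => b.cost + 1
  | .and b₁ b₂ => b₁.cost + b₂.cost + 1

/-- `Exec q P s n s'`: the program `P`, started in the memory `s`, halts after `n` elementary
operations in the memory `s'`. -/
inductive Exec (q : ℝ) : Prog → Store → ℕ → Store → Prop where
  | skip (s : Store) : Exec q .skip s 1 s
  | nset (v : ℕ) (e : NExp) (s : Store) :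
      Exec q (.nset v e) s (e.cost + 1) { s with nvar := Function.update s.nvar v (e.eval s) }
  | rset (v : ℕ) (e : RExp) (s : Store) :
      Exec q (.rset v e) s (e.cost + 1) { s with rvar := Function.update s.rvar v (e.eval q s) }
  | nput (a : ℕ) (i j k e : NExp) (s : Store) :
      Exec q (.nput a i j k e) s (i.cost + j.cost + k.cost + e.cost + 1)
        { s with ncell :=
          Function.update s.ncell (a, i.eval s, j.eval s, k.eval s) (e.eval s) }
  | rput (a : ℕ) (i j k : NExp) (e : RExp) (s : Store) :
      Exec q (.rput a i j k e) s (i.cost + j.cost + k.cost + e.cost + 1)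
        { s with rcell :=
          Function.update s.rcell (a, i.eval s, j.eval s, k.eval s) (e.eval q s) }
  | seq {P₁ P₂ : Prog} {s₁ s₂ s₃ : Store} {n₁ n₂ : ℕ} (h₁ : Exec q P₁ s₁ n₁ s₂)
      (h₂ : Exec q P₂ s₂ n₂ s₃) : Exec q (.seq P₁ P₂) s₁ (n₁ + n₂) s₃
  | iteTrue {b : Test} {P₁ P₂ : Prog} {s₁ s₂ : Store} {n : ℕ} (hb : b.Holds q s₁)
      (h : Exec q P₁ s₁ n s₂) : Exec q (.ite b P₁ P₂) s₁ (b.cost + n) s₂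
  | iteFalse {b : Test} {P₁ P₂ : Prog} {s₁ s₂ : Store} {n : ℕ} (hb : ¬ b.Holds q s₁)
      (h : Exec q P₂ s₁ n s₂) : Exec q (.ite b P₁ P₂) s₁ (b.cost + n) s₂
  | loopTrue {b : Test} {P : Prog} {s₁ s₂ s₃ : Store} {n₁ n₂ : ℕ} (hb : b.Holds q s₁)
      (h₁ : Exec q P s₁ n₁ s₂) (h₂ : Exec q (.loop b P) s₂ n₂ s₃) :
      Exec q (.loop b P) s₁ (b.cost + n₁ + n₂) s₃
  | loopFalse {b : Test} {P : Prog} {s : Store} (hb : ¬ b.Holds q s) :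
      Exec q (.loop b P) s b.cost s

end RealRAM

/-! ### Input and output conventions -/

namespace ProxGL

/-- The initial memory: `p` and `T` in the index variables `0` and `1`, the centres `F` in the
real array `0`, the radii `lam` in the real array `1`, and zero everywhere else. -/
noncomputable def input {p T : ℕ} (F : Fin (T + 1) → Fin p → ℝ) (lam : Fin (T + 1) → ℝ) :
    RealRAM.Store where
  nvar v := if v = 0 then p else if v = 1 then T else 0
  rvar _ := 0
  ncell _ := 0
  rcell
    | (0, t, i, 0) => if h : t < T + 1 ∧ i < p then F ⟨t, h.1⟩ ⟨i, h.2⟩ else 0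
    | (1, t, 0, 0) => if h : t < T + 1 then lam ⟨t, h⟩ else 0
    | _ => 0

/-- The numbers of pieces that a final memory holds, in the index array `0`. -/
def outPieces (p : ℕ) (s : RealRAM.Store) (i : Fin p) : ℕ := s.ncell (0, i, 0, 0)

/-- The breakpoints that a final memory holds, in the real array `2`. -/
def outBreaks (p : ℕ) (s : RealRAM.Store) (i : Fin p) (j : ℕ) : ℝ := s.rcell (2, i, j, 0)

/-- The trajectories that a final memory holds, in the real array `3`. -/
def outValues (p T : ℕ) (s : RealRAM.Store) (i : Fin p) (j : ℕ) (t : Fin (T + 1)) : ℝ :=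
  s.rcell (3, i, j, t)

end ProxGL

/-
The problem separates into coordinates. In one coordinate, fix the number `k` of nonzero entries.
For `q = 0` a minimizer of the variation may be taken piecewise constant. For `q ≥ 1`, moving an
entry to the midpoint of its neighbours does not increase the variation, by convexity, so among
the minimizers the one with the least sum of squared increments is linear between the times at
which it is zero or at one of its bounds. Either way, minimizing the variation for every budget
`k` at once is a shortest path problem on the `O(T)` pairs of a time and one of these three
states; it has `O(T ^ 2)` budgeted nodes with `O(T)` predecessors each. With `V k` its value, the
optimal value at `γ` is the minimum over `k` of the lines `γ * k + (1 - γ) * V k`, whose lower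
envelope is swept from `γ = 0`, along decreasing slopes.
-/

namespace RealRAM

/-! ### Cost bounds and frames -/

/-- The memory after assigning `x` to the index variable `v`. -/
@[simps] def Store.setN (s : Store) (v x : ℕ) : Store :=
  { s with nvar := Function.update s.nvar v x }

/-- The memory after assigning `x` to the real variable `v`. -/
@[simps] noncomputable def Store.setR (s : Store) (v : ℕ) (x : ℝ) : Store :=
  { s with rvar := Function.update s.rvar v x }

/-- The memory after storing `x` in the index cell `c`. -/
@[simps] def Store.putN (s : Store) (c : ℕ × ℕ × ℕ × ℕ) (x : ℕ) : Store :=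
  { s with ncell := Function.update s.ncell c x }

/-- The memory after storing `x` in the real cell `c`. -/
@[simps] noncomputable def Store.putR (s : Store) (c : ℕ × ℕ × ℕ × ℕ) (x : ℝ) : Store :=
  { s with rcell := Function.update s.rcell c x }

/-- A bound for the cost of a program in which every loop makes at most `N` iterations; both
branches of a conditional are charged. -/
def Prog.costBound (N : ℕ) : Prog → ℕ
  | .skip => 1
  | .nset _ e => e.cost + 1
  | .rset _ e => e.cost + 1
  | .nput _ i j k e => i.cost + j.cost + k.cost + e.cost + 1
  | .rput _ i j k e => i.cost + j.cost + k.cost + e.cost + 1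
  | .seq P₁ P₂ => P₁.costBound N + P₂.costBound N
  | .ite b P₁ P₂ => b.cost + (P₁.costBound N + P₂.costBound N)
  | .loop b P => (N + 1) * (b.cost + P.costBound N)

/-- The nesting depth of the loops of a program. -/
def Prog.depth : Prog → ℕ
  | .seq P₁ P₂ => max P₁.depth P₂.depth
  | .ite _ P₁ P₂ => max P₁.depth P₂.depth
  | .loop _ P => P.depth + 1
  | _ => 0

theorem Prog.costBound_le_mul_pow {N : ℕ} (hN : 1 ≤ N) (P : Prog) :
    P.costBound N ≤ P.costBound 1 * N ^ P.depth := by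
  have le_mul_pow (a d : ℕ) : a ≤ a * N ^ d := Nat.le_mul_of_pos_right _ (Nat.pow_pos hN)
  have add_le (a b c d : ℕ) : a * N ^ c + b * N ^ d ≤ (a + b) * N ^ max c d := by
    rw [Nat.add_mul]
    gcongr <;> first | exact hN | simp
  induction P with
  | seq P₁ P₂ ih₁ ih₂ => exact (Nat.add_le_add ih₁ ih₂).trans (add_le _ _ _ _)
  | ite b P₁ P₂ ih₁ ih₂ =>
    simp only [costBound, depth]
    rw [Nat.add_mul]
    exact Nat.add_le_add (le_mul_pow _ _) ((Nat.add_le_add ih₁ ih₂).trans (add_le _ _ _ _))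
  | loop b P ih =>
    calc (N + 1) * (b.cost + P.costBound N)
        ≤ (N + N) * (b.cost * N ^ P.depth + P.costBound 1 * N ^ P.depth) :=
          Nat.mul_le_mul (by omega) (Nat.add_le_add (le_mul_pow _ _) ih)
      _ = (1 + 1) * (b.cost + P.costBound 1) * N ^ (P.depth + 1) := by ring
  | _ => simp only [costBound, depth, pow_zero, mul_one, le_refl]

/-- The granularity at which memory accesses are tracked: single variables and whole arrays. -/
inductive Loc where
  | nvar (v : ℕ)
  | rvar (v : ℕ)
  | narr (a : ℕ)
  | rarr (a : ℕ)
  deriving DecidableEq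

/-- The locations that a program may modify. -/
def Prog.writes : Prog → List Loc
  | .skip => []
  | .nset v _ => [.nvar v]
  | .rset v _ => [.rvar v]
  | .nput a _ _ _ _ => [.narr a]
  | .rput a _ _ _ _ => [.rarr a]
  | .seq P₁ P₂ => P₁.writes ++ P₂.writes
  | .ite _ P₁ P₂ => P₁.writes ++ P₂.writes
  | .loop _ P => P.writes

/-- Two memories have the same contents at a location. -/
def Loc.Agree (s s' : Store) : Loc → Prop
  | .nvar v => s'.nvar v = s.nvar v
  | .rvar v => s'.rvar v = s.rvar v
  | .narr a => ∀ x, s'.ncell (a, x) = s.ncell (a, x)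
  | .rarr a => ∀ x, s'.rcell (a, x) = s.rcell (a, x)

/-- Two memories agree outside of the locations `L`. -/
def Frame (L : List Loc) (s s' : Store) : Prop := ∀ l ∉ L, l.Agree s s'

namespace Frame

variable {L L' : List Loc} {s s₁ s₂ s₃ s' : Store} {v a : ℕ}

theorem nvar (h : Frame L s s') (hv : .nvar v ∉ L) : s'.nvar v = s.nvar v := h _ hv

theorem rvar (h : Frame L s s') (hv : .rvar v ∉ L) : s'.rvar v = s.rvar v := h _ hv

theorem ncell (h : Frame L s s') (ha : .narr a ∉ L) (x : ℕ × ℕ × ℕ) :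
    s'.ncell (a, x) = s.ncell (a, x) := h _ ha x

theorem rcell (h : Frame L s s') (ha : .rarr a ∉ L) (x : ℕ × ℕ × ℕ) :
    s'.rcell (a, x) = s.rcell (a, x) := h _ ha x

theorem refl (L : List Loc) (s : Store) : Frame L s s
  | .nvar _, _ | .rvar _, _ => rfl
  | .narr _, _ | .rarr _, _ => fun _ => rfl

theorem trans (h : Frame L s₁ s₂) (h' : Frame L s₂ s₃) : Frame L s₁ s₃
  | .nvar _, hl => (h'.nvar hl).trans (h.nvar hl)
  | .rvar _, hl => (h'.rvar hl).trans (h.rvar hl)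
  | .narr _, hl => fun x => (h'.ncell hl x).trans (h.ncell hl x)
  | .rarr _, hl => fun x => (h'.rcell hl x).trans (h.rcell hl x)

theorem mono (h : Frame L s s') (hL : L ⊆ L') : Frame L' s s' :=
  fun l hl => h l fun h' => hl (hL h')

end Frame

theorem frame_setN (s : Store) (v x : ℕ) : Frame [.nvar v] s (s.setN v x)
  | .nvar _, hw => Function.update_of_ne (by simpa using hw) _ _
  | .rvar _, _ => rfl
  | .narr _, _ | .rarr _, _ => fun _ => rfl

theorem frame_setR (s : Store) (v : ℕ) (x : ℝ) : Frame [.rvar v] s (s.setR v x)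
  | .rvar _, hw => Function.update_of_ne (by simpa using hw) _ _
  | .nvar _, _ => rfl
  | .narr _, _ | .rarr _, _ => fun _ => rfl

theorem frame_putN (s : Store) (a : ℕ) (c : ℕ × ℕ × ℕ) (x : ℕ) :
    Frame [.narr a] s (s.putN (a, c) x)
  | .narr _, hb => fun _ => Function.update_of_ne (fun h => hb (by simp [(Prod.mk.inj h).1])) _ _
  | .nvar _, _ | .rvar _, _ => rfl
  | .rarr _, _ => fun _ => rfl

theorem frame_putR (s : Store) (a : ℕ) (c : ℕ × ℕ × ℕ) (x : ℝ) :
    Frame [.rarr a] s (s.putR (a, c) x)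
  | .rarr _, hb => fun _ => Function.update_of_ne (fun h => hb (by simp [(Prod.mk.inj h).1])) _ _
  | .nvar _, _ | .rvar _, _ => rfl
  | .narr _, _ => fun _ => rfl

theorem Exec.frame {q : ℝ} {P : Prog} {s s' : Store} {n : ℕ} (h : Exec q P s n s') :
    Frame P.writes s s' := by
  induction h with
  | skip s => exact Frame.refl _ _
  | nset v e s => exact frame_setN _ _ _
  | rset v e s => exact frame_setR _ _ _
  | nput a i j k e s => exact frame_putN _ _ _ _
  | rput a i j k e s => exact frame_putR _ _ _ _
  | seq _ _ ih₁ ih₂ =>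
    exact (ih₁.mono (List.subset_append_left _ _)).trans (ih₂.mono (List.subset_append_right _ _))
  | iteTrue _ _ ih => exact ih.mono (List.subset_append_left _ _)
  | iteFalse _ _ ih => exact ih.mono (List.subset_append_right _ _)
  | loopTrue _ _ _ ih₁ ih₂ => exact ih₁.trans ih₂
  | loopFalse _ => exact Frame.refl _ _

/-! ### Total correctness -/

/-- Started in `s`, the program halts after at most `c` operations in a memory that satisfies
`Q`. -/
def HaltsWithin (q : ℝ) (c : ℕ) (P : Prog) (s : Store) (Q : Store → Prop) : Prop :=
  ∃ n s', Exec q P s n s' ∧ n ≤ c ∧ Q s'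

/-- Started in `s`, the program halts within its syntactic cost bound in a memory that satisfies
`Q`. -/
def Run (q : ℝ) (N : ℕ) (P : Prog) (s : Store) (Q : Store → Prop) : Prop :=
  HaltsWithin q (P.costBound N) P s Q

namespace Run

variable {q : ℝ} {N : ℕ} {s : Store} {Q Q' : Store → Prop} {P P₁ P₂ : Prog}

theorem mono (h : Run q N P s Q) (hQ : ∀ s', Q s' → Frame P.writes s s' → Q' s') :
    Run q N P s Q' := by
  obtain ⟨n, s', he, hn, h⟩ := h
  exact ⟨n, s', he, hn, hQ s' h he.frame⟩

theorem skip (h : Q s) : Run q N .skip s Q := ⟨_, _, .skip s, le_rfl, h⟩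

theorem nset {v : ℕ} {e : NExp} (h : Q (s.setN v (e.eval s))) : Run q N (.nset v e) s Q :=
  ⟨_, _, .nset v e s, le_rfl, h⟩

theorem rset {v : ℕ} {e : RExp} (h : Q (s.setR v (e.eval q s))) : Run q N (.rset v e) s Q :=
  ⟨_, _, .rset v e s, le_rfl, h⟩

theorem nput {a : ℕ} {i j k e : NExp}
    (h : Q (s.putN (a, i.eval s, j.eval s, k.eval s) (e.eval s))) :
    Run q N (.nput a i j k e) s Q :=
  ⟨_, _, .nput a i j k e s, le_rfl, h⟩

theorem rput {a : ℕ} {i j k : NExp} {e : RExp}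
    (h : Q (s.putR (a, i.eval s, j.eval s, k.eval s) (e.eval q s))) :
    Run q N (.rput a i j k e) s Q :=
  ⟨_, _, .rput a i j k e s, le_rfl, h⟩

theorem seq (h : Run q N P₁ s (fun s' => Run q N P₂ s' Q)) : Run q N (.seq P₁ P₂) s Q := by
  obtain ⟨n₁, s₁, h₁, hn₁, n₂, s₂, h₂, hn₂, hQ⟩ := h
  exact ⟨_, _, h₁.seq h₂, Nat.add_le_add hn₁ hn₂, hQ⟩

theorem ite {b : Test} (h₁ : b.Holds q s → Run q N P₁ s Q)
    (h₂ : ¬ b.Holds q s → Run q N P₂ s Q) : Run q N (.ite b P₁ P₂) s Q := by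
  by_cases hb : b.Holds q s
  · obtain ⟨n, s', h, hn, hQ⟩ := h₁ hb
    exact ⟨_, _, .iteTrue hb h, by simp only [Prog.costBound]; omega, hQ⟩
  · obtain ⟨n, s', h, hn, hQ⟩ := h₂ hb
    exact ⟨_, _, .iteFalse hb h, by simp only [Prog.costBound]; omega, hQ⟩

end Run

/-- `while v < hi do P; v := v + 1`. -/
def Prog.countUp (v : ℕ) (hi : NExp) (P : Prog) : Prog :=
  .loop (.nle (.add (.var v) (.lit 1)) hi) (.seq P (.nset v (.add (.var v) (.lit 1))))

/-- `for v = lo, …, hi - 1 do P`; the bound `hi` is evaluated anew before every iteration. -/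
def Prog.forLoop (v : ℕ) (lo hi : NExp) (P : Prog) : Prog := .seq (.nset v lo) (.countUp v hi P)

namespace HaltsWithin

variable {q : ℝ} {v c a b : ℕ} {lo hi : NExp} {P : Prog} {s : Store}

theorem countUp (I : ℕ → Store → Prop) (d : ℕ) (hd : s.nvar v + d = b)
    (hv : .nvar v ∉ P.writes) (init : I (s.nvar v) s)
    (hhi : ∀ s', Frame (Prog.countUp v hi P).writes s s' → hi.eval s' = b)
    (step : ∀ k s', s.nvar v ≤ k → k < b → s'.nvar v = k →
      Frame (Prog.countUp v hi P).writes s s' → I k s' →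
      HaltsWithin q c P s' fun s'' => I (k + 1) (s''.setN v (k + 1))) :
    HaltsWithin q (d * (hi.cost + c + 8) + (hi.cost + 8)) (.countUp v hi P) s (I b) := by
  induction d generalizing s with
  | zero =>
    refine ⟨_, s, .loopFalse ?_, ?_, ?_⟩
    · simp only [Test.Holds, NExp.eval, hhi s (Frame.refl _ _)]; omega
    · simp only [Test.cost, NExp.cost]; omega
    · rw [← hd]; exact init
  | succ d ih =>
    obtain ⟨n, s₁, he, hn, hI⟩ := step _ s le_rfl (by omega) rfl (Frame.refl _ _) init
    have body : Exec q (.seq P (.nset v (.add (.var v) (.lit 1)))) s (n + 4)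
        (s₁.setN v (s.nvar v + 1)) := by
      have incr := Exec.nset (q := q) v (.add (.var v) (.lit 1)) s₁
      simp only [NExp.eval, he.frame.nvar hv] at incr
      exact he.seq incr
    have hv' : (s₁.setN v (s.nvar v + 1)).nvar v = s.nvar v + 1 := by simp
    obtain ⟨n', s₂, he₂, hn', hI'⟩ := ih (by omega) (by rw [hv']; exact hI)
      (fun s' h => hhi s' (body.frame.trans h))
      (fun k s' h₁ h₂ h₃ h₄ => step k s' (by omega) h₂ h₃ (body.frame.trans h₄))
    refine ⟨_, s₂, .loopTrue ?_ body he₂, ?_, hI'⟩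
    · simp only [Test.Holds, NExp.eval, hhi s (Frame.refl _ _)]; omega
    · simp only [Test.cost, NExp.cost]
      rw [Nat.add_mul]; omega

theorem forLoop (I : ℕ → Store → Prop) (ha : lo.eval s = a) (hab : a ≤ b)
    (hv : .nvar v ∉ P.writes) (init : I a (s.setN v a))
    (hhi : ∀ s', Frame (Prog.forLoop v lo hi P).writes s s' → hi.eval s' = b)
    (step : ∀ k s', a ≤ k → k < b → s'.nvar v = k → Frame (Prog.forLoop v lo hi P).writes s s' →
      I k s' → HaltsWithin q c P s' fun s'' => I (k + 1) (s''.setN v (k + 1))) :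
    HaltsWithin q ((lo.cost + 1) + ((b - a) * (hi.cost + c + 8) + (hi.cost + 8)))
      (.forLoop v lo hi P) s (I b) := by
  have start : Exec q (.nset v lo) s _ (s.setN v a) := ha ▸ Exec.nset v lo s
  have hv' : (s.setN v a).nvar v = a := by simp
  have frame (s' : Store) (h : Frame (Prog.countUp v hi P).writes (s.setN v a) s') :
      Frame (Prog.forLoop v lo hi P).writes s s' :=
    (start.frame.mono (List.subset_append_left _ _)).trans
      (h.mono (List.subset_append_right _ _))
  obtain ⟨n, s', he, hn, hI⟩ := countUp (q := q) (c := c) I (b - a) (by omega) hv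
    (by rw [hv']; exact init) (fun s' h => hhi s' (frame s' h))
    (fun k s' h₁ h₂ h₃ h₄ => step k s' (by omega) h₂ h₃ (frame s' h₄))
  exact ⟨_, s', start.seq he, by omega, hI⟩

end HaltsWithin

theorem Run.forLoop {q : ℝ} {N v a b : ℕ} {lo hi : NExp} {P : Prog} {s : Store}
    (I : ℕ → Store → Prop) (ha : lo.eval s = a) (hab : a ≤ b) (hN : b - a ≤ N)
    (hv : .nvar v ∉ P.writes) (init : I a (s.setN v a))
    (hhi : ∀ s', Frame (Prog.forLoop v lo hi P).writes s s' → hi.eval s' = b)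
    (step : ∀ k s', a ≤ k → k < b → s'.nvar v = k → Frame (Prog.forLoop v lo hi P).writes s s' →
      I k s' → Run q N P s' fun s'' => I (k + 1) (s''.setN v (k + 1))) :
    Run q N (.forLoop v lo hi P) s (I b) := by
  obtain ⟨n, s', he, hn, hI⟩ := HaltsWithin.forLoop I ha hab hv init hhi step
  refine ⟨n, s', he, hn.trans ?_, hI⟩
  simp only [Prog.forLoop, Prog.countUp, Prog.costBound, Test.cost, NExp.cost]
  have : (b - a) * (hi.cost + P.costBound N + 8) ≤ N * (hi.cost + P.costBound N + 8) :=
    Nat.mul_le_mul_right _ hN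
  nlinarith

end RealRAM

/-! ### The penalty -/

namespace RealRAM

section Penalty

variable {q : ℝ}

theorem penalty_of_ne_zero (hq : q ≠ 0) (x : ℝ) : penalty q x = |x| ^ q := if_neg hq

theorem penalty_zero (hq : q = 0 ∨ 1 ≤ q) : penalty q 0 = 0 := by
  rcases hq with rfl | hq
  · simp [penalty]
  · have : q ≠ 0 := by linarith
    simp [penalty, this]

theorem penalty_nonneg (q x : ℝ) : 0 ≤ penalty q x := by
  unfold penalty
  split_ifs <;> positivity

theorem penalty_zero_le_one (x : ℝ) : penalty 0 x ≤ 1 := by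
  unfold penalty
  split_ifs <;> simp

theorem penalty_zero_of_ne_zero {x : ℝ} (hx : x ≠ 0) : penalty 0 x = 1 := by
  simp [penalty, hx]

theorem convexOn_penalty (hq : 1 ≤ q) : ConvexOn ℝ Set.univ (penalty q) := by
  rw [funext (penalty_of_ne_zero (by linarith : q ≠ 0))]
  have image_eq : (fun x : ℝ => |x|) '' Set.univ = Set.Ici 0 := by
    ext y
    exact ⟨by rintro ⟨x, -, rfl⟩; exact abs_nonneg x, fun hy => ⟨y, trivial, abs_of_nonneg hy⟩⟩
  refine (image_eq ▸ convexOn_rpow hq).comp (convexOn_norm convex_univ) ?_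
  rw [image_eq]
  exact (Real.monotoneOn_rpow_Ici_of_exponent_nonneg (by linarith))

theorem continuous_penalty (hq : 1 ≤ q) : Continuous (penalty q) := by
  rw [funext (penalty_of_ne_zero (by linarith : q ≠ 0))]
  exact continuous_abs.rpow_const fun _ => Or.inr (by linarith)

theorem penalty_two_le_one_iff (hq : q = 0 ∨ 1 ≤ q) : penalty q 2 ≤ 1 ↔ q = 0 := by
  rcases hq with rfl | hq
  · simp [penalty]
  · have hq₀ : q ≠ 0 := by linarith
    rw [penalty_of_ne_zero hq₀, abs_two]
    exact iff_of_false (Real.one_lt_rpow (by norm_num) (by linarith)).not_ge hq₀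

end Penalty

end RealRAM

namespace ProxGL

open RealRAM Finset

/-! ### Sparsity and variation of sequences -/

/-- The number of nonzero entries of `x` at the times in `(s, t]`. -/
noncomputable def nnz (x : ℕ → ℝ) (s t : ℕ) : ℕ := #{r ∈ Ioc s t | x r ≠ 0}

/-- The variation of `x` between the times `s` and `t`, where an increment `d` is charged
`φ d`. -/
noncomputable def variation (φ : ℝ → ℝ) (x : ℕ → ℝ) (s t : ℕ) : ℝ :=
  ∑ r ∈ Ico s t, φ (x (r + 1) - x r)

section Sequences

variable {φ : ℝ → ℝ} {x y : ℕ → ℝ} {s t u : ℕ}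

theorem nnz_congr (h : ∀ r, s < r → r ≤ t → x r = y r) : nnz x s t = nnz y s t :=
  congrArg card <| filter_congr fun r hr => by
    rw [mem_Ioc] at hr
    rw [h r hr.1 hr.2]

theorem nnz_add_nnz (x : ℕ → ℝ) (hst : s ≤ t) (htu : t ≤ u) :
    nnz x s t + nnz x t u = nnz x s u := by
  rw [nnz, nnz, nnz, ← card_union_of_disjoint, ← filter_union, Ioc_union_Ioc_eq_Ioc hst htu]
  exact disjoint_filter_filter (Ioc_disjoint_Ioc_of_le le_rfl)

theorem nnz_le (x : ℕ → ℝ) (s t : ℕ) : nnz x s t ≤ t - s :=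
  (card_filter_le _ _).trans (Nat.card_Ioc s t).le

theorem nnz_le_of_last_eq_zero (hx : x t = 0) : nnz x s t ≤ t - s - 1 := by
  rw [← Nat.card_Ioo]
  refine card_le_card fun r hr => ?_
  simp only [mem_filter, mem_Ioc] at hr
  have : r ≠ t := fun h => hr.2 (h ▸ hx)
  simp only [mem_Ioo]
  omega

theorem variation_congr (h : ∀ r, s ≤ r → r ≤ t → x r = y r) :
    variation φ x s t = variation φ y s t :=
  sum_congr rfl fun r hr => by
    rw [mem_Ico] at hr
    rw [h r hr.1 hr.2.le, h (r + 1) (by omega) hr.2]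

theorem variation_add_variation (φ : ℝ → ℝ) (x : ℕ → ℝ) (hst : s ≤ t) (htu : t ≤ u) :
    variation φ x s t + variation φ x t u = variation φ x s u :=
  sum_Ico_consecutive _ hst htu

theorem variation_nonneg (hφ : ∀ d, 0 ≤ φ d) (x : ℕ → ℝ) (s t : ℕ) : 0 ≤ variation φ x s t :=
  sum_nonneg fun _ _ => hφ _

theorem variation_of_linear {c : ℝ} (h : ∀ r, s ≤ r → r < t → x (r + 1) - x r = c) :
    variation φ x s t = (t - s : ℕ) * φ c := by
  rw [variation, sum_congr rfl fun r hr => by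
    rw [h r (mem_Ico.1 hr).1 (mem_Ico.1 hr).2]]
  simp

theorem nnz_of_ne_zero (h : ∀ r, s < r → r ≤ t → x r ≠ 0) : nnz x s t = t - s := by
  rw [nnz, filter_true_of_mem fun r hr => h r (mem_Ioc.1 hr).1 (mem_Ioc.1 hr).2, Nat.card_Ioc]

theorem eq_sub_mul_of_linear {c : ℝ} (h : ∀ r, s ≤ r → r < t → x (r + 1) - x r = c) {r : ℕ}
    (hs : s ≤ r) (ht : r ≤ t) : x r = x t - c * (t - r : ℕ) := by
  induction ht using Nat.decreasingInduction with
  | self => simp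
  | of_succ r hr ih =>
    have step := h r hs hr
    have : t - r = t - (r + 1) + 1 := by omega
    rw [ih (by omega)] at step
    rw [this]
    push_cast
    linarith

theorem eq_of_constant (h : ∀ r, s ≤ r → r < t → x (r + 1) = x r) {r : ℕ}
    (hs : s ≤ r) (ht : r ≤ t) : x r = x t := by
  simpa using eq_sub_mul_of_linear (fun r h₁ h₂ => sub_eq_zero.2 (h r h₁ h₂)) hs ht

theorem le_variation {φ : ℝ → ℝ} (hφ : ∀ d, 0 ≤ φ d) (x : ℕ → ℝ) (hst : s < t) :
    φ (x (s + 1) - x s) ≤ variation φ x s t :=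
  single_le_sum (f := fun r => φ (x (r + 1) - x r)) (fun _ _ => hφ _) (left_mem_Ico.2 hst)

end Sequences

/-! ### The problem of one coordinate as a shortest path problem -/

/-- The problem of one coordinate: the temporal exponent and the bounds at the times
`1, …, T + 1`. Times are shifted by one to make room for a start node at time `0`. -/
structure CoordProblem where
  q : ℝ
  T : ℕ
  lo : ℕ → ℝ
  hi : ℕ → ℝ

/-- A table for the dynamic program. The entry at a node `n` and a budget `k` tells whether `n`
can be reached with at most `k` nonzero entries, at which cost and by which sequence. -/
structure Tableau where
  reachable : ℕ → ℕ → Prop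
  value : ℕ → ℕ → ℝ
  traj : ℕ → ℕ → ℕ → ℝ

namespace CoordProblem

variable (D : CoordProblem)

/-- A sequence that satisfies the bounds at all times. -/
def Feasible (x : ℕ → ℝ) : Prop := ∀ r, 1 ≤ r → r ≤ D.T + 1 → x r ∈ Set.Icc (D.lo r) (D.hi r)

/-- The last node. The nodes are `0` (the start), `3 * t + b` for `1 ≤ t ≤ T + 1` and `b < 3`,
and this one. A path through the node `3 * t + b` stands for a sequence that at time `t` is at its
lower bound (`b = 0`), at its upper bound (`b = 1`) or zero (`b = 2`); for `q = 0`, only the last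
of these is enforced. -/
def endNode : ℕ := 3 * (D.T + 2)

/-- The time of a node. -/
def time (n : ℕ) : ℕ := min (n / 3) (D.T + 1)

/-- The value of a sequence at a node. -/
noncomputable def nodeVal (n : ℕ) : ℝ :=
  if n % 3 = 0 then D.lo (D.time n) else if n % 3 = 1 then D.hi (D.time n) else 0

/-- The number of entries that are charged as nonzero on the edge from `m` to `n`: all of those
after `m`, except for the one at a zero node `n`. -/
def weight (m n : ℕ) : ℕ := D.time n - D.time m - (if n % 3 = 2 then 1 else 0)

/-- The value of a constant piece from `m` to `n`: the least one above the lower bounds. -/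
noncomputable def constVal (m n : ℕ) : ℝ :=
  if n % 3 = 2 then 0
  else partialSups (fun j => D.lo (D.time m + 1 + j)) (D.time n - (D.time m + 1))

/-- The value at `n` of the piece from `m` to `n`, unless it is dictated by `m`. -/
noncomputable def targetVal (m n : ℕ) : ℝ :=
  if D.endNode ≤ n then D.constVal m n else D.nodeVal n

/-- The value at `m` of the piece from `m` to `n`. -/
noncomputable def sourceVal (m n : ℕ) : ℝ :=
  if D.time m = 0 then D.targetVal m n else D.nodeVal m

/-- The value at `n` of the piece from `m` to `n`. -/
noncomputable def lastVal (m n : ℕ) : ℝ :=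
  if D.q = 0 then D.constVal m n
  else if D.endNode ≤ n then D.sourceVal m n else D.targetVal m n

/-- The slope of the piece from `m` to `n`: for `q = 0` pieces are constant and the jump takes
place right after `m`, for `q ≠ 0` they interpolate linearly. -/
noncomputable def slope (m n : ℕ) : ℝ :=
  if D.q = 0 then 0 else (D.lastVal m n - D.sourceVal m n) / (D.time n - D.time m : ℕ)

/-- The variation that is charged on the edge from `m` to `n`. -/
noncomputable def edgeCost (m n : ℕ) : ℝ :=
  if D.q = 0 then
    if D.time m = 0 ∨ D.time n ≤ D.time m ∨ (m % 3 = 2 ∧ n % 3 = 2) then 0 else 1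
  else (D.time n - D.time m : ℕ) * penalty D.q (D.slope m n)

/-- The piece from `m` to `n`, a sequence to be used at the times after `m` up to `n`. -/
noncomputable def piece (m n r : ℕ) : ℝ := D.lastVal m n - D.slope m n * (D.time n - r : ℕ)

/-- The edge from `m` to `n` may be used: its piece satisfies the bounds. -/
def Admissible (m n : ℕ) : Prop :=
  ∀ r, D.time m < r → r ≤ D.time n → D.piece m n r ∈ Set.Icc (D.lo r) (D.hi r)

/-- The edge from `m` to `n` extends a path in the table to one to `n` within the budget `k`. -/
def Cand (A : Tableau) (n k m : ℕ) : Prop :=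
  D.Admissible m n ∧ D.weight m n ≤ k ∧ A.reachable m (k - D.weight m n)

/-- The table satisfies the optimality equation at the node `n` with the budget `k`. Nodes `m`
and `n` are joined by an edge if `m / 3 < n / 3`. -/
structure Cell (A : Tableau) (n k : ℕ) : Prop where
  attained : A.reachable n k → ∃ m, m / 3 < n / 3 ∧ D.Cand A n k m ∧
    A.value n k = A.value m (k - D.weight m n) + D.edgeCost m n ∧
    ∀ r, 1 ≤ r → r ≤ D.time n →
      A.traj n k r = if r ≤ D.time m then A.traj m (k - D.weight m n) r else D.piece m n r
  bound : ∀ m, m / 3 < n / 3 → D.Cand A n k m →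
    A.reachable n k ∧ A.value n k ≤ A.value m (k - D.weight m n) + D.edgeCost m n

/-- The table solves the optimality equations; among the nodes at time `0`, only the start is
reachable. -/
structure IsTable (A : Tableau) : Prop where
  source : ∀ k ≤ D.T + 1, A.reachable 0 k ∧ A.value 0 k = 0
  dead : ∀ k ≤ D.T + 1, ¬ A.reachable 1 k ∧ ¬ A.reachable 2 k
  cell : ∀ n, 3 ≤ n → n ≤ D.endNode → ∀ k ≤ D.T + 1, D.Cell A n k

variable {D} {m n r : ℕ}

theorem time_le (D : CoordProblem) (n : ℕ) : D.time n ≤ D.T + 1 := min_le_right _ _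

theorem time_endNode : D.time D.endNode = D.T + 1 := by simp [time, endNode]

theorem time_le_time (h : m / 3 < n / 3) : D.time m ≤ D.time n := by
  unfold time; omega

theorem time_lt_time (h : m / 3 < n / 3) (hn : n < D.endNode) : D.time m < D.time n := by
  unfold time; unfold endNode at hn; omega

theorem nodeVal_eq_zero (h : n % 3 = 2) : D.nodeVal n = 0 := by simp [nodeVal, h]

theorem edgeCost_nonneg (m n : ℕ) : 0 ≤ D.edgeCost m n := by
  unfold edgeCost
  have := penalty_nonneg D.q (D.slope m n)
  split_ifs <;> positivity

theorem piece_add_one_sub (h : r < D.time n) :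
    D.piece m n (r + 1) - D.piece m n r = D.slope m n := by
  have : D.time n - r = D.time n - (r + 1) + 1 := by omega
  simp only [piece, this]
  push_cast
  ring

theorem piece_time (m n : ℕ) : D.piece m n (D.time n) = D.lastVal m n := by simp [piece]

theorem piece_time_source (hq : D.q ≠ 0) (h : D.time m < D.time n) :
    D.piece m n (D.time m) = D.sourceVal m n := by
  have : ((D.time n - D.time m : ℕ) : ℝ) ≠ 0 := Nat.cast_ne_zero.2 (by omega)
  rw [piece, slope, if_neg hq]
  field_simp
  ring

theorem piece_of_q_eq_zero (hq : D.q = 0) (m n r : ℕ) : D.piece m n r = D.constVal m n := by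
  simp [piece, slope, lastVal, hq]

theorem slope_eq_zero_of_time_eq_zero (hm : D.time m = 0) : D.slope m n = 0 := by
  unfold slope lastVal sourceVal
  split_ifs <;> simp

theorem lastVal_eq_nodeVal (hn : n < D.endNode) (h : D.q ≠ 0 ∨ n % 3 = 2) :
    D.lastVal m n = D.nodeVal n := by
  by_cases hq : D.q = 0
  · have hz := h.neg_resolve_left hq
    rw [lastVal, if_pos hq, constVal, if_pos hz, nodeVal_eq_zero hz]
  · rw [lastVal, if_neg hq, if_neg (by omega), targetVal, if_neg (by omega)]

/-! ### Soundness of the dynamic program -/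

variable (D) in
/-- The sequence `x` has the value that the node `n` stands for. -/
def Visits (x : ℕ → ℝ) (n : ℕ) : Prop :=
  3 ≤ n → n < D.endNode → (D.q ≠ 0 ∨ n % 3 = 2) → x (D.time n) = D.nodeVal n

variable (D) in
/-- Up to the node `n`, the sequence `x` is feasible, has at most `k` nonzero entries and variation
at most `v`. -/
structure Realizes (x : ℕ → ℝ) (n k : ℕ) (v : ℝ) : Prop where
  mem_Icc : ∀ r, 1 ≤ r → r ≤ D.time n → x r ∈ Set.Icc (D.lo r) (D.hi r)
  nnz_le : nnz x 0 (D.time n) ≤ k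
  variation_le : variation (penalty D.q) x 1 (D.time n) ≤ v
  visits : D.Visits x n

section Sound

variable {x y : ℕ → ℝ}

theorem nnz_piece_le (hmn : m / 3 < n / 3) (hn : n ≤ D.endNode)
    (hx : ∀ r, D.time m < r → r ≤ D.time n → x r = D.piece m n r) :
    nnz x (D.time m) (D.time n) ≤ D.weight m n := by
  unfold weight
  split_ifs with hz
  · have hn' : n < D.endNode := by unfold endNode at *; omega
    refine nnz_le_of_last_eq_zero ?_
    rw [hx _ (time_lt_time hmn hn') le_rfl, piece_time, lastVal_eq_nodeVal hn' (Or.inr hz),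
      nodeVal_eq_zero hz]
  · exact nnz_le _ _ _

theorem variation_piece_of_q_ne_zero (hq : D.q ≠ 0) (hm : 3 ≤ m) (hmn : D.time m < D.time n)
    (hm' : m < D.endNode) (hv : D.Visits x m)
    (hx : ∀ r, D.time m < r → r ≤ D.time n → x r = D.piece m n r) :
    variation (penalty D.q) x (D.time m) (D.time n) = D.edgeCost m n := by
  have hx' (r : ℕ) (h₁ : D.time m ≤ r) (h₂ : r ≤ D.time n) : x r = D.piece m n r := by
    rcases h₁.eq_or_lt with rfl | h₁
    · have : D.time m ≠ 0 := by unfold time; omega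
      rw [hv hm hm' (Or.inl hq), piece_time_source hq hmn, sourceVal, if_neg this]
    · exact hx r h₁ h₂
  rw [variation_congr hx', edgeCost, if_neg hq]
  exact variation_of_linear fun r _ h => piece_add_one_sub h

theorem variation_piece_le_of_q_eq_zero (hq : D.q = 0) (hm : 3 ≤ m) (hmn : D.time m < D.time n)
    (hm' : m < D.endNode) (hv : D.Visits x m)
    (hx : ∀ r, D.time m < r → r ≤ D.time n → x r = D.piece m n r) :
    variation (penalty D.q) x (D.time m) (D.time n) ≤ D.edgeCost m n := by
  have hm₀ : D.time m ≠ 0 := by unfold time; omega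
  have inner : variation (penalty D.q) x (D.time m + 1) (D.time n) = 0 := by
    rw [variation_congr fun r h₁ h₂ => hx r h₁ h₂, variation_of_linear fun r _ h =>
      piece_add_one_sub h, slope, if_pos hq, penalty_zero (Or.inl hq), mul_zero]
  have jump : variation (penalty D.q) x (D.time m) (D.time m + 1) =
      penalty 0 (D.constVal m n - x (D.time m)) := by
    rw [variation, Nat.Ico_succ_singleton, sum_singleton, hx _ (by omega) (by omega),
      piece_of_q_eq_zero hq, hq]
  rw [← variation_add_variation _ x (Nat.le_succ _) hmn, inner, add_zero, jump, edgeCost, if_pos hq]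
  by_cases hz : m % 3 = 2 ∧ n % 3 = 2
  · rw [hv hm hm' (Or.inr hz.1), nodeVal_eq_zero hz.1, constVal, if_pos hz.2, sub_zero,
      penalty_zero (Or.inl rfl), if_pos (Or.inr (Or.inr hz))]
  · rw [if_neg (by omega)]
    exact penalty_zero_le_one _

theorem variation_piece_le (hmn : m / 3 < n / 3) (hn : n ≤ D.endNode) (hm : D.time m ≠ 0)
    (hv : D.Visits x m) (hx : ∀ r, D.time m < r → r ≤ D.time n → x r = D.piece m n r) :
    variation (penalty D.q) x (D.time m) (D.time n) ≤ D.edgeCost m n := by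
  have hm₃ : 3 ≤ m := by
    unfold time at hm; omega
  rcases (time_le_time hmn).eq_or_lt with h | h
  · rw [← h, variation, Ico_self, sum_empty]
    exact edgeCost_nonneg m n
  by_cases hq : D.q = 0
  · exact variation_piece_le_of_q_eq_zero hq hm₃ h (by omega) hv hx
  · exact (variation_piece_of_q_ne_zero hq hm₃ h (by omega) hv hx).le

theorem Realizes.extend (hq : D.q = 0 ∨ 1 ≤ D.q) {k : ℕ} {v : ℝ} (h : D.Realizes y m k v)
    (hmn : m / 3 < n / 3) (hn : n ≤ D.endNode) (hadm : D.Admissible m n)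
    (hx : ∀ r, 1 ≤ r → r ≤ D.time n → x r = if r ≤ D.time m then y r else D.piece m n r) :
    D.Realizes x n (k + D.weight m n) (v + D.edgeCost m n) := by
  have hmn' : D.time m ≤ D.time n := time_le_time hmn
  have hx₁ (r : ℕ) (h₁ : 1 ≤ r) (h₂ : r ≤ D.time m) : x r = y r := by
    rw [hx r h₁ (by omega), if_pos h₂]
  have hx₂ (r : ℕ) (h₁ : D.time m < r) (h₂ : r ≤ D.time n) : x r = D.piece m n r := by
    rw [hx r (by omega) h₂, if_neg (by omega)]
  have hvm : D.Visits x m := fun h₁ h₂ h₃ => by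
    rw [hx₁ _ (by unfold time; omega) le_rfl, h.visits h₁ h₂ h₃]
  refine ⟨fun r h₁ h₂ => ?_, ?_, ?_, fun _ hn' h₃ => ?_⟩
  · rcases Nat.lt_or_ge (D.time m) r with hr | hr
    · exact hx₂ r hr h₂ ▸ hadm r hr h₂
    · exact hx₁ r h₁ hr ▸ h.mem_Icc r h₁ hr
  · rw [← nnz_add_nnz x (Nat.zero_le _) hmn', nnz_congr hx₁]
    exact Nat.add_le_add h.nnz_le (nnz_piece_le hmn hn hx₂)
  · have hv := h.variation_le
    rcases Nat.eq_zero_or_pos (D.time m) with h₀ | h₀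
    · rw [variation_congr fun r h₁ h₂ => hx₂ r (by omega) h₂, variation_of_linear fun r _ h =>
        piece_add_one_sub h, slope_eq_zero_of_time_eq_zero h₀, penalty_zero hq, mul_zero]
      exact add_nonneg ((variation_nonneg (penalty_nonneg _) _ _ _).trans hv)
        (edgeCost_nonneg m n)
    · rw [← variation_add_variation _ x h₀ hmn', variation_congr hx₁]
      exact add_le_add hv (variation_piece_le hmn hn (by omega) hvm hx₂)
  · rw [hx₂ _ (time_lt_time hmn hn') le_rfl, piece_time, lastVal_eq_nodeVal hn' h₃]

variable {A : Tableau}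

theorem IsTable.realizes (hq : D.q = 0 ∨ 1 ≤ D.q) (H : D.IsTable A) {n k : ℕ}
    (hn : n ≤ D.endNode) (hk : k ≤ D.T + 1) (h : A.reachable n k) :
    D.Realizes (A.traj n k) n k (A.value n k) := by
  induction n using Nat.strong_induction_on generalizing k with
  | _ n ih =>
  rcases Nat.lt_or_ge n 3 with hn₃ | hn₃
  · obtain rfl : n = 0 := by
      have := H.dead k hk
      interval_cases n <;> tauto
    have h₀ : D.time 0 = 0 := by simp [time]
    refine ⟨fun r h₁ h₂ => by omega, by simp [h₀, nnz], ?_, fun h => by omega⟩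
    simp [h₀, variation, (H.source k hk).2]
  · obtain ⟨m, hm, ⟨hadm, hw, hreach⟩, hval, htraj⟩ := (H.cell n hn₃ hn k hk).attained h
    have := (ih m (by omega) (by omega) (by omega) hreach).extend hq hm hn hadm htraj
    rwa [Nat.sub_add_cancel hw, ← hval] at this

theorem IsTable.sound (hq : D.q = 0 ∨ 1 ≤ D.q) (H : D.IsTable A) {k : ℕ} (hk : k ≤ D.T + 1)
    (h : A.reachable D.endNode k) :
    D.Feasible (A.traj D.endNode k) ∧ nnz (A.traj D.endNode k) 0 (D.T + 1) ≤ k ∧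
      variation (penalty D.q) (A.traj D.endNode k) 1 (D.T + 1) ≤ A.value D.endNode k := by
  have := H.realizes hq le_rfl hk h
  rw [← time_endNode]
  refine ⟨fun r h₁ h₂ => this.mem_Icc r h₁ ?_, this.nnz_le, this.variation_le⟩
  rwa [time_endNode]

end Sound

end CoordProblem

/-! ### Completeness of the dynamic program -/

namespace CoordProblem

variable {D : CoordProblem} {A : Tableau} {x : ℕ → ℝ} {m n s t : ℕ}

variable (D) in
/-- The edge from `m` to `n` is admissible and charges at most what the sequence `x` pays between
the times of the two nodes. -/
structure Link (x : ℕ → ℝ) (m n : ℕ) : Prop where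
  admissible : D.Admissible m n
  weight_le : D.weight m n ≤ nnz x (D.time m) (D.time n)
  edgeCost_le : D.edgeCost m n ≤ variation (penalty D.q) x (D.time m) (D.time n)

variable (D) in
/-- The node at time `t` on the path that stands for the sequence `x`. -/
noncomputable def nodeAt (x : ℕ → ℝ) (t : ℕ) : ℕ :=
  if t = 0 ∨ t = D.T + 2 then 3 * t
  else if x t = 0 then 3 * t + 2
  else if x t = D.lo t then 3 * t
  else 3 * t + 1

theorem edgeCost_eq_zero_of_time_eq_zero (hq : D.q = 0 ∨ 1 ≤ D.q) (hm : D.time m = 0) :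
    D.edgeCost m n = 0 := by
  rw [edgeCost, slope_eq_zero_of_time_eq_zero hm, penalty_zero hq, mul_zero, if_pos (Or.inl hm),
    ite_self]

theorem nodeAt_div_three (x : ℕ → ℝ) (t : ℕ) : D.nodeAt x t / 3 = t := by
  unfold nodeAt
  split_ifs <;> omega

theorem time_nodeAt (x : ℕ → ℝ) (t : ℕ) : D.time (D.nodeAt x t) = min t (D.T + 1) := by
  rw [time, nodeAt_div_three]

theorem nodeAt_mod_three (h₁ : 1 ≤ t) (h₂ : t ≤ D.T + 1) : D.nodeAt x t % 3 = 2 ↔ x t = 0 := by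
  rw [nodeAt, if_neg (by omega)]
  split_ifs with h
  · exact iff_of_true (by omega) h
  all_goals exact iff_of_false (by omega) h

theorem nodeAt_endTime (x : ℕ → ℝ) : D.nodeAt x (D.T + 2) = D.endNode := if_pos (Or.inr rfl)

theorem nodeVal_nodeAt (h₁ : 1 ≤ t) (h₂ : t ≤ D.T + 1)
    (h : x t = 0 ∨ x t = D.lo t ∨ x t = D.hi t) : D.nodeVal (D.nodeAt x t) = x t := by
  have ht : ¬ (t = 0 ∨ t = D.T + 2) := by omega
  rw [nodeVal, time_nodeAt, min_eq_left h₂, nodeAt, if_neg ht]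
  by_cases hz : x t = 0
  · rw [if_pos hz, if_neg (by omega), if_neg (by omega), hz]
  by_cases hlo : x t = D.lo t
  · rw [if_neg hz, if_pos hlo, if_pos (by omega), hlo]
  · rw [if_neg hz, if_neg hlo, if_neg (by omega), if_pos (by omega)]
    tauto

theorem exists_last_lt {S : ℕ → Prop} (h₀ : S 0) (ht : 0 < t) :
    ∃ s < t, S s ∧ ∀ r, s < r → r < t → ¬ S r := by
  classical
  refine ⟨Nat.findGreatest S (t - 1), ?_, Nat.findGreatest_spec (Nat.zero_le _) h₀,
    fun r h₁ h₂ => Nat.findGreatest_is_greatest h₁ (by omega)⟩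
  have := Nat.findGreatest_le (P := S) (t - 1)
  omega

theorem Link.relax (hq : D.q = 0 ∨ 1 ≤ D.q) (H : D.IsTable A) {k : ℕ} (hk : k ≤ D.T + 1)
    (hmn : m / 3 < n / 3) (hn : n ≤ D.endNode) (h : D.Link x m n)
    (ih : ∀ k ≤ D.T + 1, nnz x 0 (D.time m) ≤ k →
      A.reachable m k ∧ A.value m k ≤ variation (penalty D.q) x 1 (D.time m))
    (hx : nnz x 0 (D.time n) ≤ k) :
    A.reachable n k ∧ A.value n k ≤ variation (penalty D.q) x 1 (D.time n) := by
  have hw := h.weight_le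
  have hle := time_le_time hmn (D := D)
  rw [← nnz_add_nnz x (Nat.zero_le _) hle] at hx
  obtain ⟨hreach, hval⟩ := ih (k - D.weight m n) (by omega) (by omega)
  obtain ⟨hreach', hval'⟩ := (H.cell n (by omega) hn k hk).bound m hmn
    ⟨h.admissible, by omega, hreach⟩
  refine ⟨hreach', hval'.trans ((add_le_add_left hval _).trans ?_)⟩
  rcases Nat.eq_zero_or_pos (D.time m) with h₀ | h₀
  · rw [edgeCost_eq_zero_of_time_eq_zero hq h₀, h₀, add_zero]
    exact variation_nonneg (penalty_nonneg _) _ _ _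
  · rw [← variation_add_variation _ x h₀ hle]
    exact add_le_add_right h.edgeCost_le _

theorem IsTable.complete_of_links (hq : D.q = 0 ∨ 1 ≤ D.q) (H : D.IsTable A) {S : ℕ → Prop}
    (source : S 0) (target : S (D.T + 2))
    (link : ∀ s t, s < t → t ≤ D.T + 2 → S s → S t → (∀ r, s < r → r < t → ¬ S r) →
      D.Link x (D.nodeAt x s) (D.nodeAt x t))
    {k : ℕ} (hk : k ≤ D.T + 1) (hx : nnz x 0 (D.T + 1) ≤ k) :
    A.reachable D.endNode k ∧ A.value D.endNode k ≤ variation (penalty D.q) x 1 (D.T + 1) := by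
  have main (t : ℕ) (ht : t ≤ D.T + 2) (hS : S t) (k : ℕ) (hk : k ≤ D.T + 1)
      (hx : nnz x 0 (D.time (D.nodeAt x t)) ≤ k) :
      A.reachable (D.nodeAt x t) k ∧
        A.value (D.nodeAt x t) k ≤ variation (penalty D.q) x 1 (D.time (D.nodeAt x t)) := by
    induction t using Nat.strong_induction_on generalizing k with
    | _ t ih =>
    rcases Nat.eq_zero_or_pos t with rfl | ht₀
    · rw [show D.nodeAt x 0 = 0 from if_pos (Or.inl rfl)]
      refine ⟨(H.source k hk).1, ?_⟩
      rw [(H.source k hk).2]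
      exact variation_nonneg (penalty_nonneg _) _ _ _
    · obtain ⟨s, hst, hs, hbetween⟩ := exists_last_lt source ht₀
      have hs' := nodeAt_div_three (D := D) x s
      have ht' := nodeAt_div_three (D := D) x t
      refine (link s t hst ht hs hS hbetween).relax hq H hk (by omega) ?_
        (ih s hst (by omega) hs) hx
      rcases ht.eq_or_lt with rfl | ht
      · exact (nodeAt_endTime x).le
      · unfold endNode; omega
  have := main (D.T + 2) le_rfl target k hk
  rw [nodeAt_endTime, time_endNode] at this
  exact this hx

theorem weight_nodeAt_le (hst : s < t) (ht : t ≤ D.T + 2) (h : ∀ r, s < r → r < t → x r ≠ 0) :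
    D.weight (D.nodeAt x s) (D.nodeAt x t) ≤
      nnz x (D.time (D.nodeAt x s)) (D.time (D.nodeAt x t)) := by
  rw [weight, time_nodeAt, time_nodeAt, min_eq_left (by omega : s ≤ D.T + 1)]
  have hnnz : nnz x s (t - 1) = t - 1 - s := nnz_of_ne_zero fun r h₁ h₂ => h r h₁ (by omega)
  rcases ht.eq_or_lt with rfl | ht'
  · rw [min_eq_right (by omega), show D.T + 1 = D.T + 2 - 1 from rfl, hnnz]
    exact Nat.sub_le _ _
  rw [min_eq_left (by omega)]
  by_cases hz : x t = 0
  · rw [if_pos ((nodeAt_mod_three (by omega) (by omega)).2 hz),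
      ← nnz_add_nnz x (show s ≤ t - 1 by omega) (Nat.sub_le _ _), hnnz]
    omega
  · rw [nnz_of_ne_zero fun r h₁ h₂ => h₂.eq_or_lt.elim (fun e => e ▸ hz) (h r h₁)]
    exact Nat.sub_le _ _

theorem constVal_mem_Icc {c : ℝ} (hz : n % 3 = 2 → c = 0)
    (hc : ∀ r, D.time m < r → r ≤ D.time n → c ∈ Set.Icc (D.lo r) (D.hi r)) {r : ℕ}
    (h₁ : D.time m < r) (h₂ : r ≤ D.time n) : D.constVal m n ∈ Set.Icc (D.lo r) (D.hi r) := by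
  unfold constVal
  split_ifs with h
  · exact hz h ▸ hc r h₁ h₂
  · refine ⟨?_, le_trans (partialSups_le _ _ _ fun j hj => (hc _ (by omega) (by omega)).1)
      (hc r h₁ h₂).2⟩
    have := le_partialSups_of_le (fun j => D.lo (D.time m + 1 + j))
      (show r - (D.time m + 1) ≤ D.time n - (D.time m + 1) by omega)
    rwa [Nat.add_sub_cancel' h₁] at this

/-! #### Penalizing the number of changes -/

theorem link_of_constant (hq : D.q = 0) (hx : D.Feasible x) (hst : s < t) (ht : t ≤ D.T + 2)
    (hs : s = 0 ∨ x s = 0 ∨ x (s + 1) ≠ x s)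
    (hbetween : ∀ r, s < r → r < t → x r ≠ 0 ∧ (r ≤ D.T → x (r + 1) = x r)) :
    D.Link x (D.nodeAt x s) (D.nodeAt x t) := by
  have hts : D.time (D.nodeAt x s) = s := by rw [time_nodeAt]; omega
  have htt := time_nodeAt (D := D) x t
  have hconst (r : ℕ) (h₁ : s < r) (h₂ : r ≤ min t (D.T + 1)) : x r = x (min t (D.T + 1)) :=
    eq_of_constant (s := s + 1) (fun r _ _ => (hbetween r (by omega) (by omega)).2 (by omega)) h₁ h₂
  have hzero (h : s < min t (D.T + 1)) :
      D.nodeAt x t % 3 = 2 ↔ x (min t (D.T + 1)) = 0 := by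
    rcases ht.eq_or_lt with rfl | ht'
    · rw [nodeAt_endTime, endNode, min_eq_right (by omega)]
      exact iff_of_false (by omega) (hbetween _ (by omega) (by omega)).1
    · rw [min_eq_left (by omega)]
      exact nodeAt_mod_three (by omega) (by omega)
  refine ⟨fun r h₁ h₂ => ?_, weight_nodeAt_le hst ht fun r h₁ h₂ => (hbetween r h₁ h₂).1, ?_⟩
  · rw [piece_of_q_eq_zero hq]
    refine constVal_mem_Icc (hzero (by omega)).1 (fun r h₁ h₂ => ?_) h₁ h₂
    rw [← hconst r (by omega) (by omega)]
    exact hx r (by omega) (by omega)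
  · rw [edgeCost, if_pos hq, hts, htt]
    split_ifs with h
    · exact variation_nonneg (penalty_nonneg _) _ _ _
    have hjump : x (s + 1) ≠ x s := by
      rcases hs with hs | hs | hs
      · omega
      · rw [hconst _ (by omega) (by omega), hs, Ne, ← hzero (by omega)]
        rw [nodeAt_mod_three (by omega) (by omega)] at h
        tauto
      · exact hs
    rw [← penalty_zero_of_ne_zero (sub_ne_zero.2 hjump), ← hq]
    exact le_variation (penalty_nonneg _) x (by omega)

theorem IsTable.complete_of_q_eq_zero (hq : D.q = 0) (H : D.IsTable A) (hx : D.Feasible x) {k : ℕ}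
    (hk : k ≤ D.T + 1) (hc : nnz x 0 (D.T + 1) ≤ k) :
    A.reachable D.endNode k ∧ A.value D.endNode k ≤ variation (penalty D.q) x 1 (D.T + 1) := by
  refine H.complete_of_links (Or.inl hq)
    (S := fun t => t = 0 ∨ t = D.T + 2 ∨ x t = 0 ∨ t ≤ D.T ∧ x (t + 1) ≠ x t)
    (Or.inl rfl) (Or.inr (Or.inl rfl)) (fun s t hst ht hs _ hbetween => ?_) hk hc
  refine link_of_constant hq hx hst ht ?_ fun r h₁ h₂ => ?_
  · have : s ≠ D.T + 2 := by omega
    tauto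
  · have := hbetween r h₁ h₂
    tauto

/-! #### Penalizing the size of changes -/

/-- The increments of a sequence, extended by zero outside the times `1, …, T`. -/
noncomputable def incr (T : ℕ) (y : ℕ → ℝ) (t : ℕ) : ℝ :=
  if 1 ≤ t ∧ t ≤ T then y (t + 1) - y t else 0

variable (D) in
/-- The sequence `y` is at one of its bounds or at zero. -/
def Touches (y : ℕ → ℝ) (t : ℕ) : Prop := y t = 0 ∨ y t = D.lo t ∨ y t = D.hi t

variable (D) in
/-- The sequence `y` changes its slope only when it touches a bound or zero. -/
def KinksTouch (y : ℕ → ℝ) : Prop :=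
  ∀ t, 1 ≤ t → t ≤ D.T + 1 → ¬ D.Touches y t → incr D.T y t = incr D.T y (t - 1)

variable {y : ℕ → ℝ}

theorem KinksTouch.incr_eq (hy : D.KinksTouch y) (ht : t ≤ D.T + 2)
    (hbetween : ∀ r, s < r → r < t → ¬ D.Touches y r) {r : ℕ} (hs : s ≤ r) (hr : r < t) :
    incr D.T y r = incr D.T y s := by
  induction r, hs using Nat.le_induction with
  | base => rfl
  | succ r hs ih =>
    rw [hy _ (by omega) (by omega) (hbetween _ (by omega) hr), ← ih (by omega), Nat.add_sub_cancel]

theorem KinksTouch.sub_eq (hy : D.KinksTouch y) (ht : t ≤ D.T + 2)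
    (hbetween : ∀ r, s < r → r < t → ¬ D.Touches y r) {r : ℕ} (h₁ : 1 ≤ r) (hs : s ≤ r)
    (hr : r < min t (D.T + 1)) : y (r + 1) - y r = incr D.T y s := by
  rw [← hy.incr_eq ht hbetween hs (by omega), incr, if_pos (by omega)]

theorem lastVal_nodeAt (hq : D.q ≠ 0) (hy : D.KinksTouch y) (hst : s < t) (ht : t ≤ D.T + 2)
    (hs : s = 0 ∨ D.Touches y s) (ht' : t = D.T + 2 ∨ D.Touches y t)
    (hbetween : ∀ r, s < r → r < t → ¬ D.Touches y r) (hend : s = 0 → t ≠ D.T + 2) :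
    D.lastVal (D.nodeAt y s) (D.nodeAt y t) = y (min t (D.T + 1)) := by
  rcases ht.eq_or_lt with rfl | htE
  · have hs₀ : s ≠ 0 := fun h => hend h rfl
    have hend : incr D.T y (D.T + 1) = 0 := if_neg (by omega)
    have hconst (r : ℕ) (h₁ : s ≤ r) (h₂ : r < D.T + 1) : y (r + 1) = y r := by
      rw [← sub_eq_zero, hy.sub_eq le_rfl hbetween (by omega) h₁ (by omega),
        ← hy.incr_eq le_rfl hbetween (show s ≤ D.T + 1 by omega) (by omega), hend]
    rw [nodeAt_endTime, lastVal, if_neg hq, if_pos le_rfl, sourceVal, if_neg, nodeVal_nodeAt,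
      min_eq_right (by omega)]
    · exact eq_of_constant hconst le_rfl (by omega)
    · omega
    · omega
    · exact hs.resolve_left hs₀
    · rw [time_nodeAt]; omega
  · have := nodeAt_div_three (D := D) y t
    rw [lastVal_eq_nodeVal (by unfold endNode; omega) (Or.inl hq),
      nodeVal_nodeAt (by omega) (by omega) (ht'.resolve_left (by omega)), min_eq_left (by omega)]

theorem slope_nodeAt (hq : D.q ≠ 0) (hy : D.KinksTouch y) (hst : s < t) (ht : t ≤ D.T + 2)
    (hs : s = 0 ∨ D.Touches y s) (ht' : t = D.T + 2 ∨ D.Touches y t)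
    (hbetween : ∀ r, s < r → r < t → ¬ D.Touches y r) (hlt : s < min t (D.T + 1)) :
    D.slope (D.nodeAt y s) (D.nodeAt y t) = incr D.T y s := by
  have hts : D.time (D.nodeAt y s) = s := by rw [time_nodeAt]; omega
  rcases Nat.eq_zero_or_pos s with rfl | hs₀
  · rw [slope_eq_zero_of_time_eq_zero hts, incr, if_neg (by omega)]
  have hlin := eq_sub_mul_of_linear (fun r h₁ h₂ => hy.sub_eq ht hbetween (by omega) h₁ h₂)
    le_rfl hlt.le
  have hne : ((min t (D.T + 1) - s : ℕ) : ℝ) ≠ 0 := Nat.cast_ne_zero.2 (by omega)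
  rw [slope, if_neg hq, lastVal_nodeAt hq hy hst ht hs ht' hbetween (by omega), sourceVal,
    if_neg (by omega), nodeVal_nodeAt hs₀ (by omega) (hs.resolve_left (by omega)), hts,
    time_nodeAt, hlin]
  field_simp
  ring

theorem KinksTouch.eq_sub_mul (hy : D.KinksTouch y) (ht : t ≤ D.T + 2)
    (hbetween : ∀ r, s < r → r < t → ¬ D.Touches y r) {r : ℕ} (hs : s < r)
    (hr : r ≤ min t (D.T + 1)) :
    y r = y (min t (D.T + 1)) - incr D.T y s * (min t (D.T + 1) - r : ℕ) :=
  eq_sub_mul_of_linear (s := s + 1)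
    (fun _ h₁ h₂ => hy.sub_eq ht hbetween (by omega) (by omega) h₂) hs hr

theorem KinksTouch.admissible (hq : D.q ≠ 0) (hy : D.KinksTouch y) (hfeas : D.Feasible y)
    (hst : s < t) (ht : t ≤ D.T + 2) (hs : s = 0 ∨ D.Touches y s)
    (ht' : t = D.T + 2 ∨ D.Touches y t) (hbetween : ∀ r, s < r → r < t → ¬ D.Touches y r) :
    D.Admissible (D.nodeAt y s) (D.nodeAt y t) := fun r h₁ h₂ => by
  have hts : D.time (D.nodeAt y s) = s := by rw [time_nodeAt]; omega
  have htt := time_nodeAt (D := D) y t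
  have hmem (r : ℕ) (h₁ : s < r) (h₂ : r ≤ min t (D.T + 1)) :
      y (min t (D.T + 1)) - incr D.T y s * (min t (D.T + 1) - r : ℕ) ∈
        Set.Icc (D.lo r) (D.hi r) :=
    hy.eq_sub_mul ht hbetween h₁ h₂ ▸ hfeas r (by omega) (by omega)
  by_cases hend : s = 0 ∧ t = D.T + 2
  · obtain ⟨rfl, rfl⟩ := hend
    have h₀ : incr D.T y 0 = 0 := if_neg (by omega)
    rw [piece, slope_eq_zero_of_time_eq_zero hts, zero_mul, sub_zero, nodeAt_endTime, lastVal,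
      if_neg hq, if_pos le_rfl, sourceVal, if_pos hts, targetVal, if_pos le_rfl]
    rw [nodeAt_endTime] at h₂
    refine constVal_mem_Icc (c := y (D.T + 1)) (by unfold endNode; omega) (fun r h₁ h₂ => ?_) h₁ h₂
    rw [time_endNode] at h₂
    simpa only [h₀, zero_mul, sub_zero, min_eq_right (Nat.le_succ _)] using hmem r (by omega)
      (by omega)
  · rw [piece, slope_nodeAt hq hy hst ht hs ht' hbetween (by omega),
      lastVal_nodeAt hq hy hst ht hs ht' hbetween (by tauto), htt]
    exact hmem r (by omega) (by omega)

theorem KinksTouch.link (hq : 1 ≤ D.q) (hy : D.KinksTouch y) (hfeas : D.Feasible y) (hst : s < t)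
    (ht : t ≤ D.T + 2) (hs : s = 0 ∨ D.Touches y s) (ht' : t = D.T + 2 ∨ D.Touches y t)
    (hbetween : ∀ r, s < r → r < t → ¬ D.Touches y r) :
    D.Link y (D.nodeAt y s) (D.nodeAt y t) := by
  have hq₀ : D.q ≠ 0 := by linarith
  have hts : D.time (D.nodeAt y s) = s := by rw [time_nodeAt]; omega
  refine ⟨hy.admissible hq₀ hfeas hst ht hs ht' hbetween,
    weight_nodeAt_le hst ht fun r h₁ h₂ h₀ => hbetween r h₁ h₂ (Or.inl h₀), ?_⟩
  rcases Nat.eq_zero_or_pos s with rfl | hs₀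
  · rw [edgeCost_eq_zero_of_time_eq_zero (Or.inr hq) hts]
    exact variation_nonneg (penalty_nonneg _) _ _ _
  rw [edgeCost, if_neg hq₀, hts, time_nodeAt, variation_of_linear fun r h₁ h₂ =>
    hy.sub_eq ht hbetween (by omega) h₁ h₂]
  rcases (show s ≤ min t (D.T + 1) by omega).eq_or_lt with h | h
  · simp [← h]
  · rw [slope_nodeAt hq₀ hy hst ht hs ht' hbetween h]

theorem IsTable.complete_of_kinksTouch (hq : 1 ≤ D.q) (H : D.IsTable A) (hy : D.KinksTouch y)
    (hfeas : D.Feasible y) {k : ℕ} (hk : k ≤ D.T + 1) (hc : nnz y 0 (D.T + 1) ≤ k) :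
    A.reachable D.endNode k ∧ A.value D.endNode k ≤ variation (penalty D.q) y 1 (D.T + 1) := by
  refine H.complete_of_links (Or.inr hq) (S := fun t => t = 0 ∨ t = D.T + 2 ∨ D.Touches y t)
    (Or.inl rfl) (Or.inr (Or.inl rfl)) (fun s t hst ht hs ht' hbetween => ?_) hk hc
  exact hy.link hq hfeas hst ht (hs.imp_right (·.resolve_left (by omega)))
    (ht'.resolve_left (by omega)) fun r h₁ h₂ h => hbetween r h₁ h₂ (Or.inr (Or.inr h))

end CoordProblem

/-! ### Smoothing -/

section Update

variable {φ : ℝ → ℝ} {y : ℕ → ℝ} {s t u : ℕ}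

theorem variation_update_last (φ : ℝ → ℝ) (y : ℕ → ℝ) (v : ℝ) (h : s < t) :
    variation φ (Function.update y t v) s t = variation φ y s (t - 1) + φ (v - y (t - 1)) := by
  obtain ⟨t, rfl⟩ : ∃ r, t = r + 1 := ⟨t - 1, by omega⟩
  rw [← variation_add_variation _ _ (Nat.le_of_lt_succ h) t.le_succ,
    variation_congr fun r _ hr => Function.update_of_ne (show r ≠ t + 1 by omega) v y]
  simp [variation]

theorem variation_update_first (φ : ℝ → ℝ) (y : ℕ → ℝ) (v : ℝ) (h : t < u) :
    variation φ (Function.update y t v) t u = φ (y (t + 1) - v) + variation φ y (t + 1) u := by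
  rw [← variation_add_variation _ _ t.le_succ h,
    variation_congr (s := t + 1) fun r hr _ => Function.update_of_ne (show r ≠ t by omega) v y]
  simp [variation]

theorem variation_update (φ : ℝ → ℝ) (y : ℕ → ℝ) (v : ℝ) (hst : s < t) (htu : t < u) :
    variation φ (Function.update y t v) s u = variation φ y s (t - 1) +
      (φ (v - y (t - 1)) + φ (y (t + 1) - v)) + variation φ y (t + 1) u := by
  rw [← variation_add_variation _ _ hst.le htu.le, variation_update_last _ _ _ hst,
    variation_update_first _ _ _ htu]
  ring

theorem convexOn_variation_update (hφ : ConvexOn ℝ Set.univ φ) (y : ℕ → ℝ) (s t u : ℕ) :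
    ConvexOn ℝ Set.univ fun v => variation φ (Function.update y t v) s u := by
  refine ⟨convex_univ, fun v _ w _ a b ha hb hab => ?_⟩
  have hupdate (r : ℕ) : Function.update y t (a • v + b • w) r =
      a • Function.update y t v r + b • Function.update y t w r := by
    simp only [Function.update_apply]
    split_ifs
    · rfl
    · rw [← add_smul, hab, one_smul]
  simp only [variation, smul_sum, ← sum_add_distrib]
  refine sum_le_sum fun r _ => (congrArg φ ?_).trans_le
    (hφ.2 (Set.mem_univ _) (Set.mem_univ _) ha hb hab)
  rw [hupdate, hupdate]
  simp only [smul_sub]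
  abel

theorem continuous_variation (hφ : Continuous φ) (s t : ℕ) :
    Continuous fun y : ℕ → ℝ => variation φ y s t :=
  continuous_finsetSum _ fun r _ =>
    hφ.comp ((continuous_apply (r + 1)).sub (continuous_apply r))

theorem variation_update_midpoint (φ : ℝ → ℝ) (y : ℕ → ℝ) (hst : s < t) (htu : t < u) :
    variation φ (Function.update y t ((y (t - 1) + y (t + 1)) / 2)) s u = variation φ y s u +
      (2 * φ ((1 / 2 : ℝ) • (y t - y (t - 1)) + (1 / 2 : ℝ) • (y (t + 1) - y t)) -
        (φ (y t - y (t - 1)) + φ (y (t + 1) - y t))) := by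
  have hself := variation_update φ y (y t) hst htu
  rw [Function.update_eq_self] at hself
  rw [variation_update _ _ _ hst htu, hself]
  ring_nf

/-- The midpoint of the neighbours, or the only neighbour at the first and the last time, removes
the kink of `y` at `t`. -/
theorem exists_variation_update_le {T : ℕ} (h₁ : 1 ≤ t) (h₂ : t ≤ T + 1)
    (hkink : CoordProblem.incr T y t ≠ CoordProblem.incr T y (t - 1)) : ∃ v,
      (∀ φ, ConvexOn ℝ Set.univ φ → φ 0 = 0 → (∀ d, 0 ≤ φ d) →
        variation φ (Function.update y t v) 1 (T + 1) ≤ variation φ y 1 (T + 1)) ∧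
      variation (· ^ 2) (Function.update y t v) 1 (T + 1) < variation (· ^ 2) y 1 (T + 1) := by
  have hself (φ : ℝ → ℝ) : variation φ y 1 (T + 1) =
      variation φ (Function.update y t (y t)) 1 (T + 1) := by rw [Function.update_eq_self]
  unfold CoordProblem.incr at hkink
  rcases h₁.eq_or_lt with rfl | hlo <;> rcases h₂.eq_or_lt with hhi | hhi
  · exact absurd (by rw [if_neg (by omega), if_neg (by omega)]) hkink
  · rw [if_pos (by omega), if_neg (by omega)] at hkink
    refine ⟨y (1 + 1), fun φ _ h₀ hφ => ?_, ?_⟩ <;>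
      rw [hself, variation_update_first _ _ _ hhi, variation_update_first _ _ _ hhi, sub_self]
    · exact add_le_add_left (h₀.trans_le (hφ _)) _
    · exact add_lt_add_left (by rw [zero_pow two_ne_zero]; positivity) _
  · subst hhi
    rw [if_neg (by omega), if_pos (by omega), Nat.sub_add_cancel h₁] at hkink
    refine ⟨y (T + 1 - 1), fun φ _ h₀ hφ => ?_, ?_⟩ <;>
      rw [hself, variation_update_last _ _ _ hlo, variation_update_last _ _ _ hlo, sub_self]
    · exact add_le_add_right (h₀.trans_le (hφ _)) _
    · have := hkink.symm
      exact add_lt_add_right (by rw [zero_pow two_ne_zero]; positivity) _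
  · rw [if_pos (by omega), if_pos (by omega), Nat.sub_add_cancel h₁] at hkink
    refine ⟨(y (t - 1) + y (t + 1)) / 2, fun φ hφ _ _ => ?_, ?_⟩ <;>
      rw [variation_update_midpoint _ y hlo hhi]
    · have := hφ.2 (Set.mem_univ (y t - y (t - 1))) (Set.mem_univ (y (t + 1) - y t))
        one_half_pos.le one_half_pos.le (add_halves 1)
      simp only [smul_eq_mul] at this ⊢
      linarith
    · have := (even_two.strictConvexOn_pow two_ne_zero).2 (Set.mem_univ (y t - y (t - 1)))
        (Set.mem_univ (y (t + 1) - y t)) hkink.symm one_half_pos one_half_pos (add_halves 1)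
      simp only [smul_eq_mul] at this ⊢
      linarith

end Update

namespace CoordProblem

variable {D : CoordProblem} {x y : ℕ → ℝ} {t : ℕ}

variable (D) in
/-- The sequences that arise from `x` by moving its nonzero entries within the bounds without an
increase of the variation. -/
def competitors (x : ℕ → ℝ) : Set (ℕ → ℝ) :=
  (Set.univ.pi fun r =>
    if 1 ≤ r ∧ r ≤ D.T + 1 ∧ x r ≠ 0 then Set.Icc (D.lo r) (D.hi r) else {x r}) ∩
  {y | variation (penalty D.q) y 1 (D.T + 1) ≤ variation (penalty D.q) x 1 (D.T + 1)}

theorem isCompact_competitors (hq : 1 ≤ D.q) (x : ℕ → ℝ) : IsCompact (D.competitors x) := by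
  refine (isCompact_univ_pi fun r => ?_).inter_right
    (isClosed_le (continuous_variation (continuous_penalty hq) _ _) continuous_const)
  split_ifs
  · exact isCompact_Icc
  · exact isCompact_singleton

theorem mem_competitors : y ∈ D.competitors x ↔
    (∀ r, if 1 ≤ r ∧ r ≤ D.T + 1 ∧ x r ≠ 0 then y r ∈ Set.Icc (D.lo r) (D.hi r) else y r = x r) ∧
      variation (penalty D.q) y 1 (D.T + 1) ≤ variation (penalty D.q) x 1 (D.T + 1) := by
  simp only [competitors, Set.mem_inter_iff, Set.mem_univ_pi, Set.mem_ofPred_eq]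
  refine and_congr_left' (forall_congr' fun r => ?_)
  split_ifs <;> rfl

theorem self_mem_competitors (hx : D.Feasible x) : x ∈ D.competitors x := by
  refine mem_competitors.2 ⟨fun r => ?_, le_rfl⟩
  split_ifs with h
  · exact hx r h.1 h.2.1
  · rfl

theorem feasible_of_mem_competitors (hx : D.Feasible x) (hy : y ∈ D.competitors x) :
    D.Feasible y := fun r h₁ h₂ => by
  have := (mem_competitors.1 hy).1 r
  split_ifs at this
  · exact this
  · exact this ▸ hx r h₁ h₂

theorem eq_zero_of_mem_competitors (hy : y ∈ D.competitors x) {r : ℕ} (hr : x r = 0) :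
    y r = 0 := by
  have := (mem_competitors.1 hy).1 r
  rw [if_neg (by tauto)] at this
  exact this.trans hr

theorem update_mem_competitors (hy : y ∈ D.competitors x) {v : ℝ} (h₁ : 1 ≤ t) (h₂ : t ≤ D.T + 1)
    (ht : x t ≠ 0) (hv : v ∈ Set.Icc (D.lo t) (D.hi t))
    (hvar : variation (penalty D.q) (Function.update y t v) 1 (D.T + 1) ≤
      variation (penalty D.q) x 1 (D.T + 1)) : Function.update y t v ∈ D.competitors x := by
  refine mem_competitors.2 ⟨fun r => ?_, hvar⟩
  rcases eq_or_ne r t with rfl | hr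
  · rwa [Function.update_self, if_pos ⟨h₁, h₂, ht⟩]
  · rw [Function.update_of_ne hr]
    exact (mem_competitors.1 hy).1 r

theorem kinksTouch_of_isMinOn (hq : 1 ≤ D.q) (hx : D.Feasible x) (hy : y ∈ D.competitors x)
    (hmin : IsMinOn (fun z => variation (· ^ 2) z 1 (D.T + 1)) (D.competitors x) y) :
    D.KinksTouch y := by
  intro t h₁ h₂ hfree
  simp only [Touches, not_or] at hfree
  by_contra hkink
  obtain ⟨v, hle, hlt⟩ := exists_variation_update_le h₁ h₂ hkink
  have hle := (hle _ (convexOn_penalty hq) (penalty_zero (Or.inr hq)) (penalty_nonneg _)).trans hy.2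
  have hmem := feasible_of_mem_competitors hx hy t h₁ h₂
  set S : Set ℝ := {v ∈ Set.univ | variation (penalty D.q) (Function.update y t v) 1 (D.T + 1) ≤
    variation (penalty D.q) x 1 (D.T + 1)}
  have hyS : y t ∈ S := ⟨trivial, by rw [Function.update_eq_self]; exact hy.2⟩
  have hconv : Convex ℝ S := (convexOn_variation_update (convexOn_penalty hq) y 1 t _).convex_le _
  have hlocal : IsLocalMinOn (fun v => variation (· ^ 2) (Function.update y t v) 1 (D.T + 1)) S
      (y t) := by
    filter_upwards [self_mem_nhdsWithin, mem_nhdsWithin_of_mem_nhds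
      (Icc_mem_nhds (hmem.1.lt_of_ne' hfree.2.1) (hmem.2.lt_of_ne hfree.2.2))] with w hw hw'
    rw [Function.update_eq_self]
    exact hmin (update_mem_competitors hy h₁ h₂
      (fun h => hfree.1 (eq_zero_of_mem_competitors hy h)) hw' hw.2)
  have := IsMinOn.of_isLocalMinOn_of_convexOn hyS hlocal
    ((convexOn_variation_update even_two.convexOn_pow y 1 t _).subset (Set.subset_univ _) hconv)
    (show v ∈ S from ⟨trivial, hle⟩)
  simp only [Set.mem_ofPred_eq, Function.update_eq_self] at this
  exact hlt.not_ge this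

theorem Feasible.exists_kinksTouch (hq : 1 ≤ D.q) (hx : D.Feasible x) :
    ∃ y, D.KinksTouch y ∧ D.Feasible y ∧ nnz y 0 (D.T + 1) ≤ nnz x 0 (D.T + 1) ∧
      variation (penalty D.q) y 1 (D.T + 1) ≤ variation (penalty D.q) x 1 (D.T + 1) := by
  obtain ⟨y, hy, hmin⟩ := (isCompact_competitors hq x).exists_isMinOn ⟨x, self_mem_competitors hx⟩
    (continuous_variation (continuous_pow 2) 1 (D.T + 1)).continuousOn
  refine ⟨y, kinksTouch_of_isMinOn hq hx hy hmin, feasible_of_mem_competitors hx hy, ?_, hy.2⟩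
  exact card_le_card <| monotone_filter_right _ fun r _ =>
    mt (eq_zero_of_mem_competitors hy)

variable {A : Tableau}

theorem IsTable.complete (hq : D.q = 0 ∨ 1 ≤ D.q) (H : D.IsTable A) (hx : D.Feasible x) {k : ℕ}
    (hk : k ≤ D.T + 1) (hc : nnz x 0 (D.T + 1) ≤ k) :
    A.reachable D.endNode k ∧ A.value D.endNode k ≤ variation (penalty D.q) x 1 (D.T + 1) := by
  rcases hq with hq | hq
  · exact H.complete_of_q_eq_zero hq hx hk hc
  · obtain ⟨y, hkinks, hfeas, hnnz, hvar⟩ := hx.exists_kinksTouch hq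
    obtain ⟨hreach, hval⟩ := H.complete_of_kinksTouch hq hkinks hfeas hk (hnnz.trans hc)
    exact ⟨hreach, hval.trans hvar⟩

end CoordProblem

/-! ### The lower envelope -/

section Envelope

variable {A : ℕ → Prop} {W : ℕ → ℝ} {K j k k' : ℕ} {γ γ' δ : ℝ}

/-- The parametric cost of a budget `k` with the optimal value `w`. -/
noncomputable def paramCost (k : ℕ) (w γ : ℝ) : ℝ := γ * k + (1 - γ) * w

theorem paramCost_le_paramCost {w w' : ℝ} (hγ : γ ∈ Set.Icc 0 1) (hk : k ≤ k') (hw : w ≤ w') :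
    paramCost k w γ ≤ paramCost k' w' γ :=
  add_le_add (mul_le_mul_of_nonneg_left (Nat.cast_le.2 hk) hγ.1)
    (mul_le_mul_of_nonneg_left hw (sub_nonneg.2 hγ.2))

/-- The parameter at which the budget `k'` becomes as good as the larger budget `k`. -/
noncomputable def crossing (W : ℕ → ℝ) (k k' : ℕ) : ℝ :=
  (W k' - W k) / ((W k' - W k) + (k - k' : ℕ))

/-- The state of the sweep over the parameter after `j` pieces of the lower envelope: the attainable
budget `k ≤ K` is optimal at `γ`. Since each new piece lowers the budget, there are at most `K + 1`
of them. -/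
structure Front (A : ℕ → Prop) (W : ℕ → ℝ) (K j k : ℕ) (γ : ℝ) : Prop where
  le : k ≤ K
  attainable : A k
  nonneg : 0 ≤ γ
  le_one : γ ≤ 1
  optimal : ∀ k' ≤ K, A k' → paramCost k (W k) γ ≤ paramCost k' (W k') γ
  progress : k + j ≤ K ∨ γ = 1 ∧ ∀ k' < k, ¬ A k'

/-- `γ` is the first crossing of the budget `k` with the attainable budgets below `b`; it is the
crossing with `k'`, or `1` if there are no such budgets. -/
structure FirstCrossing (A : ℕ → Prop) (W : ℕ → ℝ) (k b k' : ℕ) (γ : ℝ) : Prop where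
  le : ∀ l < b, A l → γ ≤ crossing W k l
  attained : γ = 1 ∧ k' = k ∨ k' < k ∧ A k' ∧ γ = crossing W k k'

theorem FirstCrossing.succ {b : ℕ} (h : FirstCrossing A W k b k' γ)
    (hb : A b → γ ≤ crossing W k b) : FirstCrossing A W k (b + 1) k' γ := by
  refine ⟨fun l hl hA => ?_, h.attained⟩
  rcases Nat.lt_succ_iff_lt_or_eq.1 hl with hlt | rfl
  · exact h.le l hlt hA
  · exact hb hA

theorem FirstCrossing.succ_of_crossing_le {b : ℕ} (h : FirstCrossing A W k b k' γ) (hbk : b < k)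
    (hA : A b) (hγ : crossing W k b ≤ γ) : FirstCrossing A W k (b + 1) b (crossing W k b) := by
  refine ⟨fun l hl hAl => ?_, Or.inr ⟨hbk, hA, rfl⟩⟩
  rcases Nat.lt_succ_iff_lt_or_eq.1 hl with hlt | rfl
  · exact hγ.trans (h.le l hlt hAl)
  · exact le_rfl

theorem le_crossing_iff (hk : k' < k) (hW : W k ≤ W k') :
    γ ≤ crossing W k k' ↔ paramCost k (W k) γ ≤ paramCost k' (W k') γ := by
  have hpos : (0 : ℝ) < (k - k' : ℕ) := by rw [Nat.cast_pos]; omega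
  rw [crossing, le_div_iff₀ (by linarith), Nat.cast_sub hk.le, paramCost, paramCost]
  constructor <;> intro h <;> linarith

theorem crossing_le_one (hk : k' < k) (hW : W k ≤ W k') : crossing W k k' ≤ 1 := by
  have hpos : (0 : ℝ) < (k - k' : ℕ) := by rw [Nat.cast_pos]; omega
  exact div_le_one_of_le₀ (by linarith) (by linarith)

theorem paramCost_crossing (hk : k' < k) (hW : W k ≤ W k') :
    paramCost k' (W k') (crossing W k k') = paramCost k (W k) (crossing W k k') := by
  have hpos : (0 : ℝ) < (k - k' : ℕ) := by rw [Nat.cast_pos]; omega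
  have : crossing W k k' * (W k' - W k + (k - k' : ℕ)) = W k' - W k :=
    div_mul_cancel₀ _ (by linarith)
  rw [Nat.cast_sub hk.le] at this
  rw [paramCost, paramCost]
  linarith

variable (hW : ∀ k k', A k → k ≤ k' → k' ≤ K → W k' ≤ W k)
include hW

theorem Front.le_firstCrossing (h : Front A W K j k γ) (hc : FirstCrossing A W k k k' γ') :
    γ ≤ γ' := by
  rcases hc.attained with ⟨rfl, -⟩ | ⟨hk, hA, rfl⟩
  · exact h.le_one
  · exact (le_crossing_iff hk (hW k' k hA hk.le h.le)).2 (h.optimal k' (hk.le.trans h.le) hA)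

theorem Front.optimal_of_le_firstCrossing (h : Front A W K j k γ)
    (hc : FirstCrossing A W k k k' γ') (hγδ : γ ≤ δ) (hδγ' : δ ≤ γ') {l : ℕ} (hl : l ≤ K)
    (hA : A l) : paramCost k (W k) δ ≤ paramCost l (W l) δ := by
  rcases lt_or_ge l k with hlk | hkl
  · exact (le_crossing_iff hlk (hW l k hA hlk.le h.le)).1 (hδγ'.trans (hc.le l hlk hA))
  · have hval := hW k l h.attainable hkl hl
    have hopt := h.optimal l hl hA
    have hcast : (k : ℝ) ≤ l := by exact_mod_cast hkl
    unfold paramCost at *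
    nlinarith [mul_nonneg (sub_nonneg.2 hγδ) (sub_nonneg.2 hval),
      mul_nonneg (sub_nonneg.2 hγδ) (sub_nonneg.2 hcast)]

theorem Front.next (h : Front A W K j k γ) (hc : FirstCrossing A W k k k' γ') :
    Front A W K (j + 1) k' γ' := by
  have hγ := h.le_firstCrossing hW hc
  have hopt := fun l => h.optimal_of_le_firstCrossing hW hc hγ le_rfl (l := l)
  rcases hc.attained with ⟨rfl, rfl⟩ | ⟨hk, hA, rfl⟩
  · refine ⟨h.le, h.attainable, zero_le_one, le_rfl, hopt, Or.inr ⟨rfl, fun l hl hA => ?_⟩⟩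
    have hval := (le_crossing_iff hl (hW l _ hA hl.le h.le)).1 (hc.le l hl hA)
    have hcast : (l : ℝ) < k' := by exact_mod_cast hl
    unfold paramCost at hval
    linarith
  · have hval := hW k' k hA hk.le h.le
    refine ⟨hk.le.trans h.le, hA, h.nonneg.trans hγ, crossing_le_one hk hval,
      fun l hl hAl => ?_, ?_⟩
    · rw [paramCost_crossing hk hval]
      exact hopt l hl hAl
    · rcases h.progress with hp | ⟨-, hp⟩
      · left; omega
      · exact absurd hA (hp k' hk)

end Envelope

namespace CoordProblem

variable {D : CoordProblem}

variable (D) in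
/-- The objective of the problem of one coordinate. -/
noncomputable def objective (γ : ℝ) (x : ℕ → ℝ) : ℝ :=
  paramCost (nnz x 0 (D.T + 1)) (variation (penalty D.q) x 1 (D.T + 1)) γ

variable (D) in
/-- The sequence `x` is optimal for all parameters in `[0, 1]` between `a` and `b`. -/
def OptimalOn (a b : ℝ) (x : ℕ → ℝ) : Prop :=
  ∀ γ ∈ Set.Icc (0 : ℝ) 1, a ≤ γ → γ ≤ b →
    D.Feasible x ∧ ∀ y, D.Feasible y → D.objective γ x ≤ D.objective γ y

theorem OptimalOn.congr {a b : ℝ} {x y : ℕ → ℝ} (h : D.OptimalOn a b x)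
    (hxy : ∀ r, 1 ≤ r → r ≤ D.T + 1 → x r = y r) : D.OptimalOn a b y := by
  intro γ hγ ha hb
  obtain ⟨hx, hopt⟩ := h γ hγ ha hb
  have hobj : D.objective γ x = D.objective γ y := by
    rw [objective, objective, nnz_congr fun r h₁ => hxy r h₁, variation_congr hxy]
  exact ⟨fun r h₁ h₂ => hxy r h₁ h₂ ▸ hx r h₁ h₂, hobj ▸ hopt⟩

variable {A : Tableau}

section Table

variable (hq : D.q = 0 ∨ 1 ≤ D.q) (H : D.IsTable A)
include hq H

theorem IsTable.antitone (k k' : ℕ) (h : A.reachable D.endNode k) (hk : k ≤ k')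
    (hk' : k' ≤ D.T + 1) : A.value D.endNode k' ≤ A.value D.endNode k := by
  obtain ⟨hfeas, hnnz, hvar⟩ := H.sound hq (hk.trans hk') h
  exact (H.complete hq hfeas hk' (hnnz.trans hk)).2.trans hvar

theorem IsTable.front_zero (hlohi : ∀ r, D.lo r ≤ D.hi r) :
    Front (A.reachable D.endNode) (A.value D.endNode) (D.T + 1) 0 (D.T + 1) 0 := by
  have hlo : D.Feasible D.lo := fun r _ _ => Set.left_mem_Icc.2 (hlohi r)
  refine ⟨le_rfl, (H.complete hq hlo le_rfl (nnz_le _ _ _)).1, le_rfl, zero_le_one,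
    fun k hk h => ?_, Or.inl le_rfl⟩
  simpa [paramCost] using H.antitone hq k _ h hk le_rfl

theorem IsTable.optimalOn {k : ℕ} {γ γ' : ℝ} (hk : k ≤ D.T + 1) (h : A.reachable D.endNode k)
    (hopt : ∀ δ, γ ≤ δ → δ ≤ γ' → ∀ k' ≤ D.T + 1, A.reachable D.endNode k' →
      paramCost k (A.value D.endNode k) δ ≤ paramCost k' (A.value D.endNode k') δ) :
    D.OptimalOn γ γ' (A.traj D.endNode k) := by
  intro δ hδ hγδ hδγ'
  obtain ⟨hfeas, hnnz, hvar⟩ := H.sound hq hk h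
  refine ⟨hfeas, fun y hy => ?_⟩
  obtain ⟨hreach, hval⟩ := H.complete hq hy (nnz_le _ _ _) le_rfl
  calc
    D.objective δ (A.traj D.endNode k) ≤ paramCost k (A.value D.endNode k) δ :=
      paramCost_le_paramCost hδ hnnz hvar
    _ ≤ paramCost _ (A.value D.endNode (nnz y 0 (D.T + 1))) δ :=
      hopt δ hγδ hδγ' _ (nnz_le _ _ _) hreach
    _ ≤ D.objective δ y := paramCost_le_paramCost hδ le_rfl hval

end Table

variable (D) in
/-- A solution path of the problem of one coordinate: `m` pieces with the breakpoints `g` and the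
trajectories `x`, which are indexed by the times `0, …, T` as in the problem itself. -/
structure IsPath (m : ℕ) (g : ℕ → ℝ) (x : ℕ → ℕ → ℝ) : Prop where
  first : g 0 = 0
  last : g m = 1
  mono : ∀ j < m, g j ≤ g (j + 1)
  optimal : ∀ j < m, D.OptimalOn (g j) (g (j + 1)) (fun r => x j (r - 1))

end CoordProblem

/-! ### Separation into coordinates -/

section Coordinates

variable {p T : ℕ}

/-- The problem of coordinate `i`. -/
noncomputable def coord (q : ℝ) (F : Fin (T + 1) → Fin p → ℝ) (lam : Fin (T + 1) → ℝ)
    (i : Fin p) : CoordProblem where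
  q := q
  T := T
  lo r := if h : r - 1 < T + 1 then F ⟨r - 1, h⟩ i - lam ⟨r - 1, h⟩ else 0
  hi r := if h : r - 1 < T + 1 then F ⟨r - 1, h⟩ i + lam ⟨r - 1, h⟩ else 0

theorem coord_lo_le_hi {lam : Fin (T + 1) → ℝ} (hlam : ∀ t, 0 ≤ lam t) (q : ℝ)
    {F : Fin (T + 1) → Fin p → ℝ} (i : Fin p) (r : ℕ) :
    (coord q F lam i).lo r ≤ (coord q F lam i).hi r := by
  simp only [coord]
  split_ifs with h
  · linarith [hlam ⟨r - 1, h⟩]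
  · exact le_rfl

/-- Coordinate `i` of a parameter sequence, with the times `0, …, T` shifted to `1, …, T + 1`. -/
noncomputable def column (θ : Fin (T + 1) → Fin p → ℝ) (i : Fin p) (r : ℕ) : ℝ :=
  if h : r - 1 < T + 1 then θ ⟨r - 1, h⟩ i else 0

variable (θ : Fin (T + 1) → Fin p → ℝ)

theorem column_of_eq_add_one {r : ℕ} {t : Fin (T + 1)} (h : r = t + 1) (i : Fin p) :
    column θ i r = θ t i := by
  subst h
  exact dif_pos t.isLt

theorem sum_l0norm : ∑ t, l0norm (θ t) = ∑ i, nnz (column θ i) 0 (T + 1) := by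
  simp_rw [l0norm, nnz, card_filter]
  rw [sum_comm]
  refine sum_congr rfl fun i _ => ?_
  rw [show Ioc 0 (T + 1) = Ico 1 (T + 2) from rfl, sum_Ico_eq_sum_range,
    show T + 2 - 1 = T + 1 from rfl, sum_range]
  refine sum_congr rfl fun t _ => ?_
  rw [column_of_eq_add_one θ (add_comm _ _)]

theorem lqPow_eq_sum_penalty (q : ℝ) (v : Fin p → ℝ) : lqPow q v = ∑ i, penalty q (v i) := by
  unfold lqPow penalty
  split_ifs
  · simp [l0norm, card_filter, ite_not]
  · rfl

theorem sum_lqPow (q : ℝ) : ∑ t : Fin T, lqPow q (θ t.succ - θ t.castSucc) =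
    ∑ i, variation (penalty q) (column θ i) 1 (T + 1) := by
  simp_rw [lqPow_eq_sum_penalty, variation]
  rw [sum_comm]
  refine sum_congr rfl fun i _ => ?_
  rw [sum_Ico_eq_sum_range, Nat.add_sub_cancel, sum_range]
  refine sum_congr rfl fun t _ => ?_
  rw [column_of_eq_add_one θ (t := t.succ) (by simp [add_comm]),
    column_of_eq_add_one θ (t := t.castSucc) (by simp [add_comm]), Pi.sub_apply]

theorem objective_eq_sum_coord (q γ : ℝ) (F : Fin (T + 1) → Fin p → ℝ) (lam : Fin (T + 1) → ℝ) :
    objective q γ θ = ∑ i, (coord q F lam i).objective γ (column θ i) := by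
  simp only [CoordProblem.objective, paramCost]
  rw [objective, sum_lqPow, sum_add_distrib, ← mul_sum, ← mul_sum, ← Nat.cast_sum, ← Nat.cast_sum,
    sum_l0norm]
  rfl

theorem mem_feasible_iff_coord (q : ℝ) {F : Fin (T + 1) → Fin p → ℝ} {lam : Fin (T + 1) → ℝ}
    (hlam : ∀ t, 0 ≤ lam t) :
    θ ∈ feasible F lam ↔ ∀ i, (coord q F lam i).Feasible (column θ i) := by
  have mem_iff : θ ∈ feasible F lam ↔ ∀ i t, θ t i ∈ Set.Icc (F t i - lam t) (F t i + lam t) := by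
    unfold feasible
    rw [Set.mem_ofPred_eq, forall_comm]
    refine forall_congr' fun t => ?_
    rw [pi_norm_le_iff_of_nonneg (hlam t)]
    refine forall_congr' fun i => ?_
    rw [Pi.sub_apply, Real.norm_eq_abs, abs_sub_comm, Set.mem_Icc_iff_abs_le]
  rw [mem_iff]
  refine forall_congr' fun i => ⟨fun h r h₁ h₂ => ?_, fun h t => ?_⟩
  · have hr : r - 1 < T + 1 := by simp only [coord] at h₂; omega
    simpa only [coord, column, dif_pos hr] using h ⟨r - 1, hr⟩
  · have := h (t + 1) (Nat.le_add_left _ _) (Nat.succ_le_of_lt t.isLt)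
    simpa only [coord, column, Nat.add_sub_cancel, t.isLt, dif_pos] using this

theorem isSolutionPath_of_coord {q : ℝ} {F : Fin (T + 1) → Fin p → ℝ} {lam : Fin (T + 1) → ℝ}
    (hlam : ∀ t, 0 ≤ lam t) {m : Fin p → ℕ} {g : Fin p → ℕ → ℝ} {x : Fin p → ℕ → ℕ → ℝ}
    (h : ∀ i, (coord q F lam i).IsPath (m i) (g i) (x i)) :
    IsSolutionPath q F lam m g (fun i j t => x i j t) := by
  refine ⟨fun i => (h i).first, fun i => (h i).last, fun i => (h i).mono, fun γ hγ J hJ => ?_⟩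
  set θ : Fin (T + 1) → Fin p → ℝ := fun t i => x i (J i) t with hθ
  have column_eq (i : Fin p) (r : ℕ) (h₁ : 1 ≤ r) (h₂ : r ≤ T + 1) :
      x i (J i) (r - 1) = column θ i r := by
    have hr : r - 1 < T + 1 := by omega
    simp only [column, dif_pos hr, hθ]
  have hopt := fun i =>
    ((h i).optimal (J i) (hJ i).1).congr (column_eq i) γ hγ (hJ i).2.1 (hJ i).2.2
  refine ⟨(mem_feasible_iff_coord θ q hlam).2 fun i => (hopt i).1, fun y hy => ?_⟩
  rw [Set.mem_ofPred_eq, objective_eq_sum_coord _ q γ F lam, objective_eq_sum_coord _ q γ F lam]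
  exact sum_le_sum fun i _ => (hopt i).2 _ ((mem_feasible_iff_coord y q hlam).1 hy i)

end Coordinates

end ProxGL

/-! ### The program -/

namespace RealRAM

instance : Add NExp := ⟨.add⟩

instance : Sub NExp := ⟨.sub⟩

instance (n : ℕ) : OfNat NExp n := ⟨.lit n⟩

instance : Add RExp := ⟨.add⟩

instance : Sub RExp := ⟨.sub⟩

instance : Mul RExp := ⟨.mul⟩

instance : Div RExp := ⟨.div⟩

instance (n : ℕ) : OfNat RExp n := ⟨.ofN (.lit n)⟩

variable (q : ℝ) (s : Store)

@[simp] theorem NExp.eval_var (v : ℕ) : (NExp.var v).eval s = s.nvar v := rfl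

@[simp] theorem NExp.eval_get (a : ℕ) (i j k : NExp) :
    (NExp.get a i j k).eval s = s.ncell (a, i.eval s, j.eval s, k.eval s) := rfl

@[simp] theorem NExp.eval_add (e₁ e₂ : NExp) : (e₁ + e₂).eval s = e₁.eval s + e₂.eval s := rfl

@[simp] theorem NExp.eval_sub (e₁ e₂ : NExp) : (e₁ - e₂).eval s = e₁.eval s - e₂.eval s := rfl

@[simp] theorem NExp.eval_ofNat (n : ℕ) : (ofNat(n) : NExp).eval s = n := rfl

@[simp] theorem RExp.eval_var (v : ℕ) : (RExp.var v).eval q s = s.rvar v := rfl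

@[simp] theorem RExp.eval_ofN (e : NExp) : (RExp.ofN e).eval q s = e.eval s := rfl

@[simp] theorem RExp.eval_pen (e : RExp) : (RExp.pen e).eval q s = penalty q (e.eval q s) := rfl

@[simp] theorem RExp.eval_get (a : ℕ) (i j k : NExp) :
    (RExp.get a i j k).eval q s = s.rcell (a, i.eval s, j.eval s, k.eval s) := rfl

@[simp] theorem RExp.eval_add (e₁ e₂ : RExp) :
    (e₁ + e₂).eval q s = e₁.eval q s + e₂.eval q s := rfl

@[simp] theorem RExp.eval_sub (e₁ e₂ : RExp) :
    (e₁ - e₂).eval q s = e₁.eval q s - e₂.eval q s := rfl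

@[simp] theorem RExp.eval_mul (e₁ e₂ : RExp) :
    (e₁ * e₂).eval q s = e₁.eval q s * e₂.eval q s := rfl

@[simp] theorem RExp.eval_div (e₁ e₂ : RExp) :
    (e₁ / e₂).eval q s = e₁.eval q s / e₂.eval q s := rfl

@[simp] theorem RExp.eval_ofNat (n : ℕ) :
    (ofNat(n) : RExp).eval q s = (n : ℕ) := rfl

end RealRAM

namespace ProxGL.Program

open RealRAM

local notation:65 P:66 " ;; " Q:65 => Prog.seq P Q

-- Names for the variables (`Var`) and arrays (`Arr`) holding indices (`I`) and reals (`R`).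

abbrev IVar.dim : ℕ := 0
abbrev IVar.horizon : ℕ := 1
abbrev IVar.coord : ℕ := 2
abbrev IVar.node : ℕ := 3
abbrev IVar.pred : ℕ := 4
abbrev IVar.time : ℕ := 5
abbrev IVar.budget : ℕ := 6
abbrev IVar.piece : ℕ := 7
abbrev IVar.admissible : ℕ := 8
abbrev IVar.found : ℕ := 9
abbrev IVar.bestPred : ℕ := 10
abbrev IVar.candBudget : ℕ := 11
abbrev IVar.curBudget : ℕ := 12
abbrev IVar.nextBudget : ℕ := 13

abbrev RVar.maxLower : ℕ := 0
abbrev RVar.sourceVal : ℕ := 1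
abbrev RVar.targetVal : ℕ := 2
abbrev RVar.lastVal : ℕ := 3
abbrev RVar.slope : ℕ := 4
abbrev RVar.constVal : ℕ := 5
abbrev RVar.cost : ℕ := 6
abbrev RVar.bestCost : ℕ := 7
abbrev RVar.param : ℕ := 8
abbrev RVar.nextParam : ℕ := 9

abbrev IArr.pieces : ℕ := 0
abbrev IArr.time : ℕ := 1
abbrev IArr.kind : ℕ := 2
abbrev IArr.reachable : ℕ := 3
abbrev IArr.admissible : ℕ := 4
abbrev IArr.weight : ℕ := 5

abbrev RArr.center : ℕ := 0
abbrev RArr.radius : ℕ := 1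
abbrev RArr.breaks : ℕ := 2
abbrev RArr.output : ℕ := 3
abbrev RArr.value : ℕ := 4
abbrev RArr.traj : ℕ := 5
abbrev RArr.cost : ℕ := 6
abbrev RArr.last : ℕ := 7
abbrev RArr.slope : ℕ := 8

def lowerE (r : NExp) : RExp :=
  .get RArr.center (r - 1) (.var IVar.coord) 0 - .get RArr.radius (r - 1) 0 0

def upperE (r : NExp) : RExp :=
  .get RArr.center (r - 1) (.var IVar.coord) 0 + .get RArr.radius (r - 1) 0 0

def timeE (n : NExp) : NExp := .get IArr.time n 0 0

def kindE (n : NExp) : NExp := .get IArr.kind n 0 0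

def endNodeE : NExp :=
  (.var IVar.horizon + 2) + (.var IVar.horizon + 2) + (.var IVar.horizon + 2)

def reachableE (n k : NExp) : NExp := .get IArr.reachable n k 0

def valueE (n k : NExp) : RExp := .get RArr.value n k 0

def trajE (n k r : NExp) : RExp := .get RArr.traj n k r

/-- The number of steps between the current two nodes. -/
def stepsE : NExp := timeE (.var IVar.node) - timeE (.var IVar.pred)

/-- The budget that remains for the predecessor `m`. -/
def restE (m : NExp) : NExp := .var IVar.budget - .get IArr.weight m 0 0

/-- Records the node of kind `b` at the current time; `t - (t - (T + 1)) = min t (T + 1)`. -/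
def storeNode (b : ℕ) : Prog :=
  let t : NExp := .var IVar.time
  .nput IArr.time (t + t + t + .lit b) 0 0 (t - (t - (.var IVar.horizon + 1))) ;;
  .nput IArr.kind (t + t + t + .lit b) 0 0 (.lit b)

def nodes : Prog :=
  .forLoop IVar.time 0 (.var IVar.horizon + 3) (storeNode 0 ;; storeNode 1 ;; storeNode 2)

/-- Loops over the times that the current edge covers. -/
def forTimes (P : Prog) : Prog :=
  .forLoop IVar.time (timeE (.var IVar.pred) + 1) (timeE (.var IVar.node) + 1) P

def maxLower : Prog :=
  .rset RVar.maxLower (lowerE (timeE (.var IVar.pred) + 1)) ;;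
  forTimes
    (.ite (.rle (.var RVar.maxLower) (lowerE (.var IVar.time)))
      (.rset RVar.maxLower (lowerE (.var IVar.time))) .skip)

def nodeVal (n : NExp) (v : ℕ) : Prog :=
  .ite (.nle 2 (kindE n)) (.rset v 0)
    (.ite (.nle 1 (kindE n)) (.rset v (upperE (timeE n))) (.rset v (lowerE (timeE n))))

def constVal : Prog :=
  .ite (.nle 2 (kindE (.var IVar.node))) (.rset RVar.constVal 0)
    (.rset RVar.constVal (.var RVar.maxLower))

def targetVal : Prog :=
  .ite (.nle endNodeE (.var IVar.node)) (.rset RVar.targetVal (.var RVar.constVal))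
    (nodeVal (.var IVar.node) RVar.targetVal)

def sourceVal : Prog :=
  .ite (.nle (timeE (.var IVar.pred)) 0) (.rset RVar.sourceVal (.var RVar.targetVal))
    (nodeVal (.var IVar.pred) RVar.sourceVal)

/-- The edge data for `q = 0`. -/
def jumpEdge : Prog :=
  let m : NExp := .var IVar.pred
  let n : NExp := .var IVar.node
  .rset RVar.lastVal (.var RVar.constVal) ;; .rset RVar.slope 0 ;;
  .ite (.and (.not (.nle (timeE m) 0)) (.and (.not (.nle (timeE n) (timeE m)))
      (.not (.and (.nle 2 (kindE m)) (.nle 2 (kindE n))))))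
    (.rset RVar.cost 1) (.rset RVar.cost 0)

/-- The edge data for `1 ≤ q`. -/
def slopeEdge : Prog :=
  .ite (.nle endNodeE (.var IVar.node)) (.rset RVar.lastVal (.var RVar.sourceVal))
    (.rset RVar.lastVal (.var RVar.targetVal)) ;;
  .rset RVar.slope ((.var RVar.lastVal - .var RVar.sourceVal) / .ofN stepsE) ;;
  .rset RVar.cost (.ofN stepsE * .pen (.var RVar.slope))

/-- The exponent is not an input; the test `penalty q 2 ≤ 1` detects `q = 0`. -/
def edgeData : Prog := .ite (.rle (.pen 2) 1) jumpEdge slopeEdge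

def pieceE : RExp :=
  .var RVar.lastVal - .var RVar.slope * .ofN (timeE (.var IVar.node) - .var IVar.time)

def checkEdge : Prog :=
  .nset IVar.admissible 1 ;;
  forTimes
    (.ite (.and (.rle (lowerE (.var IVar.time)) pieceE) (.rle pieceE (upperE (.var IVar.time))))
      .skip (.nset IVar.admissible 0))

def storeEdge : Prog :=
  .nput IArr.admissible (.var IVar.pred) 0 0 (.var IVar.admissible) ;;
  .nput IArr.weight (.var IVar.pred) 0 0 (stepsE - (kindE (.var IVar.node) - 1)) ;;
  .rput RArr.cost (.var IVar.pred) 0 0 (.var RVar.cost) ;;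
  .rput RArr.last (.var IVar.pred) 0 0 (.var RVar.lastVal) ;;
  .rput RArr.slope (.var IVar.pred) 0 0 (.var RVar.slope)

/-- Computes and stores the data of the edge between the current two nodes. -/
def edge : Prog :=
  maxLower ;; constVal ;; targetVal ;; sourceVal ;; edgeData ;; checkEdge ;; storeEdge

/-- Loops over the predecessors: `m / 3 < n / 3` means `m < n - n % 3`. -/
def forPreds (P : Prog) : Prog :=
  .forLoop IVar.pred 0 (.var IVar.node - kindE (.var IVar.node)) P

/-- The predecessor leads to the current cell by an admissible edge within the budget. -/
def candTest : Test :=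
  let m : NExp := .var IVar.pred
  .and (.nle 1 (.get IArr.admissible m 0 0))
    (.and (.nle (.get IArr.weight m 0 0) (.var IVar.budget)) (.nle 1 (reachableE m (restE m))))

def improve : Prog :=
  let m : NExp := .var IVar.pred
  .rset RVar.cost (valueE m (restE m) + .get RArr.cost m 0 0) ;;
  .ite (.and (.nle 1 (.var IVar.found)) (.not (.rle (.var RVar.cost) (.var RVar.bestCost)))) .skip
    (.nset IVar.found 1 ;; .rset RVar.bestCost (.var RVar.cost) ;; .nset IVar.bestPred m)

/-- Searches for the best candidate predecessor of the current cell. -/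
def best : Prog := .nset IVar.found 0 ;; forPreds (.ite candTest improve .skip)

def storeTraj : Prog :=
  let m : NExp := .var IVar.bestPred
  let r : NExp := .var IVar.time
  .forLoop IVar.time 1 (timeE (.var IVar.node) + 1)
    (.ite (.nle r (timeE m))
      (.rput RArr.traj (.var IVar.node) (.var IVar.budget) r (trajE m (restE m) r))
      (.rput RArr.traj (.var IVar.node) (.var IVar.budget) r
        (.get RArr.last m 0 0 - .get RArr.slope m 0 0 * .ofN (timeE (.var IVar.node) - r))))

/-- Computes the entry of the table at the current node and budget. -/
def cell : Prog :=
  best ;;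
  .nput IArr.reachable (.var IVar.node) (.var IVar.budget) 0 (.var IVar.found) ;;
  .rput RArr.value (.var IVar.node) (.var IVar.budget) 0 (.var RVar.bestCost) ;;
  storeTraj

def forBudgets (P : Prog) : Prog := .forLoop IVar.budget 0 (.var IVar.horizon + 2) P

def source : Prog :=
  forBudgets
    (.nput IArr.reachable 0 (.var IVar.budget) 0 1 ;;
    .nput IArr.reachable 1 (.var IVar.budget) 0 0 ;;
    .nput IArr.reachable 2 (.var IVar.budget) 0 0 ;;
    .rput RArr.value 0 (.var IVar.budget) 0 0)

/-- Solves the dynamic program; the edges are stored for one target node at a time. -/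
def table : Prog :=
  source ;; .forLoop IVar.node 3 (endNodeE + 1) (forPreds edge ;; forBudgets cell)

/-- Moves the next breakpoint down to the crossing with the line of the candidate budget. -/
def updateCrossing : Prog :=
  let k : NExp := .var IVar.curBudget
  let l : NExp := .var IVar.candBudget
  .rset RVar.cost (valueE endNodeE l - valueE endNodeE k) ;;
  .rset RVar.param (.var RVar.cost / (.var RVar.cost + .ofN (k - l))) ;;
  .ite (.rle (.var RVar.param) (.var RVar.nextParam))
    (.rset RVar.nextParam (.var RVar.param) ;; .nset IVar.nextBudget l) .skip

/-- Finds the parameter at which the current budget stops being optimal, and its successor. -/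
def firstCrossing : Prog :=
  .rset RVar.nextParam 1 ;; .nset IVar.nextBudget (.var IVar.curBudget) ;;
  .forLoop IVar.candBudget 0 (.var IVar.curBudget)
    (.ite (.nle 1 (reachableE endNodeE (.var IVar.candBudget))) updateCrossing .skip)

def outputTraj : Prog :=
  .forLoop IVar.time 0 (.var IVar.horizon + 1)
    (.rput RArr.output (.var IVar.coord) (.var IVar.piece) (.var IVar.time)
      (trajE endNodeE (.var IVar.curBudget) (.var IVar.time + 1)))

def outputPiece : Prog :=
  firstCrossing ;;
  .rput RArr.breaks (.var IVar.coord) (.var IVar.piece + 1) 0 (.var RVar.nextParam) ;;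
  outputTraj ;; .nset IVar.curBudget (.var IVar.nextBudget)

def initEnvelope : Prog :=
  .nput IArr.pieces (.var IVar.coord) 0 0 (.var IVar.horizon + 2) ;;
  .rput RArr.breaks (.var IVar.coord) 0 0 0 ;;
  .nset IVar.curBudget (.var IVar.horizon + 1)

/-- Outputs `T + 2` pieces, the last of which may be degenerate. -/
def envelope : Prog := initEnvelope ;; .forLoop IVar.piece 0 (.var IVar.horizon + 2) outputPiece

/-- Computes the solution path of the current coordinate. -/
def coordinate : Prog := nodes ;; table ;; envelope

/-- Computes the solution paths of all coordinates. -/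
def main : Prog := .forLoop IVar.coord 0 (.var IVar.dim) coordinate

/-! ### Correctness: nodes and edges -/

attribute [local simp] Test.Holds

/-- The inputs of the current coordinate are those of `D`. -/
structure Input (D : CoordProblem) (s : Store) : Prop where
  horizon : s.nvar IVar.horizon = D.T
  lo : ∀ r, s.rcell (RArr.center, r - 1, s.nvar IVar.coord, 0) -
    s.rcell (RArr.radius, r - 1, 0, 0) = D.lo r
  hi : ∀ r, s.rcell (RArr.center, r - 1, s.nvar IVar.coord, 0) +
    s.rcell (RArr.radius, r - 1, 0, 0) = D.hi r

/-- The memory moreover holds the times and the kinds of the nodes. -/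
structure Env (D : CoordProblem) (s : Store) : Prop extends Input D s where
  time : ∀ n ≤ D.endNode, s.ncell (IArr.time, n, 0, 0) = D.time n
  kind : ∀ n ≤ D.endNode, s.ncell (IArr.kind, n, 0, 0) = n % 3

/-- The edge from node `m` to node `n` is being computed. -/
structure AtEdge (D : CoordProblem) (m n : ℕ) (s : Store) : Prop extends Env D s where
  pred : s.nvar IVar.pred = m
  node : s.nvar IVar.node = n
  le_endNode : n ≤ D.endNode
  lt : m / 3 < n / 3

abbrev inputLocs : List Loc :=
  [.nvar IVar.horizon, .nvar IVar.coord, .rarr RArr.center, .rarr RArr.radius]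

abbrev envLocs : List Loc := .narr IArr.time :: .narr IArr.kind :: inputLocs

abbrev atEdgeLocs : List Loc := .nvar IVar.pred :: .nvar IVar.node :: envLocs

variable {D : CoordProblem} {s s' : Store} {L : List Loc} {N m n k : ℕ}

theorem Input.frame (h : Input D s) (hF : Frame L s s') (hL : ∀ l ∈ inputLocs, l ∉ L) :
    Input D s' where
  horizon := (hF.nvar (hL _ (by decide))).trans h.horizon
  lo r := by
    rw [hF.rcell (hL _ (by decide)), hF.rcell (hL _ (by decide)), hF.nvar (hL _ (by decide)), h.lo]
  hi r := by
    rw [hF.rcell (hL _ (by decide)), hF.rcell (hL _ (by decide)), hF.nvar (hL _ (by decide)), h.hi]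

theorem Env.frame (h : Env D s) (hF : Frame L s s') (hL : ∀ l ∈ envLocs, l ∉ L) : Env D s' where
  toInput := h.toInput.frame hF fun l hl => hL l (by simp [hl])
  time n hn := (hF.ncell (hL _ (by decide)) _).trans (h.time n hn)
  kind n hn := (hF.ncell (hL _ (by decide)) _).trans (h.kind n hn)

theorem AtEdge.frame (h : AtEdge D m n s) (hF : Frame L s s') (hL : ∀ l ∈ atEdgeLocs, l ∉ L) :
    AtEdge D m n s' where
  toEnv := h.toEnv.frame hF fun l hl => hL l (by simp [hl])
  pred := (hF.nvar (hL _ (by decide))).trans h.pred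
  node := (hF.nvar (hL _ (by decide))).trans h.node
  le_endNode := h.le_endNode
  lt := h.lt

theorem Input.eval_lowerE (h : Input D s) (e : NExp) :
    (lowerE e).eval D.q s = D.lo (e.eval s) := by
  simp [lowerE, h.lo]

theorem Input.eval_upperE (h : Input D s) (e : NExp) :
    (upperE e).eval D.q s = D.hi (e.eval s) := by
  simp [upperE, h.hi]

theorem Input.eval_endNodeE (h : Input D s) : endNodeE.eval s = D.endNode := by
  simp only [endNodeE, NExp.eval_add, NExp.eval_var, NExp.eval_ofNat, h.horizon,
    CoordProblem.endNode]
  omega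

theorem Env.eval_timeE (h : Env D s) {e : NExp} (he : e.eval s = n) (hn : n ≤ D.endNode) :
    (timeE e).eval s = D.time n := by
  simp [timeE, he, h.time n hn]

theorem Env.eval_kindE (h : Env D s) {e : NExp} (he : e.eval s = n) (hn : n ≤ D.endNode) :
    (kindE e).eval s = n % 3 := by
  simp [kindE, he, h.kind n hn]

namespace AtEdge

theorem pred_le_endNode (h : AtEdge D m n s) : m ≤ D.endNode := by
  have := h.le_endNode
  have := h.lt
  omega

theorem eval_timeE_pred (h : AtEdge D m n s) : (timeE (.var IVar.pred)).eval s = D.time m :=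
  h.toEnv.eval_timeE h.pred h.pred_le_endNode

theorem eval_timeE_node (h : AtEdge D m n s) : (timeE (.var IVar.node)).eval s = D.time n :=
  h.toEnv.eval_timeE h.node h.le_endNode

theorem eval_kindE_pred (h : AtEdge D m n s) : (kindE (.var IVar.pred)).eval s = m % 3 :=
  h.toEnv.eval_kindE h.pred h.pred_le_endNode

theorem eval_kindE_node (h : AtEdge D m n s) : (kindE (.var IVar.node)).eval s = n % 3 :=
  h.toEnv.eval_kindE h.node h.le_endNode

theorem eval_stepsE (h : AtEdge D m n s) : stepsE.eval s = D.time n - D.time m := by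
  rw [stepsE, NExp.eval_sub, h.eval_timeE_node, h.eval_timeE_pred]

end AtEdge

theorem run_storeNode {q : ℝ} (b : ℕ) : Run q N (storeNode b) s fun s' => ∀ n,
    (s'.ncell (IArr.time, n, 0, 0) = if n = 3 * s.nvar IVar.time + b
      then min (s.nvar IVar.time) (s.nvar IVar.horizon + 1) else s.ncell (IArr.time, n, 0, 0)) ∧
    s'.ncell (IArr.kind, n, 0, 0) =
      if n = 3 * s.nvar IVar.time + b then b else s.ncell (IArr.kind, n, 0, 0) := by
  refine Run.seq (Run.nput (Run.nput fun n => ?_))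
  have index : s.nvar IVar.time + s.nvar IVar.time + s.nvar IVar.time + b =
    3 * s.nvar IVar.time + b := by omega
  have min_eq : s.nvar IVar.time - (s.nvar IVar.time - (s.nvar IVar.horizon + 1)) =
    min (s.nvar IVar.time) (s.nvar IVar.horizon + 1) := by omega
  simp [Function.update_apply, NExp.eval, index, min_eq]

theorem run_nodes (h : Input D s) (hN : D.T + 3 ≤ N) : Run D.q N nodes s (Env D) := by
  have tabulated : Run D.q N nodes s fun s' => ∀ n < 3 * (D.T + 3),
      s'.ncell (IArr.time, n, 0, 0) = D.time n ∧ s'.ncell (IArr.kind, n, 0, 0) = n % 3 := by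
    refine Run.forLoop (a := 0) (b := D.T + 3) (fun t s' => ∀ n < 3 * t,
      s'.ncell (IArr.time, n, 0, 0) = D.time n ∧ s'.ncell (IArr.kind, n, 0, 0) = n % 3)
      rfl (by omega) (by omega) (by decide) (by simp)
      (fun s' hF => by simp [hF.nvar (v := IVar.horizon) (by decide), h.horizon]) ?_
    intro t s' _ _ ht hF hI
    have hT : s'.nvar IVar.horizon = D.T := (hF.nvar (by decide)).trans h.horizon
    refine Run.seq ((run_storeNode 0).mono fun s₀ h₀ f₀ => ?_)
    refine Run.seq ((run_storeNode 1).mono fun s₁ h₁ f₁ => ?_)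
    refine (run_storeNode 2).mono fun s₂ h₂ _ n hn => ?_
    have t₀ := (f₀.nvar (v := IVar.time) (by decide)).trans ht
    have t₁ := (f₁.nvar (v := IVar.time) (by decide)).trans t₀
    have T₀ := (f₀.nvar (v := IVar.horizon) (by decide)).trans hT
    have T₁ := (f₁.nvar (v := IVar.horizon) (by decide)).trans T₀
    simp only [Store.setN_ncell, (h₂ n).1, (h₂ n).2, (h₁ n).1, (h₁ n).2, (h₀ n).1, (h₀ n).2, t₁,
      T₁, t₀, T₀, ht, hT]
    by_cases hlt : n < 3 * t
    · rw [(hI n hlt).1, (hI n hlt).2]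
      grind
    · simp only [CoordProblem.time]
      grind
  refine tabulated.mono fun s' hQ hF => ⟨h.frame hF (by decide), fun n hn => (hQ n ?_).1,
    fun n hn => (hQ n ?_).2⟩
  all_goals
    unfold CoordProblem.endNode at hn
    omega

theorem run_forTimes {P : Prog} (I : ℕ → Store → Prop) (h : AtEdge D m n s) (hN : D.T + 1 ≤ N)
    (hv : .nvar IVar.time ∉ P.writes) (hP : ∀ l ∈ atEdgeLocs, l ∉ (forTimes P).writes)
    (init : I (D.time m + 1) (s.setN IVar.time (D.time m + 1)))
    (step : ∀ r s', D.time m < r → r ≤ D.time n → s'.nvar IVar.time = r →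
      Frame (forTimes P).writes s s' → AtEdge D m n s' → I r s' →
      Run D.q N P s' fun s'' => I (r + 1) (s''.setN IVar.time (r + 1))) :
    Run D.q N (forTimes P) s (I (D.time n + 1)) := by
  have := D.time_le_time h.lt
  have := D.time_le n
  refine Run.forLoop I ?_ (by omega) (by omega) hv init (fun s' hF => ?_)
    fun r s' h₁ h₂ h₃ hF => step r s' h₁ (by omega) h₃ hF (h.frame hF hP)
  · simp [h.eval_timeE_pred]
  · simp [(h.frame hF hP).eval_timeE_node]

theorem run_maxLower (h : AtEdge D m n s) (hN : D.T + 1 ≤ N) :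
    Run D.q N maxLower s fun s' => s'.rvar RVar.maxLower =
      partialSups (fun j => D.lo (D.time m + 1 + j)) (D.time n - (D.time m + 1)) := by
  refine Run.seq (Run.rset ?_)
  have first : (lowerE (timeE (.var IVar.pred) + 1)).eval D.q s = D.lo (D.time m + 1) := by
    simp [h.eval_lowerE, h.eval_timeE_pred]
  rw [first]
  refine (run_forTimes (fun r s' => s'.rvar RVar.maxLower =
      partialSups (fun j => D.lo (D.time m + 1 + j)) (r - (D.time m + 2)))
    (h.frame (frame_setR _ _ _) (by decide)) hN (by decide) (by decide) (by simp) ?_).mono ?_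
  · intro r s' h₁ _ hr _ hs hI
    have hmax : partialSups (fun j => D.lo (D.time m + 1 + j)) (r + 1 - (D.time m + 2)) =
        max (s'.rvar RVar.maxLower) (D.lo r) := by
      rw [hI]
      obtain ⟨d, rfl⟩ := Nat.exists_eq_add_of_lt h₁
      cases d with
      | zero => simp
      | succ d =>
        rw [show D.time m + (d + 1) + 1 + 1 - (D.time m + 2) = d + 1 by omega,
          show D.time m + (d + 1) + 1 - (D.time m + 2) = d by omega, partialSups_add_one]
        congr 2
        omega
    rw [hmax]
    refine Run.ite (fun hb => Run.rset ?_) (fun hb => Run.skip ?_) <;>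
      simp only [Test.Holds, RExp.eval_var, hs.eval_lowerE, NExp.eval_var, hr] at hb
    · simp [hs.eval_lowerE, hr, max_eq_right hb]
    · simp [max_eq_left (not_le.1 hb).le]
  · intro s' hI _
    rw [hI]
    congr 1
    omega

theorem run_nodeVal (h : Env D s) {e : NExp} {v : ℕ} (he : e.eval s = n) (hn : n ≤ D.endNode) :
    Run D.q N (nodeVal e v) s fun s' => s'.rvar v = D.nodeVal n := by
  have hkind := h.eval_kindE he hn
  have htime := h.eval_timeE he hn
  refine Run.ite (fun hb => Run.rset ?_) (fun hb =>
    Run.ite (fun hb' => Run.rset ?_) (fun hb' => Run.rset ?_)) <;>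
    simp only [Test.Holds, hkind, NExp.eval_ofNat] at hb <;>
    try simp only [Test.Holds, hkind, NExp.eval_ofNat] at hb'
  · rw [CoordProblem.nodeVal, if_neg (by omega), if_neg (by omega)]
    simp
  · rw [CoordProblem.nodeVal, if_neg (by omega), if_pos (by omega)]
    simp [h.eval_upperE, htime]
  · rw [CoordProblem.nodeVal, if_pos (by omega)]
    simp [h.eval_lowerE, htime]

theorem run_constVal (h : AtEdge D m n s) (hmax : s.rvar RVar.maxLower =
      partialSups (fun j => D.lo (D.time m + 1 + j)) (D.time n - (D.time m + 1))) :
    Run D.q N constVal s fun s' => s'.rvar RVar.constVal = D.constVal m n := by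
  refine Run.ite (fun hb => Run.rset ?_) (fun hb => Run.rset ?_) <;>
    simp only [Test.Holds, h.eval_kindE_node, NExp.eval_ofNat] at hb
  · rw [CoordProblem.constVal, if_pos (by omega)]
    simp
  · rw [CoordProblem.constVal, if_neg (by omega)]
    simp [hmax]

theorem run_targetVal (h : AtEdge D m n s) (hconst : s.rvar RVar.constVal = D.constVal m n) :
    Run D.q N targetVal s fun s' => s'.rvar RVar.targetVal = D.targetVal m n := by
  refine Run.ite (fun hb => Run.rset ?_) (fun hb =>
    (run_nodeVal h.toEnv (e := .var IVar.node) h.node h.le_endNode).mono fun s' hs _ => ?_) <;>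
    simp only [Test.Holds, h.eval_endNodeE, NExp.eval_var, h.node] at hb
  · rw [CoordProblem.targetVal, if_pos hb]
    simp [hconst]
  · rw [CoordProblem.targetVal, if_neg hb, hs]

theorem run_sourceVal (h : AtEdge D m n s) (htarget : s.rvar RVar.targetVal = D.targetVal m n) :
    Run D.q N sourceVal s fun s' => s'.rvar RVar.sourceVal = D.sourceVal m n := by
  refine Run.ite (fun hb => Run.rset ?_) (fun hb =>
    (run_nodeVal h.toEnv (e := .var IVar.pred) h.pred h.pred_le_endNode).mono fun s' hs _ => ?_) <;>
    simp only [Test.Holds, h.eval_timeE_pred, NExp.eval_ofNat] at hb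
  · rw [CoordProblem.sourceVal, if_pos (by omega)]
    simp [htarget]
  · rw [CoordProblem.sourceVal, if_neg (by omega), hs]

/-- The data of the edge from `m` to `n` are in the variables. -/
structure EdgeData (D : CoordProblem) (m n : ℕ) (s : Store) : Prop where
  last : s.rvar RVar.lastVal = D.lastVal m n
  slope : s.rvar RVar.slope = D.slope m n
  cost : s.rvar RVar.cost = D.edgeCost m n

theorem EdgeData.frame (h : EdgeData D m n s) (hF : Frame L s s')
    (hL : ∀ l ∈ [.rvar RVar.lastVal, .rvar RVar.slope, .rvar RVar.cost], l ∉ L) :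
    EdgeData D m n s' where
  last := (hF.rvar (hL _ (by decide))).trans h.last
  slope := (hF.rvar (hL _ (by decide))).trans h.slope
  cost := (hF.rvar (hL _ (by decide))).trans h.cost

theorem run_jumpEdge (hq : D.q = 0) (h : AtEdge D m n s)
    (hconst : s.rvar RVar.constVal = D.constVal m n) :
    Run D.q N jumpEdge s (EdgeData D m n) := by
  refine Run.seq (Run.rset (Run.seq (Run.rset ?_)))
  set s₂ := Store.setR _ RVar.slope _ with hs₂
  have h₂ : AtEdge D m n s₂ :=
    (h.frame (frame_setR _ _ _) (by decide)).frame (frame_setR _ _ _) (by decide)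
  have hlast : s₂.rvar RVar.lastVal = D.lastVal m n := by
    simp [hs₂, hconst, CoordProblem.lastVal, hq]
  have hslope : s₂.rvar RVar.slope = D.slope m n := by simp [hs₂, CoordProblem.slope, hq]
  refine Run.ite (fun hb => Run.rset ⟨by simpa using hlast, by simpa using hslope, ?_⟩)
    (fun hb => Run.rset ⟨by simpa using hlast, by simpa using hslope, ?_⟩) <;>
    simp only [Test.Holds, h₂.eval_timeE_pred, h₂.eval_timeE_node, h₂.eval_kindE_pred,
      h₂.eval_kindE_node, NExp.eval_ofNat] at hb <;>
    rw [CoordProblem.edgeCost, if_pos hq]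
  · rw [if_neg (by omega)]
    simp
  · rw [if_pos (by omega)]
    simp

theorem run_slopeEdge (hq : D.q ≠ 0) (h : AtEdge D m n s)
    (htarget : s.rvar RVar.targetVal = D.targetVal m n)
    (hsource : s.rvar RVar.sourceVal = D.sourceVal m n) :
    Run D.q N slopeEdge s (EdgeData D m n) := by
  have last : Run D.q N (.ite (.nle endNodeE (.var IVar.node))
      (.rset RVar.lastVal (.var RVar.sourceVal)) (.rset RVar.lastVal (.var RVar.targetVal))) s
      fun s' => s'.rvar RVar.lastVal = D.lastVal m n := by
    rw [CoordProblem.lastVal, if_neg hq]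
    refine Run.ite (fun hb => Run.rset ?_) (fun hb => Run.rset ?_) <;>
      simp only [Test.Holds, h.eval_endNodeE, NExp.eval_var, h.node] at hb
    · simp [hb, hsource]
    · simp [hb, htarget]
  refine Run.seq (last.mono fun s₁ hlast hF => ?_)
  have h₁ := h.frame hF (by decide)
  have hslope : ((.var RVar.lastVal - .var RVar.sourceVal) / .ofN stepsE : RExp).eval D.q s₁ =
      D.slope m n := by
    rw [CoordProblem.slope, if_neg hq]
    simp [hlast, hF.rvar (v := RVar.sourceVal) (by decide), hsource, h₁.eval_stepsE]
  refine Run.seq (Run.rset (Run.rset ?_))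
  rw [hslope]
  have h₂ : AtEdge D m n (s₁.setR RVar.slope (D.slope m n)) :=
    h₁.frame (frame_setR _ _ _) (by decide)
  refine ⟨by simp [hlast], by simp, ?_⟩
  rw [CoordProblem.edgeCost, if_neg hq]
  simp [h₂.eval_stepsE]

theorem run_edgeData (hq : D.q = 0 ∨ 1 ≤ D.q) (h : AtEdge D m n s)
    (hconst : s.rvar RVar.constVal = D.constVal m n)
    (htarget : s.rvar RVar.targetVal = D.targetVal m n)
    (hsource : s.rvar RVar.sourceVal = D.sourceVal m n) :
    Run D.q N edgeData s (EdgeData D m n) := by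
  have htest : Test.Holds D.q s (.rle (.pen 2) 1) ↔ D.q = 0 := by
    simpa using penalty_two_le_one_iff hq
  exact Run.ite (fun hb => run_jumpEdge (htest.1 hb) h hconst)
    (fun hb => run_slopeEdge (mt htest.2 hb) h htarget hsource)

theorem run_checkEdge (h : AtEdge D m n s) (hN : D.T + 1 ≤ N) (hdata : EdgeData D m n s) :
    Run D.q N checkEdge s fun s' => 1 ≤ s'.nvar IVar.admissible ↔ D.Admissible m n := by
  refine Run.seq (Run.nset ?_)
  refine (run_forTimes (fun r s' => 1 ≤ s'.nvar IVar.admissible ↔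
      ∀ r', D.time m < r' → r' < r → D.piece m n r' ∈ Set.Icc (D.lo r') (D.hi r'))
    (h.frame (frame_setN _ _ _) (by decide)) hN (by decide) (by decide) ?_ ?_).mono ?_
  · exact iff_of_true (by simp) fun r' h₁ h₂ => by omega
  · intro r s' h₁ _ hr hF hs hI
    have hpiece : pieceE.eval D.q s' = D.piece m n r := by
      simp [pieceE, hs.eval_timeE_node, hr, hF.rvar (v := RVar.lastVal) (by decide),
        hF.rvar (v := RVar.slope) (by decide), hdata.last, hdata.slope, CoordProblem.piece]
    have hsplit : (∀ r', D.time m < r' → r' < r + 1 →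
          D.piece m n r' ∈ Set.Icc (D.lo r') (D.hi r')) ↔
        1 ≤ s'.nvar IVar.admissible ∧ D.piece m n r ∈ Set.Icc (D.lo r) (D.hi r) := by
      rw [hI]
      grind
    simp only [hsplit]
    refine Run.ite (fun hb => Run.skip ?_) (fun hb => Run.nset ?_) <;>
      simp only [Test.Holds, hs.eval_lowerE, hs.eval_upperE, hpiece, NExp.eval_var, hr] at hb
    · simp [hb]
    · simp [Set.mem_Icc, hb]
  · intro s' hI _
    rw [hI]
    exact forall_congr' fun r => by rw [Nat.lt_succ_iff]

/-- The edge from `m` to the current node `n` is in the memory. -/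
structure EdgeEntry (D : CoordProblem) (n m : ℕ) (s : Store) : Prop where
  admissible : 1 ≤ s.ncell (IArr.admissible, m, 0, 0) ↔ D.Admissible m n
  weight : s.ncell (IArr.weight, m, 0, 0) = D.weight m n
  cost : s.rcell (RArr.cost, m, 0, 0) = D.edgeCost m n
  last : s.rcell (RArr.last, m, 0, 0) = D.lastVal m n
  slope : s.rcell (RArr.slope, m, 0, 0) = D.slope m n

abbrev edgeEntryLocs : List Loc :=
  [.narr IArr.admissible, .narr IArr.weight, .rarr RArr.cost, .rarr RArr.last, .rarr RArr.slope]

theorem EdgeEntry.frame (h : EdgeEntry D n m s) (hF : Frame L s s')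
    (hL : ∀ l ∈ edgeEntryLocs, l ∉ L) : EdgeEntry D n m s' where
  admissible := by rw [hF.ncell (hL _ (by decide))]; exact h.admissible
  weight := (hF.ncell (hL _ (by decide)) _).trans h.weight
  cost := (hF.rcell (hL _ (by decide)) _).trans h.cost
  last := (hF.rcell (hL _ (by decide)) _).trans h.last
  slope := (hF.rcell (hL _ (by decide)) _).trans h.slope

theorem run_storeEdge (h : AtEdge D m n s) (hdata : EdgeData D m n s)
    (hadm : 1 ≤ s.nvar IVar.admissible ↔ D.Admissible m n) :
    Run D.q N storeEdge s fun s' => EdgeEntry D n m s' ∧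
      ∀ m', m' ≠ m → EdgeEntry D n m' s → EdgeEntry D n m' s' := by
  refine Run.seq (Run.nput (Run.seq (Run.nput (Run.seq (Run.rput (Run.seq (Run.rput
    (Run.rput ?_))))))))
  have hweight : (stepsE - (kindE (.var IVar.node) - 1)).eval
      (s.putN (IArr.admissible, m, 0, 0) (s.nvar IVar.admissible)) = D.weight m n := by
    have h' : AtEdge D m n (s.putN (IArr.admissible, m, 0, 0) (s.nvar IVar.admissible)) :=
      h.frame (frame_putN _ _ _ _) (by decide)
    simp only [NExp.eval_sub, h'.eval_stepsE, h'.eval_kindE_node, NExp.eval_ofNat,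
      CoordProblem.weight]
    split_ifs <;> omega
  simp only [NExp.eval_var, NExp.eval_ofNat, RExp.eval_var, h.pred, Store.putN_nvar,
    Store.putN_rvar, Store.putR_nvar, Store.putR_rvar, hweight, hdata.last, hdata.slope,
    hdata.cost]
  refine ⟨⟨?_, ?_, ?_, ?_, ?_⟩, fun m' hm' hE => ⟨?_, ?_, ?_, ?_, ?_⟩⟩
  · simpa using hadm
  iterate 4 simp
  · simpa [hm'] using hE.admissible
  · simpa [hm'] using hE.weight
  · simpa [hm'] using hE.cost
  · simpa [hm'] using hE.last
  · simpa [hm'] using hE.slope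

end ProxGL.Program

namespace ProxGL

/-! ### Correctness: the table -/

namespace Tableau

/-- Two tables agree on the entry at the node `n` with the budget `k`. -/
structure AgreeAt (A B : Tableau) (n k : ℕ) : Prop where
  reachable : B.reachable n k ↔ A.reachable n k
  value : B.value n k = A.value n k
  traj : ∀ r, B.traj n k r = A.traj n k r

variable {A B C : Tableau} {n k : ℕ}

theorem AgreeAt.refl (A : Tableau) (n k : ℕ) : AgreeAt A A n k := ⟨.rfl, rfl, fun _ => rfl⟩

theorem AgreeAt.trans (h : AgreeAt A B n k) (h' : AgreeAt B C n k) : AgreeAt A C n k :=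
  ⟨h'.reachable.trans h.reachable, h'.value.trans h.value, fun r => (h'.traj r).trans (h.traj r)⟩

end Tableau

namespace CoordProblem

variable {D : CoordProblem} {A B : Tableau} {m n k : ℕ}

theorem cand_congr (h : A.AgreeAt B m (k - D.weight m n)) : D.Cand B n k m ↔ D.Cand A n k m := by
  rw [Cand, Cand, h.reachable]

theorem Cell.congr (h : D.Cell A n k) (heq : A.AgreeAt B n k)
    (hlt : ∀ m < n, ∀ k', A.AgreeAt B m k') : D.Cell B n k := by
  refine ⟨fun hr => ?_, fun m hm hc => ?_⟩
  · obtain ⟨m, hm, hc, hval, htraj⟩ := h.attained (heq.reachable.1 hr)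
    have hm' := hlt m (by omega) (k - D.weight m n)
    refine ⟨m, hm, (cand_congr hm').2 hc, by rw [heq.value, hval, hm'.value], fun r h₁ h₂ => ?_⟩
    rw [heq.traj, htraj r h₁ h₂, hm'.traj]
  · obtain ⟨hr, hval⟩ := h.bound m hm ((cand_congr (hlt m (by omega) _)).1 hc)
    rw [heq.reachable, heq.value, (hlt m (by omega) _).value]
    exact ⟨hr, hval⟩

end CoordProblem

namespace Program

open RealRAM

attribute [local simp] Test.Holds

variable {D : CoordProblem} {s s' : Store} {L : List Loc} {N m n k b : ℕ}

theorem run_edge (hq : D.q = 0 ∨ 1 ≤ D.q) (h : AtEdge D m n s) (hN : D.T + 1 ≤ N) :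
    Run D.q N edge s fun s' => EdgeEntry D n m s' ∧
      ∀ m', m' ≠ m → EdgeEntry D n m' s → EdgeEntry D n m' s' := by
  refine Run.seq ((run_maxLower h hN).mono fun s₁ hmax f₁ => ?_)
  have h₁ := h.frame f₁ (by decide)
  refine Run.seq ((run_constVal h₁ hmax).mono fun s₂ hconst f₂ => ?_)
  have h₂ := h₁.frame f₂ (by decide)
  refine Run.seq ((run_targetVal h₂ hconst).mono fun s₃ htarget f₃ => ?_)
  have h₃ := h₂.frame f₃ (by decide)
  have hconst₃ := (f₃.rvar (v := RVar.constVal) (by decide)).trans hconst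
  refine Run.seq ((run_sourceVal h₃ htarget).mono fun s₄ hsource f₄ => ?_)
  have h₄ := h₃.frame f₄ (by decide)
  have hconst₄ := (f₄.rvar (v := RVar.constVal) (by decide)).trans hconst₃
  have htarget₄ := (f₄.rvar (v := RVar.targetVal) (by decide)).trans htarget
  refine Run.seq ((run_edgeData hq h₄ hconst₄ htarget₄ hsource).mono fun s₅ hdata f₅ => ?_)
  have h₅ := h₄.frame f₅ (by decide)
  refine Run.seq ((run_checkEdge h₅ hN hdata).mono fun s₆ hadm f₆ => ?_)
  have h₆ := h₅.frame f₆ (by decide)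
  refine (run_storeEdge h₆ (hdata.frame f₆ (by decide)) hadm).mono
    fun s₇ ⟨hE, hkeep⟩ _ => ⟨hE, fun m' hm' hE' => hkeep m' hm' ?_⟩
  exact (((((hE'.frame f₁ (by decide)).frame f₂ (by decide)).frame f₃ (by decide)).frame f₄
    (by decide)).frame f₅ (by decide)).frame f₆ (by decide)

theorem run_forPreds {P : Prog} (I : ℕ → Store → Prop) (h : Env D s)
    (hn : s.nvar IVar.node = n) (hle : n ≤ D.endNode) (hN : 3 * D.T + 10 ≤ N)
    (hv : .nvar IVar.pred ∉ P.writes)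
    (hP : ∀ l ∈ .nvar IVar.node :: envLocs, l ∉ (forPreds P).writes)
    (init : I 0 (s.setN IVar.pred 0))
    (step : ∀ m s', AtEdge D m n s' → Frame (forPreds P).writes s s' → I m s' →
      Run D.q N P s' fun s'' => I (m + 1) (s''.setN IVar.pred (m + 1))) :
    Run D.q N (forPreds P) s (I (n - n % 3)) := by
  have hend : D.endNode = 3 * (D.T + 2) := rfl
  have env (s') (hF : Frame (forPreds P).writes s s') : Env D s' ∧ s'.nvar IVar.node = n :=
    ⟨h.frame hF fun l hl => hP l (.tail _ hl), (hF.nvar (hP _ (.head _))).trans hn⟩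
  refine Run.forLoop I rfl (Nat.zero_le _) (by omega) hv init (fun s' hF => ?_)
    fun m s' _ hm hpred hF => ?_
  · rw [NExp.eval_sub, (env s' hF).1.eval_kindE (e := .var IVar.node) (env s' hF).2 hle,
      NExp.eval_var, (env s' hF).2]
  · exact step m s' ⟨(env s' hF).1, hpred, (env s' hF).2, hle, by omega⟩ hF

theorem run_edges (hq : D.q = 0 ∨ 1 ≤ D.q) (h : Env D s) (hn : s.nvar IVar.node = n)
    (hle : n ≤ D.endNode) (hN : 3 * D.T + 10 ≤ N) :
    Run D.q N (forPreds edge) s fun s' => ∀ m, m / 3 < n / 3 → EdgeEntry D n m s' := by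
  refine (run_forPreds (fun b s' => ∀ m < b, EdgeEntry D n m s') h hn hle hN (by decide)
    (by decide) (by simp) fun b s' hs _ hI => ?_).mono fun s' hI _ m hm => hI m (by omega)
  refine (run_edge hq hs (by omega)).mono fun s'' ⟨hE, hkeep⟩ _ m hm => ?_
  have done : EdgeEntry D n m s'' := by
    rcases Nat.lt_succ_iff_lt_or_eq.1 hm with hlt | rfl
    · exact hkeep m hlt.ne (hI m hlt)
    · exact hE
  exact done.frame (frame_setN _ _ _) (by decide)

theorem run_forBudgets {P : Prog} (I : ℕ → Store → Prop) (h : Input D s) (hN : D.T + 2 ≤ N)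
    (hv : .nvar IVar.budget ∉ P.writes) (hP : ∀ l ∈ inputLocs, l ∉ (forBudgets P).writes)
    (init : I 0 (s.setN IVar.budget 0))
    (step : ∀ k s', k ≤ D.T + 1 → s'.nvar IVar.budget = k → Frame (forBudgets P).writes s s' →
      I k s' → Run D.q N P s' fun s'' => I (k + 1) (s''.setN IVar.budget (k + 1))) :
    Run D.q N (forBudgets P) s (I (D.T + 2)) := by
  refine Run.forLoop I rfl (Nat.zero_le _) hN hv init (fun s' hF => ?_)
    fun k s' _ hk hb => step k s' (by omega) hb
  simp [(h.frame hF hP).horizon]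

/-- The table in the memory. -/
def tableau (s : Store) : Tableau where
  reachable n k := 1 ≤ s.ncell (IArr.reachable, n, k, 0)
  value n k := s.rcell (RArr.value, n, k, 0)
  traj n k r := s.rcell (RArr.traj, n, k, r)

abbrev tableauLocs : List Loc := [.narr IArr.reachable, .rarr RArr.value, .rarr RArr.traj]

theorem tableau_frame (hF : Frame L s s') (hL : ∀ l ∈ tableauLocs, l ∉ L) :
    tableau s' = tableau s := by
  simp only [tableau, hF.ncell (hL (.narr IArr.reachable) (by decide)),
    hF.rcell (hL (.rarr RArr.value) (by decide)), hF.rcell (hL (.rarr RArr.traj) (by decide))]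

/-- The entry at the node `n` with the budget `k` is being computed. -/
structure AtCell (D : CoordProblem) (n k : ℕ) (s : Store) : Prop extends Env D s where
  node : s.nvar IVar.node = n
  budget : s.nvar IVar.budget = k
  le_endNode : n ≤ D.endNode
  entry : ∀ m, m / 3 < n / 3 → EdgeEntry D n m s

abbrev atCellLocs : List Loc :=
  .nvar IVar.node :: .nvar IVar.budget :: (envLocs ++ edgeEntryLocs)

theorem AtCell.frame (h : AtCell D n k s) (hF : Frame L s s') (hL : ∀ l ∈ atCellLocs, l ∉ L) :
    AtCell D n k s' where
  toEnv := h.toEnv.frame hF fun l hl => hL l (.tail _ (.tail _ (List.mem_append_left _ hl)))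
  node := (hF.nvar (hL _ (by decide))).trans h.node
  budget := (hF.nvar (hL _ (by decide))).trans h.budget
  le_endNode := h.le_endNode
  entry m hm := (h.entry m hm).frame hF fun l hl =>
    hL l (.tail _ (.tail _ (List.mem_append_right _ hl)))

/-- The memory holds the best candidate among the predecessors `m < b` of the node `n` with the
budget `k`. -/
structure BestAmong (D : CoordProblem) (A : Tableau) (n k b : ℕ) (s : Store) : Prop where
  attained : 1 ≤ s.nvar IVar.found → ∃ m < b, D.Cand A n k m ∧ s.nvar IVar.bestPred = m ∧
    s.rvar RVar.bestCost = A.value m (k - D.weight m n) + D.edgeCost m n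
  bound : ∀ m < b, D.Cand A n k m → 1 ≤ s.nvar IVar.found ∧
    s.rvar RVar.bestCost ≤ A.value m (k - D.weight m n) + D.edgeCost m n

abbrev bestLocs : List Loc := [.nvar IVar.found, .nvar IVar.bestPred, .rvar RVar.bestCost]

namespace BestAmong

variable {A : Tableau}

theorem frame (h : BestAmong D A n k b s) (hF : Frame L s s') (hL : ∀ l ∈ bestLocs, l ∉ L) :
    BestAmong D A n k b s' := by
  have found := hF.nvar (hL (.nvar IVar.found) (by decide))
  have bestPred := hF.nvar (hL (.nvar IVar.bestPred) (by decide))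
  have bestCost := hF.rvar (hL (.rvar RVar.bestCost) (by decide))
  constructor
  · rw [found, bestPred, bestCost]
    exact h.attained
  · rw [found, bestCost]
    exact h.bound

theorem succ_of_bound (h : BestAmong D A n k b s)
    (hb : D.Cand A n k b → 1 ≤ s.nvar IVar.found ∧
      s.rvar RVar.bestCost ≤ A.value b (k - D.weight b n) + D.edgeCost b n) :
    BestAmong D A n k (b + 1) s where
  attained hf := by
    obtain ⟨m, hm, hc⟩ := h.attained hf
    exact ⟨m, by omega, hc⟩
  bound m hm hc := by
    rcases Nat.lt_succ_iff_lt_or_eq.1 hm with hlt | rfl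
    · exact h.bound m hlt hc
    · exact hb hc

theorem cell {B : Tableau} (h : BestAmong D A n k (n - n % 3) s)
    (hlt : ∀ m < n, ∀ k', A.AgreeAt B m k') (hr : B.reachable n k ↔ 1 ≤ s.nvar IVar.found)
    (hv : B.value n k = s.rvar RVar.bestCost)
    (htraj : ∀ m, m / 3 < n / 3 → s.nvar IVar.bestPred = m → ∀ r, 1 ≤ r → r ≤ D.time n →
      B.traj n k r = if r ≤ D.time m then A.traj m (k - D.weight m n) r else D.piece m n r) :
    D.Cell B n k := by
  refine ⟨fun hreach => ?_, fun m hm hc => ?_⟩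
  · obtain ⟨m, hm, hc, hpred, hcost⟩ := h.attained (hr.1 hreach)
    have hm' := hlt m (by omega) (k - D.weight m n)
    refine ⟨m, by omega, (CoordProblem.cand_congr hm').2 hc, by rw [hv, hcost, hm'.value], ?_⟩
    simpa only [hm'.traj] using htraj m (by omega) hpred
  · rw [hr, hv, (hlt m (by omega) _).value]
    exact h.bound m (by omega) ((CoordProblem.cand_congr (hlt m (by omega) _)).1 hc)

end BestAmong

theorem AtCell.eval_restE (h : AtCell D n k s) {e : NExp} (he : e.eval s = m)
    (hm : m / 3 < n / 3) : (restE e).eval s = k - D.weight m n := by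
  simp [restE, he, h.budget, (h.entry m hm).weight]

theorem AtCell.candTest_holds (h : AtCell D n k s) (hpred : s.nvar IVar.pred = m)
    (hm : m / 3 < n / 3) : candTest.Holds D.q s ↔ D.Cand (tableau s) n k m := by
  have hE := h.entry m hm
  simp [candTest, reachableE, h.eval_restE (e := .var IVar.pred) hpred hm, hpred, hE.admissible,
    hE.weight, h.budget, CoordProblem.Cand, tableau]

theorem run_improve (h : AtCell D n k s) (hpred : s.nvar IVar.pred = b) (hb : b / 3 < n / 3)
    (hcand : D.Cand (tableau s) n k b) (hbest : BestAmong D (tableau s) n k b s) :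
    Run D.q N improve s (BestAmong D (tableau s) n k (b + 1)) := by
  refine Run.seq (Run.rset ?_)
  have hcost : (valueE (.var IVar.pred) (restE (.var IVar.pred)) +
      .get RArr.cost (.var IVar.pred) 0 0).eval D.q s =
      (tableau s).value b (k - D.weight b n) + D.edgeCost b n := by
    simp [valueE, h.eval_restE (e := .var IVar.pred) hpred hb, hpred, (h.entry b hb).cost, tableau]
  rw [hcost]
  refine Run.ite (fun ht => Run.skip ?_)
    (fun ht => Run.seq (Run.nset (Run.seq (Run.rset (Run.nset ?_)))))
  · refine (hbest.frame (frame_setR s RVar.cost _) (by decide)).succ_of_bound fun _ => ?_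
    simp_all [le_of_lt]
  · simp only [Test.Holds, NExp.eval_ofNat, NExp.eval_var, RExp.eval_var, Store.setR_nvar,
      Store.setR_rvar, not_and, not_not, Function.update_apply] at ht
    refine ⟨fun _ => ⟨b, by omega, hcand, by simp [hpred], by simp⟩, fun m hm hc => ?_⟩
    rcases Nat.lt_succ_iff_lt_or_eq.1 hm with hlt | rfl
    · obtain ⟨hf, hle⟩ := hbest.bound m hlt hc
      simpa using (ht hf).trans hle
    · simp

theorem run_best (h : AtCell D n k s) (hN : 3 * D.T + 10 ≤ N) :
    Run D.q N best s (BestAmong D (tableau s) n k (n - n % 3)) := by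
  refine Run.seq (Run.nset ?_)
  have f₁ := frame_setN s IVar.found 0
  have h₁ := h.frame f₁ (by decide)
  refine run_forPreds _ h₁.toEnv h₁.node h.le_endNode hN (by decide) (by decide)
    ⟨by simp, by simp⟩ fun b s' hs hF hI => ?_
  have hs' := h₁.frame hF (by decide)
  have hA : tableau s' = tableau s :=
    (tableau_frame hF (by decide)).trans (tableau_frame f₁ (by decide))
  rw [← hA] at hI ⊢
  refine (Run.ite (fun hb => ?_) fun hb => Run.skip ?_ : Run D.q N _ s' _).mono
    fun s'' (hQ : BestAmong D (tableau s') n k (b + 1) s'') _ =>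
      hQ.frame (frame_setN _ _ _) (by decide)
  · exact run_improve hs' hs.pred hs.lt ((hs'.candTest_holds hs.pred hs.lt).1 hb) hI
  · exact hI.succ_of_bound fun hc => absurd ((hs'.candTest_holds hs.pred hs.lt).2 hc) hb

/-- The entry at time `r` of the extension to `n`, within the budget `k`, of the path to `m` that is
in the memory. -/
noncomputable def extension (D : CoordProblem) (n k m : ℕ) (s : Store) (r : ℕ) : ℝ :=
  if r ≤ s.ncell (IArr.time, m, 0, 0) then
    s.rcell (RArr.traj, m, k - s.ncell (IArr.weight, m, 0, 0), r)
  else s.rcell (RArr.last, m, 0, 0) - s.rcell (RArr.slope, m, 0, 0) * (D.time n - r : ℕ)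

theorem run_storeTraj (h : AtCell D n k s) (hm : s.nvar IVar.bestPred = m) (hN : D.T + 1 ≤ N) :
    Run D.q N storeTraj s fun s' => ∀ n' k' r, s'.rcell (RArr.traj, n', k', r) =
      if n' = n ∧ k' = k ∧ 1 ≤ r ∧ r ≤ D.time n then extension D n k m s r
      else s.rcell (RArr.traj, n', k', r) := by
  have := D.time_le n
  refine (Run.forLoop (a := 1) (b := D.time n + 1) (fun b s' => ∀ n' k' r,
      s'.rcell (RArr.traj, n', k', r) =
        if n' = n ∧ k' = k ∧ 1 ≤ r ∧ r < b then extension D n k m s r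
        else s.rcell (RArr.traj, n', k', r))
    rfl (by omega) (by omega) (by decide) (fun n' k' r => ?_) (fun s' hF => ?_) ?_).mono
    fun s' hI _ n' k' r => ?_
  · rw [if_neg (by omega)]
    rfl
  · have hs := h.frame hF (by decide)
    simp [hs.eval_timeE (e := .var IVar.node) hs.node hs.le_endNode]
  · intro b s' hb _ hr hF hI
    have hs := h.frame hF (by decide)
    have hm' := (hF.nvar (v := IVar.bestPred) (by decide)).trans hm
    have htime := hs.eval_timeE (e := .var IVar.node) hs.node hs.le_endNode
    have unread : ∀ n' k', s'.rcell (RArr.traj, n', k', b) = s.rcell (RArr.traj, n', k', b) :=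
      fun n' k' => by rw [hI, if_neg (by omega)]
    suffices body : Run D.q N _ s' fun s'' =>
        s'' = s'.putR (RArr.traj, n, k, b) (extension D n k m s b) by
      refine body.mono fun s'' hs'' _ n' k' r => ?_
      rw [hs'']
      simp only [Store.setN_rcell, Store.putR_rcell, Function.update_apply, hI, Prod.mk.injEq]
      grind
    refine Run.ite (fun ht => Run.rput ?_) (fun ht => Run.rput ?_) <;>
      simp only [Test.Holds, timeE, NExp.eval_get, NExp.eval_var, NExp.eval_ofNat, hr, hm',
        hF.ncell (a := IArr.time) (by decide)] at ht
    · simp [extension, ht, hr, hm', hs.node, hs.budget, trajE, restE, unread,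
        hF.ncell (a := IArr.weight) (by decide)]
    · simp [extension, ht, hr, hm', hs.node, hs.budget, htime,
        hF.rcell (a := RArr.last) (by decide), hF.rcell (a := RArr.slope) (by decide)]
  · rw [hI]
    simp only [Nat.lt_succ_iff]

theorem run_cell (h : AtCell D n k s) (hN : 3 * D.T + 10 ≤ N) :
    Run D.q N cell s fun s' => D.Cell (tableau s') n k ∧
      ∀ n' k', n' ≠ n ∨ k' ≠ k → (tableau s).AgreeAt (tableau s') n' k' := by
  refine Run.seq ((run_best h hN).mono fun s₁ hbest f₁ => ?_)
  have h₁ := h.frame f₁ (by decide)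
  rw [← tableau_frame f₁ (by decide)] at hbest ⊢
  refine Run.seq (Run.nput (Run.seq (Run.rput ?_)))
  simp only [NExp.eval_var, NExp.eval_ofNat, RExp.eval_var, Store.putN_nvar, Store.putN_rvar,
    h₁.node, h₁.budget]
  set s₂ := (s₁.putN (IArr.reachable, n, k, 0) (s₁.nvar IVar.found)).putR (RArr.value, n, k, 0)
    (s₁.rvar RVar.bestCost) with hs₂
  have h₂ : AtCell D n k s₂ :=
    (h₁.frame (frame_putN _ _ _ _) (by decide)).frame (frame_putR _ _ _ _) (by decide)
  refine (run_storeTraj h₂ rfl (by omega)).mono fun s₃ htraj f₃ => ?_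
  have agree (n' k' : ℕ) (hne : n' ≠ n ∨ k' ≠ k) :
      (tableau s₁).AgreeAt (tableau s₃) n' k' := by
    have hne' : ¬ (n' = n ∧ k' = k) := by omega
    refine ⟨?_, ?_, fun r => ?_⟩
    · simp [tableau, f₃.ncell (a := IArr.reachable) (by decide), hs₂, hne']
    · simp [tableau, f₃.rcell (a := RArr.value) (by decide), hs₂, hne']
    · simp only [tableau, htraj]
      rw [if_neg (fun h => hne' ⟨h.1, h.2.1⟩)]
      rfl
  refine ⟨hbest.cell (fun m hm k' => agree m k' (.inl hm.ne)) ?_ ?_ fun m hm hpred r hr₁ hr₂ => ?_,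
    agree⟩
  · simp [tableau, f₃.ncell (a := IArr.reachable) (by decide), hs₂]
  · simp [tableau, f₃.rcell (a := RArr.value) (by decide), hs₂]
  · have hE := h₂.entry m hm
    have hpred₂ : s₂.nvar IVar.bestPred = m := hpred
    have hle := h.le_endNode
    simp only [tableau, htraj, hpred₂, extension, hE.weight, hE.last, hE.slope,
      h₂.time m (by omega), CoordProblem.piece, hr₁, hr₂, and_self, if_true]
    rfl

theorem run_source (h : Input D s) (hN : D.T + 2 ≤ N) :
    Run D.q N source s fun s' => ∀ k ≤ D.T + 1,
      ((tableau s').reachable 0 k ∧ (tableau s').value 0 k = 0) ∧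
      ¬ (tableau s').reachable 1 k ∧ ¬ (tableau s').reachable 2 k := by
  refine (run_forBudgets (fun b s' => ∀ k < b,
      ((tableau s').reachable 0 k ∧ (tableau s').value 0 k = 0) ∧
      ¬ (tableau s').reachable 1 k ∧ ¬ (tableau s').reachable 2 k)
    h hN (by decide) (by decide) (by simp) fun b s' _ hb _ hI => ?_).mono
      fun s' hI _ k hk => hI k (by omega)
  refine Run.seq (Run.nput (Run.seq (Run.nput (Run.seq (Run.nput (Run.rput fun k hk => ?_))))))
  rcases Nat.lt_succ_iff_lt_or_eq.1 hk with hlt | rfl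
  · simpa [tableau, hb, hlt.ne] using hI k hlt
  · simp [tableau, hb]

theorem run_cells (h : Env D s) (hn : s.nvar IVar.node = n) (hle : n ≤ D.endNode)
    (hE : ∀ m, m / 3 < n / 3 → EdgeEntry D n m s) (hN : 3 * D.T + 10 ≤ N) :
    Run D.q N (forBudgets cell) s fun s' => (∀ k ≤ D.T + 1, D.Cell (tableau s') n k) ∧
      ∀ n' < n, ∀ k, (tableau s).AgreeAt (tableau s') n' k := by
  refine (run_forBudgets (fun b s' => (∀ k < b, D.Cell (tableau s') n k) ∧
      ∀ n' < n, ∀ k, (tableau s).AgreeAt (tableau s') n' k)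
    h.toInput (by omega) (by decide) (by decide) ⟨by simp, fun _ _ _ => .refl _ _ _⟩
    fun b s' _ hb hF ⟨hdone, hrows⟩ => ?_).mono
      fun s' ⟨hcells, hrows⟩ _ => ⟨fun k hk => hcells k (by omega), hrows⟩
  have hs : AtCell D n b s' := ⟨h.frame hF (by decide), (hF.nvar (by decide)).trans hn, hb, hle,
    fun m hm => (hE m hm).frame hF (by decide)⟩
  refine (run_cell hs hN).mono fun s'' ⟨hcell, hkeep⟩ _ =>
    ⟨fun k hk => ?_, fun n' hn' k => (hrows n' hn' k).trans (hkeep n' k (.inl hn'.ne))⟩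
  rcases Nat.lt_succ_iff_lt_or_eq.1 hk with hlt | rfl
  · exact (hdone k hlt).congr (hkeep n k (.inr hlt.ne)) fun m hm k' => hkeep m k' (.inl hm.ne)
  · exact hcell

theorem run_row (hq : D.q = 0 ∨ 1 ≤ D.q) (h : Env D s) (hn : s.nvar IVar.node = n)
    (hle : n ≤ D.endNode) (hN : 3 * D.T + 10 ≤ N) :
    Run D.q N (.seq (forPreds edge) (forBudgets cell)) s fun s' =>
      (∀ k ≤ D.T + 1, D.Cell (tableau s') n k) ∧
      ∀ n' < n, ∀ k, (tableau s).AgreeAt (tableau s') n' k := by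
  refine Run.seq ((run_edges hq h hn hle hN).mono fun s₁ hE f₁ => ?_)
  rw [← tableau_frame f₁ (by decide)]
  exact run_cells (h.frame f₁ (by decide)) ((f₁.nvar (by decide)).trans hn) hle hE hN

theorem run_table (hq : D.q = 0 ∨ 1 ≤ D.q) (h : Env D s) (hN : 3 * D.T + 10 ≤ N) :
    Run D.q N table s fun s' => D.IsTable (tableau s') := by
  have hend : D.endNode = 3 * (D.T + 2) := rfl
  refine Run.seq ((run_source h.toInput (by omega)).mono fun s₁ hsource f₁ => ?_)
  have h₁ := h.frame f₁ (by decide)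
  refine (Run.forLoop (fun b s' => (∀ n < 3, ∀ k, (tableau s₁).AgreeAt (tableau s') n k) ∧
      ∀ n, 3 ≤ n → n < b → ∀ k ≤ D.T + 1, D.Cell (tableau s') n k)
    (a := 3) (b := D.endNode + 1) rfl (by omega) (by omega) (by decide) ?_
    (fun s' hF => ?_) ?_).mono fun s' ⟨hfirst, hcells⟩ _ => ?_
  · exact ⟨fun _ _ _ => .refl _ _ _, fun n _ _ => by omega⟩
  · simp [(h₁.frame hF (by decide)).eval_endNodeE]
  · intro n s' h3 hlt hn hF ⟨hfirst, hcells⟩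
    refine (run_row hq (h₁.frame hF (by decide)) hn (by omega) hN).mono
      fun s'' ⟨hrow, hkeep⟩ _ => ⟨fun n' hn' k => (hfirst n' hn' k).trans (hkeep n' (by omega) k),
        fun n' hn' hlt' k hk => ?_⟩
    rcases Nat.lt_succ_iff_lt_or_eq.1 hlt' with hlt' | rfl
    · exact (hcells n' hn' hlt' k hk).congr (hkeep n' hlt' k) fun m hm => hkeep m (by omega)
    · exact hrow k hk
  · refine ⟨fun k hk => ?_, fun k hk => ?_, fun n hn hle => hcells n hn (by omega)⟩
    · rw [(hfirst 0 (by simp) k).reachable, (hfirst 0 (by simp) k).value]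
      exact (hsource k hk).1
    · rw [(hfirst 1 (by simp) k).reachable, (hfirst 2 (by simp) k).reachable]
      exact (hsource k hk).2

end Program

/-! ### Correctness: the envelope and the program -/

namespace Program

open RealRAM

attribute [local simp] Test.Holds

variable {D : CoordProblem} {A : Tableau} {s s' s'' : Store} {N i j k b : ℕ}

theorem run_updateCrossing (h : Input D s) (hk : s.nvar IVar.curBudget = k)
    (hb : s.nvar IVar.candBudget = b) (hbk : b < k) (hA : (tableau s).reachable D.endNode b)
    (hc : FirstCrossing ((tableau s).reachable D.endNode) ((tableau s).value D.endNode) k b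
      (s.nvar IVar.nextBudget) (s.rvar RVar.nextParam)) :
    Run D.q N updateCrossing s fun s' =>
      FirstCrossing ((tableau s).reachable D.endNode) ((tableau s).value D.endNode) k (b + 1)
        (s'.nvar IVar.nextBudget) (s'.rvar RVar.nextParam) := by
  refine Run.seq (Run.rset (Run.seq (Run.rset ?_)))
  set W := (tableau s).value D.endNode with hW
  set s₁ := s.setR RVar.cost ((valueE endNodeE (.var IVar.candBudget) -
    valueE endNodeE (.var IVar.curBudget)).eval D.q s) with hs₁
  have hcost : s₁.rvar RVar.cost = W b - W k := by
    simp [hs₁, hW, tableau, valueE, h.eval_endNodeE, hk, hb]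
  set s₂ := s₁.setR RVar.param (crossing W k b) with hs₂
  have hparam : (RExp.var RVar.cost / (.var RVar.cost +
      .ofN (.var IVar.curBudget - .var IVar.candBudget))).eval D.q s₁ = crossing W k b := by
    have hk₁ : s₁.nvar IVar.curBudget = k := hk
    have hb₁ : s₁.nvar IVar.candBudget = b := hb
    simp [crossing, hcost, hk₁, hb₁]
  rw [hparam, ← hs₂]
  refine Run.ite (fun hle => Run.seq (Run.rset (Run.nset ?_))) fun hlt => Run.skip ?_
  · have hle' : crossing W k b ≤ s.rvar RVar.nextParam := by simpa [hs₁, hs₂] using hle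
    simpa [hs₁, hs₂, hb] using hc.succ_of_crossing_le hbk hA hle'
  · have hlt' : s.rvar RVar.nextParam < crossing W k b := by simpa [hs₁, hs₂] using hlt
    simpa [hs₁, hs₂] using hc.succ fun _ => hlt'.le

theorem run_firstCrossing (h : Input D s) (hk : s.nvar IVar.curBudget = k) (hkT : k ≤ D.T + 1)
    (hN : D.T + 1 ≤ N) :
    Run D.q N firstCrossing s fun s' =>
      FirstCrossing ((tableau s).reachable D.endNode) ((tableau s).value D.endNode) k k
        (s'.nvar IVar.nextBudget) (s'.rvar RVar.nextParam) := by
  refine Run.seq (Run.rset (Run.seq (Run.nset ?_)))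
  set s₁ := (s.setR RVar.nextParam _).setN IVar.nextBudget _ with hs₁
  have f₁ : Frame [.nvar IVar.nextBudget, .rvar RVar.nextParam] s s₁ :=
    ((frame_setR _ _ _).mono (by simp)).trans ((frame_setN _ _ _).mono (by simp))
  have hk₁ := (f₁.nvar (v := IVar.curBudget) (by decide)).trans hk
  refine Run.forLoop (fun b s' => FirstCrossing ((tableau s).reachable D.endNode)
      ((tableau s).value D.endNode) k b (s'.nvar IVar.nextBudget) (s'.rvar RVar.nextParam))
    (a := 0) rfl (Nat.zero_le k) (by omega) (by decide) ?_
    (fun s' hF => (hF.nvar (by decide)).trans hk₁) fun b s' _ hbk hb hF hc => ?_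
  · exact ⟨fun _ h => by omega, Or.inl (by simp [hs₁, hk])⟩
  · have h' := (h.frame f₁ (by decide)).frame hF (by decide)
    have hk' := (hF.nvar (v := IVar.curBudget) (by decide)).trans hk₁
    have htab : tableau s' = tableau s :=
      (tableau_frame hF (by decide)).trans (tableau_frame f₁ (by decide))
    rw [← htab] at hc ⊢
    have hreach : (Test.nle 1 (reachableE endNodeE (.var IVar.candBudget))).Holds D.q s' ↔
        (tableau s').reachable D.endNode b := by
      simp [tableau, reachableE, h'.eval_endNodeE, hb]
    refine Run.ite (fun hA => ?_) fun hA => Run.skip (hc.succ fun hA' => absurd (hreach.2 hA') hA)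
    exact (run_updateCrossing h' hk' hb hbk (hreach.1 hA) hc).mono fun s'' hc' _ => hc'

theorem run_outputTraj (h : Input D s) (hj : s.nvar IVar.piece = j) (hN : D.T + 1 ≤ N) :
    Run D.q N outputTraj s fun s' => ∀ i' j' r, s'.rcell (RArr.output, i', j', r) =
      if i' = s.nvar IVar.coord ∧ j' = j ∧ r < D.T + 1
      then (tableau s).traj D.endNode (s.nvar IVar.curBudget) (r + 1)
      else s.rcell (RArr.output, i', j', r) := by
  refine Run.forLoop (fun b s' => ∀ i' j' r, s'.rcell (RArr.output, i', j', r) =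
      if i' = s.nvar IVar.coord ∧ j' = j ∧ r < b
      then (tableau s).traj D.endNode (s.nvar IVar.curBudget) (r + 1)
      else s.rcell (RArr.output, i', j', r))
    rfl (Nat.zero_le _) hN (by decide) (by simp) (fun s' hF => ?_)
    fun b s' _ hb hr hF hI => Run.rput fun i' j' r => ?_
  · simp [(h.frame hF (by decide)).horizon]
  · have hcoord := hF.nvar (v := IVar.coord) (by decide)
    have hpiece := (hF.nvar (v := IVar.piece) (by decide)).trans hj
    have hbudget := hF.nvar (v := IVar.curBudget) (by decide)
    have htraj : (trajE endNodeE (.var IVar.curBudget) (.var IVar.time + 1)).eval D.q s' =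
        (tableau s).traj D.endNode (s.nvar IVar.curBudget) (b + 1) := by
      simp [tableau, trajE, hbudget, hr, (h.frame hF (by decide)).eval_endNodeE,
        hF.rcell (a := RArr.traj) (by decide)]
    simp only [Store.setN, Store.putR, Function.update_apply, Prod.mk.injEq, true_and,
      NExp.eval_var, hcoord, hpiece, hr, htraj]
    by_cases hnew : i' = s.nvar IVar.coord ∧ j' = j ∧ r = b
    · obtain ⟨rfl, rfl, rfl⟩ := hnew
      simp
    · rw [if_neg hnew, hI]
      exact if_congr (by omega) rfl rfl

/-- The memory `s'` differs from `s` in the output by the piece `j` of the coordinate `i`, in which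
the budget `k` is optimal, and holds the budget of the next piece. -/
structure PieceOutput (D : CoordProblem) (A : Tableau) (i j k : ℕ) (s s' : Store) : Prop where
  crossing : FirstCrossing (A.reachable D.endNode) (A.value D.endNode) k k
    (s'.nvar IVar.curBudget) (s'.rcell (RArr.breaks, i, j + 1, 0))
  output : ∀ r < D.T + 1, s'.rcell (RArr.output, i, j, r) = A.traj D.endNode k (r + 1)
  breaks_eq : ∀ i' j', i' ≠ i ∨ j' ≠ j + 1 →
    s'.rcell (RArr.breaks, i', j', 0) = s.rcell (RArr.breaks, i', j', 0)
  output_eq : ∀ i' j' r, i' ≠ i ∨ j' ≠ j →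
    s'.rcell (RArr.output, i', j', r) = s.rcell (RArr.output, i', j', r)

theorem run_outputPiece (h : Input D s) (hi : s.nvar IVar.coord = i) (hj : s.nvar IVar.piece = j)
    (hk : s.nvar IVar.curBudget = k) (hkT : k ≤ D.T + 1) (hN : D.T + 1 ≤ N) :
    Run D.q N outputPiece s (PieceOutput D (tableau s) i j k s) := by
  refine Run.seq ((run_firstCrossing h hk hkT hN).mono fun s₁ hc f₁ => Run.seq (Run.rput ?_))
  have hi₁ := (f₁.nvar (v := IVar.coord) (by decide)).trans hi
  have hj₁ := (f₁.nvar (v := IVar.piece) (by decide)).trans hj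
  have hk₁ := (f₁.nvar (v := IVar.curBudget) (by decide)).trans hk
  set s₂ := s₁.putR _ _ with hs₂
  have f₂ : Frame [.rarr RArr.breaks] s₁ s₂ := frame_putR _ _ _ _
  have h₂ := (h.frame f₁ (by decide)).frame f₂ (by decide)
  have hi₂ := (f₂.nvar (v := IVar.coord) (by decide)).trans hi₁
  have hk₂ := (f₂.nvar (v := IVar.curBudget) (by decide)).trans hk₁
  refine Run.seq ((run_outputTraj h₂ hj₁ hN).mono fun s₃ hout f₃ => Run.nset ?_)
  rw [hi₂, hk₂, tableau_frame f₂ (by decide), tableau_frame f₁ (by decide)] at hout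
  have hbreaks (i' j' : ℕ) : s₃.rcell (RArr.breaks, i', j', 0) =
      if i' = i ∧ j' = j + 1 then s₁.rvar RVar.nextParam
      else s.rcell (RArr.breaks, i', j', 0) := by
    rw [f₃.rcell (by decide), ← f₁.rcell (a := RArr.breaks) (by decide), hs₂]
    simp [Function.update_apply, hi₁, hj₁]
  have hkeep (i' j' r : ℕ) : s₂.rcell (RArr.output, i', j', r) =
      s.rcell (RArr.output, i', j', r) :=
    (f₂.rcell (by decide) _).trans (f₁.rcell (by decide) _)
  have hnext : s₃.nvar IVar.nextBudget = s₁.nvar IVar.nextBudget := f₃.nvar (by decide)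
  constructor
  · simpa [hbreaks, hnext] using hc
  · exact fun r hr => (hout i j r).trans (if_pos ⟨rfl, rfl, hr⟩)
  · exact fun i' j' hne => (hbreaks i' j').trans (if_neg (by omega))
  · exact fun i' j' r hne => ((hout i' j' r).trans (if_neg (by omega))).trans (hkeep i' j' r)

/-- The memory holds the first `j` pieces of a solution path of the coordinate `i`, together with
the budget of the next piece. -/
structure Swept (D : CoordProblem) (A : Tableau) (i j : ℕ) (s : Store) : Prop where
  front : Front (A.reachable D.endNode) (A.value D.endNode) (D.T + 1) j
    (s.nvar IVar.curBudget) (s.rcell (RArr.breaks, i, j, 0))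
  first : s.rcell (RArr.breaks, i, 0, 0) = 0
  mono : ∀ j' < j, s.rcell (RArr.breaks, i, j', 0) ≤ s.rcell (RArr.breaks, i, j' + 1, 0)
  optimal : ∀ j' < j, D.OptimalOn (s.rcell (RArr.breaks, i, j', 0))
    (s.rcell (RArr.breaks, i, j' + 1, 0)) fun r => s.rcell (RArr.output, i, j', r - 1)

theorem Swept.next (hq : D.q = 0 ∨ 1 ≤ D.q) (hA : D.IsTable A) (h : Swept D A i j s)
    (hp : PieceOutput D A i j (s.nvar IVar.curBudget) s s') : Swept D A i (j + 1) s' := by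
  have hW := hA.antitone hq
  have hbreak (j' : ℕ) (hj' : j' ≠ j + 1) := hp.breaks_eq i j' (.inr hj')
  refine ⟨h.front.next hW hp.crossing, (hbreak 0 (by omega)).trans h.first,
    fun j' hj' => ?_, fun j' hj' => ?_⟩ <;>
  rw [hbreak j' hj'.ne] <;>
  rcases Nat.lt_succ_iff_lt_or_eq.1 hj' with hlt | rfl
  · rw [hbreak _ (by omega)]
    exact h.mono j' hlt
  · exact h.front.le_firstCrossing hW hp.crossing
  · rw [hbreak _ (by omega)]
    exact (h.optimal j' hlt).congr fun r _ _ => (hp.output_eq i j' _ (.inr hlt.ne)).symm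
  · refine (hA.optimalOn hq h.front.le h.front.attainable fun δ h₁ h₂ l =>
      h.front.optimal_of_le_firstCrossing hW hp.crossing h₁ h₂).congr fun r h₁ h₂ => ?_
    rw [hp.output _ (by omega), Nat.sub_add_cancel h₁]

/-- The memory holds a solution path of the coordinate `i`. -/
structure HasPath (D : CoordProblem) (i : ℕ) (s : Store) : Prop where
  pieces : s.ncell (IArr.pieces, i, 0, 0) = D.T + 2
  path : D.IsPath (D.T + 2) (fun j => s.rcell (RArr.breaks, i, j, 0))
    fun j r => s.rcell (RArr.output, i, j, r)

/-- Two memories agree on the output for the coordinates other than `i`. -/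
structure SameOutputExcept (i : ℕ) (s s' : Store) : Prop where
  pieces : ∀ i' ≠ i, s'.ncell (IArr.pieces, i', 0, 0) = s.ncell (IArr.pieces, i', 0, 0)
  breaks : ∀ i' ≠ i, ∀ j, s'.rcell (RArr.breaks, i', j, 0) = s.rcell (RArr.breaks, i', j, 0)
  output : ∀ i' ≠ i, ∀ j r, s'.rcell (RArr.output, i', j, r) = s.rcell (RArr.output, i', j, r)

theorem SameOutputExcept.trans (h : SameOutputExcept i s s') (h' : SameOutputExcept i s' s'') :
    SameOutputExcept i s s'' where
  pieces i' hi' := (h'.pieces i' hi').trans (h.pieces i' hi')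
  breaks i' hi' j := (h'.breaks i' hi' j).trans (h.breaks i' hi' j)
  output i' hi' j r := (h'.output i' hi' j r).trans (h.output i' hi' j r)

theorem HasPath.congr (h : HasPath D i s) (hs : SameOutputExcept k s s') (hik : i ≠ k) :
    HasPath D i s' := by
  refine ⟨(hs.pieces i hik).trans h.pieces, ?_⟩
  simpa only [hs.breaks i hik, hs.output i hik] using h.path

theorem PieceOutput.sameOutputExcept (h : PieceOutput D A i j k s s')
    (hpieces : ∀ x, s'.ncell (IArr.pieces, x) = s.ncell (IArr.pieces, x)) :
    SameOutputExcept i s s' where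
  pieces _ _ := hpieces _
  breaks i' hi' j' := h.breaks_eq i' j' (.inl hi')
  output i' hi' j' r := h.output_eq i' j' r (.inl hi')

theorem Swept.hasPath (h : Swept D A i (D.T + 2) s)
    (hpieces : s.ncell (IArr.pieces, i, 0, 0) = D.T + 2) : HasPath D i s where
  pieces := hpieces
  path := by
    refine ⟨h.first, ?_, h.mono, h.optimal⟩
    rcases h.front.progress with hle | ⟨hone, -⟩
    · omega
    · exact hone

theorem run_initEnvelope (hq : D.q = 0 ∨ 1 ≤ D.q) (hlohi : ∀ r, D.lo r ≤ D.hi r)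
    (h : Input D s) (hi : s.nvar IVar.coord = i) (hA : D.IsTable (tableau s)) :
    Run D.q N initEnvelope s fun s' => Swept D (tableau s) i 0 s' ∧ SameOutputExcept i s s' ∧
      s'.ncell (IArr.pieces, i, 0, 0) = D.T + 2 := by
  refine Run.seq (Run.nput (Run.seq (Run.rput (Run.nset ?_))))
  set s₁ := ((s.putN _ _).putR _ _).setN IVar.curBudget _ with hs₁
  have hpieces (i' : ℕ) : s₁.ncell (IArr.pieces, i', 0, 0) =
      if i' = i then D.T + 2 else s.ncell (IArr.pieces, i', 0, 0) := by
    simp [hs₁, Function.update_apply, hi, h.horizon]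
  have hbreaks (i' j : ℕ) : s₁.rcell (RArr.breaks, i', j, 0) =
      if i' = i ∧ j = 0 then 0 else s.rcell (RArr.breaks, i', j, 0) := by
    simp [hs₁, Function.update_apply, hi]
  have hfirst : s₁.rcell (RArr.breaks, i, 0, 0) = 0 := (hbreaks i 0).trans (if_pos ⟨rfl, rfl⟩)
  have hbudget : s₁.nvar IVar.curBudget = D.T + 1 := by simp [hs₁, h.horizon]
  refine ⟨⟨?_, hfirst, by simp, by simp⟩, ⟨fun i' hi' => ?_, fun i' hi' j => ?_,
    fun i' _ j r => ?_⟩, (hpieces i).trans (if_pos rfl)⟩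
  · simpa [hfirst, hbudget] using hA.front_zero hq hlohi
  · exact (hpieces i').trans (if_neg hi')
  · exact (hbreaks i' j).trans (if_neg fun hij => hi' hij.1)
  · simp [hs₁]

theorem run_envelope (hq : D.q = 0 ∨ 1 ≤ D.q) (hlohi : ∀ r, D.lo r ≤ D.hi r)
    (h : Input D s) (hi : s.nvar IVar.coord = i) (hA : D.IsTable (tableau s)) (hN : D.T + 2 ≤ N) :
    Run D.q N envelope s fun s' => HasPath D i s' ∧ SameOutputExcept i s s' := by
  refine Run.seq ((run_initEnvelope hq hlohi h hi hA).mono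
    fun s₁ ⟨hswept₁, hsame₁, hpieces₁⟩ f₁ => ?_)
  have h₁ := h.frame f₁ (by decide)
  refine (Run.forLoop (fun j s' => Swept D (tableau s) i j s' ∧ SameOutputExcept i s s')
    (a := 0) (b := D.T + 2) rfl (Nat.zero_le _) hN (by decide) ?_ (fun s' hF => ?_)
    fun j s' _ _ hj hF ⟨hswept, hsame⟩ => ?_).mono
      fun s' ⟨hswept, hsame⟩ hF => ⟨hswept.hasPath ?_, hsame⟩
  · exact ⟨⟨hswept₁.front, hswept₁.first, hswept₁.mono, hswept₁.optimal⟩,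
      hsame₁.pieces, hsame₁.breaks, hsame₁.output⟩
  · simp [(h₁.frame hF (by decide)).horizon]
  · have htab : tableau s' = tableau s :=
      (tableau_frame hF (by decide)).trans (tableau_frame f₁ (by decide))
    have hi' := (hF.nvar (v := IVar.coord) (by decide)).trans
      ((f₁.nvar (v := IVar.coord) (by decide)).trans hi)
    refine (run_outputPiece (h₁.frame hF (by decide)) hi' hj rfl hswept.front.le
      (by omega)).mono fun s'' hp f => ?_
    rw [htab] at hp
    have hnext := hswept.next hq hA hp
    have hsame' := hsame.trans (hp.sameOutputExcept (f.ncell (by decide)))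
    exact ⟨⟨hnext.front, hnext.first, hnext.mono, hnext.optimal⟩,
      hsame'.pieces, hsame'.breaks, hsame'.output⟩
  · exact (hF.ncell (by decide) _).trans hpieces₁

theorem run_coordinate (hq : D.q = 0 ∨ 1 ≤ D.q) (hlohi : ∀ r, D.lo r ≤ D.hi r)
    (h : Input D s) (hi : s.nvar IVar.coord = i) (hN : 3 * D.T + 10 ≤ N) :
    Run D.q N coordinate s fun s' => HasPath D i s' ∧ SameOutputExcept i s s' := by
  refine Run.seq ((run_nodes h (by omega)).mono fun s₁ h₁ f₁ => ?_)
  refine Run.seq ((run_table hq h₁ hN).mono fun s₂ hA f₂ => ?_)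
  have hi₂ := (f₂.nvar (v := IVar.coord) (by decide)).trans
    ((f₁.nvar (v := IVar.coord) (by decide)).trans hi)
  refine (run_envelope hq hlohi (h₁.toInput.frame f₂ (by decide)) hi₂ hA (by omega)).mono
    fun s₃ ⟨hpath, hsame⟩ _ => ⟨hpath, SameOutputExcept.trans ?_ hsame⟩
  exact ⟨fun _ _ => (f₂.ncell (by decide) _).trans (f₁.ncell (by decide) _),
    fun _ _ _ => (f₂.rcell (by decide) _).trans (f₁.rcell (by decide) _),
    fun _ _ _ _ => (f₂.rcell (by decide) _).trans (f₁.rcell (by decide) _)⟩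

section Main

variable {q : ℝ} {p T : ℕ} (F : Fin (T + 1) → Fin p → ℝ) (lam : Fin (T + 1) → ℝ)

theorem input_coord (q : ℝ) (i : Fin p) (hT : s.nvar IVar.horizon = T)
    (hi : s.nvar IVar.coord = i)
    (hcenter : ∀ x, s.rcell (RArr.center, x) = (input F lam).rcell (RArr.center, x))
    (hradius : ∀ x, s.rcell (RArr.radius, x) = (input F lam).rcell (RArr.radius, x)) :
    Input (coord q F lam i) s := by
  refine ⟨hT, fun r => ?_, fun r => ?_⟩ <;>
  rw [hcenter, hradius, hi] <;>
  by_cases h : r - 1 < T + 1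
  · simp only [input, coord, dif_pos h, dif_pos (And.intro h i.2)]
  · simp only [input, coord, dif_neg h, dif_neg (fun h' => h (And.left h')), sub_zero]
  · simp only [input, coord, dif_pos h, dif_pos (And.intro h i.2)]
  · simp only [input, coord, dif_neg h, dif_neg (fun h' => h (And.left h')), add_zero]

theorem halts_main (hq : q = 0 ∨ 1 ≤ q) (hlam : ∀ t, 0 ≤ lam t) :
    HaltsWithin q (11 + p * (9 + coordinate.costBound (3 * T + 10))) main (input F lam)
      fun s => ∀ i : Fin p, HasPath (coord q F lam i) i s := by
  have halts : HaltsWithin q ((NExp.lit 0).cost + 1 + ((p - 0) * ((NExp.var IVar.dim).cost +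
      coordinate.costBound (3 * T + 10) + 8) + ((NExp.var IVar.dim).cost + 8)))
      main (input F lam) fun s => ∀ i : Fin p, i < p → HasPath (coord q F lam i) i s := by
    refine HaltsWithin.forLoop (fun b s' => ∀ i : Fin p, i < b → HasPath (coord q F lam i) i s')
      rfl (Nat.zero_le p) (by decide) (fun i hi => absurd hi (Nat.not_lt_zero _))
      (fun s' hF => hF.nvar (by decide)) fun k s' _ hkp hk hF hI => ?_
    have hin : Input (coord q F lam ⟨k, hkp⟩) s' :=
      input_coord F lam q ⟨k, hkp⟩ (hF.nvar (by decide)) hk (hF.rcell (by decide))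
        (hF.rcell (by decide))
    refine (run_coordinate hq (coord_lo_le_hi hlam q _) hin hk le_rfl).mono
      fun s'' ⟨hpath, hsame⟩ _ i hi => ?_
    have hpath' : HasPath (coord q F lam i) i s'' := by
      rcases Nat.lt_succ_iff_lt_or_eq.1 hi with hlt | rfl
      · exact (hI i hlt).congr hsame hlt.ne
      · exact hpath
    exact ⟨hpath'.pieces, hpath'.path⟩
  obtain ⟨n, s, he, hn, hI⟩ := halts
  refine ⟨n, s, he, hn.trans ?_, fun i => hI i i.2⟩
  simp only [NExp.cost, Nat.sub_zero]
  linarith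

end Main

theorem costBound_coordinate_le (p T : ℕ) :
    11 + p * (9 + coordinate.costBound (3 * T + 10)) ≤
      (20 + 2197 * coordinate.costBound 1) * (max 1 p * max 1 T ^ 3) := by
  set A := coordinate.costBound (3 * T + 10)
  set B := coordinate.costBound 1
  have hM : 1 ≤ max 1 T ^ 3 := Nat.one_le_pow _ _ (by omega)
  have hA : A ≤ B * (2197 * max 1 T ^ 3) := calc
    A ≤ B * (3 * T + 10) ^ 3 := Prog.costBound_le_mul_pow (by omega) coordinate
    _ ≤ B * (13 * max 1 T) ^ 3 := by gcongr; omega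
    _ = B * (2197 * max 1 T ^ 3) := by ring
  calc 11 + p * (9 + A)
    _ ≤ 11 * (max 1 p * max 1 T ^ 3) +
        max 1 p * (9 * max 1 T ^ 3 + B * (2197 * max 1 T ^ 3)) := by
      have : 1 ≤ max 1 p * max 1 T ^ 3 := Nat.mul_pos (by omega) hM
      exact Nat.add_le_add (by omega) (Nat.mul_le_mul (le_max_right _ _) (by omega))
    _ = _ := by ring

end Program

end ProxGL

theorem theorem1 :
    ∃ (P : RealRAM.Prog) (C : ℕ), ∀ q : ℝ, (q = 0 ∨ 1 ≤ q) →
      ∀ (p T : ℕ) (F : Fin (T + 1) → Fin p → ℝ) (lam : Fin (T + 1) → ℝ), (∀ t, 0 ≤ lam t) →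
        ∃ (n : ℕ) (s : RealRAM.Store),
          RealRAM.Exec q P (ProxGL.input F lam) n s ∧
          n ≤ C * (max 1 p * max 1 T ^ 3) ∧
          ProxGL.IsSolutionPath q F lam (ProxGL.outPieces p s) (ProxGL.outBreaks p s)
            (ProxGL.outValues p T s) := by
  refine ⟨ProxGL.Program.main, 20 + 2197 * ProxGL.Program.coordinate.costBound 1, ?_⟩
  intro q hq p T F lam hlam
  obtain ⟨n, s, hexec, hn, hs⟩ := ProxGL.Program.halts_main F lam hq hlam
  refine ⟨n, s, hexec, hn.trans (ProxGL.Program.costBound_coordinate_le p T), ?_⟩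
  refine ProxGL.isSolutionPath_of_coord hlam (x := fun i j r => s.rcell (3, i, j, r)) fun i => ?_
  have hpath := (hs i).path
  rw [← (hs i).pieces] at hpath
  exact hpath
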